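/- **Setting.** Let $\Sigma$ be an alphabet of fixed size $\sigma\ge 2$. For strings $u,v$ over $\Sigma$ let $\delta_E(u,v)$ be the edit distance (the least number of insertions, deletions and substitutions of single letters that turn $u$ into $v$), and for a string $x$ of length $m$ let $x^j=x[j\,..\,m-1]\,x[0\,..\,j-1]$, $0\le j<m$, be its rotations. The problem ApproximateCircularStringMatching is: given a pattern $x$ of length $m$, a threshold $k<m$ and a text $t$ of length $n>m$, report all factors $u$ of $t$ (as pairs of starting position and length) such that $\delta_E(u,x^j)\le k$ for some $0\le j<m$. An algorithm consists of a preprocessing program, which is given $x$ and $k$ but not the text, and a search program, which is then given $t$; both run on a unit-cost word RAM in which reading one letter of the pattern or of the text takes one step. The search time is the number of steps of the search program, and its expectation is taken over a text $t$ whose $n$ letters are independent and uniform in $\Sigma$; the pattern is arbitrary. For $0<c<1$ put $d(c)=1-c+2c\log_\sigma c+2(1-c)\log_\sigma(1-c)$ and, when $d(c)>0$, $q(c,m,k)=\left\lceil \dfrac{3\log_\sigma m+\log_\sigma \max(k,1)}{d(c)}\right\rceil$. **Theorem.** There is an absolute constant $C>0$ such that for every $\sigma\ge 2$ with $\frac12-\frac{C}{\sqrt\sigma}>0$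 the following two statements hold. 1. (Upper bound.) There are a real $c$ with $0<c<1-\frac{e}{\sqrt\sigma}$ and $d(c)>0$, one algorithm, and constants $K,B,M$ (all depending only on $\sigma$) such that for all $m\ge M$, all $k\ge 0$ with $\frac km<\frac12-\frac{C}{\sqrt\sigma}$, all $n>m$ and all patterns $x\in\Sigma^m$, on every machine whose arithmetic is modulo some $W\ge n^B$ (words of at least $B\log_2 n$ bits), and with $q=q(c,m,k)$: the preprocessing halts after at most $K\sigma^q m q$ steps; for every text $t\in\Sigma^n$ the search halts and reports exactly the factors asked for; at most $K\sigma^q$ memory cells are used; and the expected search time is at most $$K\cdot\frac{n\,(k+\log_\sigma m)}{m}.$$ 2. (Optimality.) There are constants $\kappa>0$ and $M$ (depending only on $\sigma$) such that for all $m\ge M$ and all $k\ge 0$ with $\frac km<\frac12-\frac{C}{\sqrt\sigma}$ there is a pattern $x\in\Sigma^m$ such that, for every $n>m$, every algorithm (with any preprocessing time, memory size and word size) that reports exactly the factors asked for on $x$, $k$ and every text $t\in\Sigma^n$ has expected search time at least $$\kappa\cdot\frac{n\,(k+\log_\sigma m)}{m}.$$ -/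

import Mathlib

namespace CircularMatching

/-! ### The problem -/

/-- The edit distance with unit costs, by the standard recurrence: the least number of insertions,
deletions and substitutions of letters that transform `u` into `v` (see `editDist_le_iff`). -/
def editDist {α : Type*} [DecidableEq α] : List α → List α → ℕ
  | [], v => v.length
  | a :: u, [] => (a :: u).length
  | a :: u, b :: v =>
      min (editDist u v + if a = b then 0 else 1)
        (min (editDist u (b :: v) + 1) (editDist (a :: u) v + 1))
termination_by u v => u.length + v.length

/-- `v` arises from `u` by one insertion, deletion or substitution of a letter. -/
inductive EditStep {α : Type*} : List α → List α → Prop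
  | ins (u v : List α) (b : α) : EditStep (u ++ v) (u ++ b :: v)
  | del (u v : List α) (a : α) : EditStep (u ++ a :: v) (u ++ v)
  | sub (u v : List α) (a b : α) : EditStep (u ++ a :: v) (u ++ b :: v)

/-- `EditChain e u v`: some sequence of `e` edit operations transforms `u` into `v`. -/
inductive EditChain {α : Type*} : ℕ → List α → List α → Prop
  | refl (u : List α) : EditChain 0 u u
  | step {e : ℕ} {u v w : List α} (h : EditChain e u v) (h' : EditStep v w) :
      EditChain (e + 1) u w

theorem editDist_nil_right {α : Type*} [DecidableEq α] (u : List α) :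
    editDist u [] = u.length := by
  cases u <;> simp [editDist]

theorem editDist_cons_cons_le {α : Type*} [DecidableEq α] (a : α) (u v : List α) :
    editDist (a :: u) (a :: v) ≤ editDist u v := by
  rw [editDist]; simp

theorem editDist_cons_left_le {α : Type*} [DecidableEq α] (a : α) (u v : List α) :
    editDist (a :: u) v ≤ editDist u v + 1 := by
  cases v with
  | nil => simp [editDist_nil_right]
  | cons b v => rw [editDist]; omega

theorem editDist_cons_right_le {α : Type*} [DecidableEq α] (b : α) (u v : List α) :
    editDist u (b :: v) ≤ editDist u v + 1 := by
  cases u with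
  | nil => simp [editDist]
  | cons a u => rw [editDist]; omega

theorem editDist_self {α : Type*} [DecidableEq α] (u : List α) : editDist u u = 0 := by
  induction u with
  | nil => simp [editDist]
  | cons a u ih => have := editDist_cons_cons_le a u u; omega

theorem editDist_le_cons_right {α : Type*} [DecidableEq α] (b : α) (u v : List α) :
    editDist u v ≤ editDist u (b :: v) + 1 := by
  induction u with
  | nil => simp [editDist]; omega
  | cons a u ih =>
    have h := editDist_cons_left_le a u v
    rw [editDist.eq_3]
    omega

theorem editDist_sub_le {α : Type*} [DecidableEq α] (a b : α) (u v : List α) :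
    editDist u (b :: v) ≤ editDist u (a :: v) + 1 := by
  induction u with
  | nil => simp [editDist]
  | cons d u ih =>
    rw [editDist.eq_3, editDist.eq_3 d u a v]
    split_ifs <;> omega

theorem editDist_append_le {α : Type*} [DecidableEq α] {v w : List α}
    (h : ∀ u, editDist u w ≤ editDist u v + 1) (p u : List α) :
    editDist u (p ++ w) ≤ editDist u (p ++ v) + 1 := by
  induction p generalizing u with
  | nil => exact h u
  | cons b p ih =>
    induction u with
    | nil => have := ih []; simp only [editDist, List.cons_append, List.length_cons] at *; omega
    | cons a u ihu =>
      have h₁ := ih u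
      have h₂ := ih (a :: u)
      simp only [List.cons_append] at *
      rw [editDist.eq_3, editDist.eq_3 a u b (p ++ v)]
      omega

theorem editDist_le_of_step {α : Type*} [DecidableEq α] {v w : List α} (h : EditStep v w)
    (u : List α) : editDist u w ≤ editDist u v + 1 := by
  cases h with
  | ins p v b => exact editDist_append_le (fun u => editDist_cons_right_le b u v) p u
  | del p v a => exact editDist_append_le (fun u => editDist_le_cons_right a u v) p u
  | sub p v a b => exact editDist_append_le (fun u => editDist_sub_le a b u v) p u

theorem EditStep.cons {α : Type*} {v w : List α} (a : α) (h : EditStep v w) :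
    EditStep (a :: v) (a :: w) := by
  cases h with
  | ins p v b => exact .ins (a :: p) v b
  | del p v d => exact .del (a :: p) v d
  | sub p v d b => exact .sub (a :: p) v d b

theorem EditChain.cons {α : Type*} {e : ℕ} {v w : List α} (a : α) (h : EditChain e v w) :
    EditChain e (a :: v) (a :: w) := by
  induction h with
  | refl => exact .refl _
  | step _ h' ih => exact .step ih (h'.cons a)

theorem EditChain.trans_step {α : Type*} {e : ℕ} {u v w : List α} (h' : EditStep u v)
    (h : EditChain e v w) : EditChain (e + 1) u w := by
  induction h with
  | refl => exact .step (.refl _) h'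
  | step _ h₂ ih => exact .step (ih h') h₂

theorem editChain_editDist {α : Type*} [DecidableEq α] (u v : List α) :
    EditChain (editDist u v) u v := by
  induction u generalizing v with
  | nil =>
    induction v with
    | nil => simpa [editDist] using EditChain.refl []
    | cons b v ih =>
      have h := EditChain.step ih (.ins [] v b)
      simpa [editDist] using h
  | cons a u ihu =>
    induction v with
    | nil =>
      have h := EditChain.trans_step (.del [] u a) (ihu [])
      simpa [editDist_nil_right] using h
    | cons b v ihv =>
      have h₁ := (ihu v).cons b
      have h₂ := EditChain.trans_step (.del [] u a) (ihu (b :: v))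
      have h₃ := EditChain.step ihv (.ins [] v b)
      rw [editDist]
      rcases min_choice (editDist u v + if a = b then 0 else 1)
        (min (editDist u (b :: v) + 1) (editDist (a :: u) v + 1)) with h | h
      · rw [h]
        split_ifs with hab
        · subst hab; exact h₁
        · exact EditChain.trans_step (.sub [] u a b) h₁
      · rw [h]
        rcases min_choice (editDist u (b :: v) + 1) (editDist (a :: u) v + 1) with h | h
        · rw [h]; exact h₂
        · rw [h]; exact h₃

/-- The edit distance is the least number of edit operations. -/
theorem editDist_le_iff {α : Type*} [DecidableEq α] (k : ℕ) (u v : List α) :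
    editDist u v ≤ k ↔ ∃ e ≤ k, EditChain e u v := by
  refine ⟨fun h => ⟨_, h, editChain_editDist u v⟩, ?_⟩
  rintro ⟨e, he, h⟩
  refine le_trans ?_ he
  clear he
  induction h with
  | refl u => simp [editDist_self]
  | step _ h' ih => exact (editDist_le_of_step h' _).trans (Nat.add_le_add_right ih 1)

/-- The factor of `t` of length `l` starting at position `i` exists and has edit distance at most
`k` from some rotation `x^j`, `0 ≤ j < |x|`, of `x`. -/
def IsOccurrence {α : Type*} [DecidableEq α] (x t : List α) (k i l : ℕ) : Prop :=
  i + l ≤ t.length ∧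
    ∃ j < x.length, editDist ((t.drop i).take l) (x.rotate j) ≤ k

/-! ### The machine model: a word RAM with unit-cost instructions -/

/-- Elementary instructions; the arguments (but for the value of `const`) are register names.
* `const r v`: `r := v`; `copy r a`: `r := a`;
* `add`, `sub` (truncated), `mul`, `div` (integer division): `r := a ∘ b`;
* `load r a`: `r := mem[a]`; `store a b`: `mem[a] := b`;
* `pat r a`: `r := x[a]`, a letter of the pattern;
* `txt r a`: `r := t[a]`, a letter of the text;
* `report a b`: append the pair `(a, b)` to the output. -/
inductive Instr
  | const (r v : ℕ)
  | copy (r a : ℕ)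
  | add (r a b : ℕ)
  | sub (r a b : ℕ)
  | mul (r a b : ℕ)
  | div (r a b : ℕ)
  | load (r a : ℕ)
  | store (a b : ℕ)
  | pat (r a : ℕ)
  | txt (r a : ℕ)
  | report (a b : ℕ)

/-- Programs: `ite a b c₁ c₂` is `if a < b then c₁ else c₂`, and `loop a b c` is
`while a < b do c`, for registers `a` and `b`. -/
inductive Cmd
  | instr (i : Instr)
  | seq (c₁ c₂ : Cmd)
  | ite (a b : ℕ) (c₁ c₂ : Cmd)
  | loop (a b : ℕ) (c : Cmd)

/-- What a run does not change: arithmetic is modulo `word`, there are `size` memory cells, and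
`pattern` and `text` are read-only. -/
structure Env (σ : ℕ) where
  word : ℕ
  size : ℕ
  pattern : List (Fin σ)
  text : List (Fin σ)

/-- Contents of the registers, contents of the memory, and the output written so far. A program
mentions only finitely many registers. -/
structure State where
  reg : ℕ → ℕ
  mem : ℕ → ℕ
  out : List (ℕ × ℕ)

/-- Write a value, reduced modulo `w`, to a register. -/
def State.setReg (s : State) (w r v : ℕ) : State :=
  { s with reg := Function.update s.reg r (v % w) }

/-- The effect of one instruction. Accesses outside the memory, the pattern or the text fail. -/
def Instr.run {σ : ℕ} (E : Env σ) (s : State) : Instr → Option State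
  | .const r v => some (s.setReg E.word r v)
  | .copy r a => some (s.setReg E.word r (s.reg a))
  | .add r a b => some (s.setReg E.word r (s.reg a + s.reg b))
  | .sub r a b => some (s.setReg E.word r (s.reg a - s.reg b))
  | .mul r a b => some (s.setReg E.word r (s.reg a * s.reg b))
  | .div r a b => some (s.setReg E.word r (s.reg a / s.reg b))
  | .load r a => if s.reg a < E.size then some (s.setReg E.word r (s.mem (s.reg a))) else none
  | .store a b =>
      if s.reg a < E.size then
        some { s with mem := Function.update s.mem (s.reg a) (s.reg b) }
      else none
  | .pat r a =>
      if h : s.reg a < E.pattern.length then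
        some (s.setReg E.word r (E.pattern[s.reg a] : Fin σ).val)
      else none
  | .txt r a =>
      if h : s.reg a < E.text.length then
        some (s.setReg E.word r (E.text[s.reg a] : Fin σ).val)
      else none
  | .report a b => some { s with out := s.out ++ [(s.reg a, s.reg b)] }

/-- `Exec E c s T s'`: started in state `s`, the program `c` halts in state `s'` after exactly `T`
steps. Every instruction and every evaluation of a test is one step. -/
inductive Exec {σ : ℕ} (E : Env σ) : Cmd → State → ℕ → State → Prop
  | instr {i : Instr} {s s' : State} (h : i.run E s = some s') : Exec E (.instr i) s 1 s'
  | seq {c₁ c₂ : Cmd} {s s₁ s₂ : State} {T₁ T₂ : ℕ} (h₁ : Exec E c₁ s T₁ s₁)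
      (h₂ : Exec E c₂ s₁ T₂ s₂) : Exec E (.seq c₁ c₂) s (T₁ + T₂) s₂
  | iteTrue {a b : ℕ} {c₁ c₂ : Cmd} {s s' : State} {T : ℕ} (hab : s.reg a < s.reg b)
      (h : Exec E c₁ s T s') : Exec E (.ite a b c₁ c₂) s (T + 1) s'
  | iteFalse {a b : ℕ} {c₁ c₂ : Cmd} {s s' : State} {T : ℕ} (hab : ¬ s.reg a < s.reg b)
      (h : Exec E c₂ s T s') : Exec E (.ite a b c₁ c₂) s (T + 1) s'
  | loopDone {a b : ℕ} {c : Cmd} {s : State} (hab : ¬ s.reg a < s.reg b) :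
      Exec E (.loop a b c) s 1 s
  | loopStep {a b : ℕ} {c : Cmd} {s s₁ s₂ : State} {T₁ T₂ : ℕ} (hab : s.reg a < s.reg b)
      (h₁ : Exec E c s T₁ s₁) (h₂ : Exec E (.loop a b c) s₁ T₂ s₂) :
      Exec E (.loop a b c) s (T₁ + T₂ + 1) s₂

/-! ### Matching algorithms -/

/-- A preprocessing program, which sees the pattern but not the text, and a search program. -/
structure Algorithm where
  prep : Cmd
  search : Cmd

/-- The initial state of the preprocessing: `m` in register 0 and `k` in register 1. -/
def State.init (m k : ℕ) : State where
  reg := fun r => if r = 0 then m else if r = 1 then k else 0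
  mem := fun _ => 0
  out := []

/-- The search starts from the registers and the memory that the preprocessing leaves behind, with
the length `n` of the text in register 2 and with empty output. -/
def State.startSearch (s : State) (n : ℕ) : State where
  reg := Function.update s.reg 2 n
  mem := s.mem
  out := []

/-- On a machine with arithmetic modulo `word` and `size` memory cells, `A` preprocesses the
pattern `x` and the threshold `k` in `Tp` steps, without access to a text; then, for every text `t`
of length `n`, its search halts after `Ts t` steps, having reported exactly the pairs
(starting position, length) of the factors of `t` that are within edit distance `k` of a rotation
of `x`. -/
def Algorithm.Solves {σ : ℕ} (A : Algorithm) (word size : ℕ) (x : List (Fin σ)) (k n : ℕ)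
    (Tp : ℕ) (Ts : (Fin n → Fin σ) → ℕ) : Prop :=
  ∃ s : State, Exec ⟨word, size, x, []⟩ A.prep (State.init x.length k) Tp s ∧
    ∀ t : Fin n → Fin σ, ∃ s' : State,
      Exec ⟨word, size, x, List.ofFn t⟩ A.search (s.startSearch n) (Ts t) s' ∧
      ∀ i l : ℕ, (i, l) ∈ s'.out ↔ IsOccurrence x (List.ofFn t) k i l

/-- The expectation of `T t` for a text `t` whose `n` letters are independent and uniform. -/
noncomputable def expectedTime {σ n : ℕ} (T : (Fin n → Fin σ) → ℕ) : ℝ :=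
  (∑ t : Fin n → Fin σ, (T t : ℝ)) / (σ : ℝ) ^ n

/-! ### The length of the `q`-grams -/

/-- `d = 1 - c + 2 c log_σ c + 2 (1 - c) log_σ (1 - c)`. -/
noncomputable def gramExponent (σ : ℕ) (c : ℝ) : ℝ :=
  1 - c + 2 * c * Real.logb σ c + 2 * (1 - c) * Real.logb σ (1 - c)

/-- `q = (3 log_σ m + log_σ k) / d`, rounded up; `log_σ k` is read as `0` for `k = 0`. -/
noncomputable def gramLength (σ : ℕ) (c : ℝ) (m k : ℕ) : ℕ :=
  ⌈(3 * Real.logb σ m + Real.logb σ (max k 1 : ℕ)) / gramExponent σ c⌉₊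

end CircularMatching

open CircularMatching

namespace CircularMatching

/-! Upper bound. Put `lam = ⌊log_σ m⌋` and cut text into grams of length `q = R N lam`. The
preprocessing tabulates, for each of the `σ ^ q` grams, its distance from the nearest factor of `x
++ x`; every rotation of `x` is such a factor. An occurrence has length at least `m - k`, so all
occurrences that start in a window of `sh` positions, where `sh - 1 + L q = m - k`, contain the same
block of `L` grams. Edit distance is superadditive over pieces (`exists_split_editDist_le`), so the
sum of the `L` table entries is a lower bound for the distance, and a window whose sum exceeds `k`
is skipped without loss (`gramSum_le_of_close`). The other windows are checked by brute force in
`O(m ^ 5)` steps.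

With `h = (R - 1) N lam` and `L = k / h + 11`, a window survives only if ten of its grams have table
entry at most `h`. A gram that close to a fixed string shares with it a subsequence of length `q - h
= N lam`, so there are few such grams (`card_close_prefix_le`). Disjoint grams of a random text are
independent, and `R`, `N` are chosen so that ten close grams have probability `O(m ^ (-5))`
(`card_gramSum_mul_le`). Verification therefore costs `O(1)` per window on average, reading costs
`O(k + log m)`, and `sh` is at least `m / σ` (`windowShift_bounds`), so there are `O(n / m)`
windows. Concrete RAM programs are verified by a logic of triples with time bounds.

Lower bound. By the probabilistic method there is a pattern in which any prescribed `l` letters at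
any prescribed `l` positions appear in some rotation, for `l` about `log_σ m / 8`
(`exists_universal`). Consider a block of `m` text letters that is not an occurrence. If at most `l`
of its letters were read, the unread ones could be changed so that the block becomes a rotation; if
at most `k` were read, changing the unread ones gives distance at most `k` from `x`. The run would
be the same in both cases, so more than `max k l` letters are read (`card_reads_gt`). At least half
of the texts have no occurrence at a given block (`card_isOccurrence_le`), and the `n / m` disjoint
blocks add up. -/

/-! ### Arithmetic expressions and a total-correctness logic with time bounds -/

/-- The letter at position `i` of a list of letters, as a number (and `0` outside). -/
def letter {σ : ℕ} (l : List (Fin σ)) (i : ℕ) : ℕ := ((l[i]?).map Fin.val).getD 0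

theorem letter_of_lt {σ : ℕ} {l : List (Fin σ)} {i : ℕ} (h : i < l.length) :
    letter l i = (l[i]).val := by
  simp [letter, h]

/-- Arithmetic expressions over the registers. -/
inductive Arith
  | var (r : ℕ)
  | lit (v : ℕ)
  | add (a b : Arith)
  | sub (a b : Arith)
  | mul (a b : Arith)
  | div (a b : Arith)
  | mem (a : Arith)
  | pat (a : Arith)
  | txt (a : Arith)

/-- Programs keep their variables in the registers below `40`; the others hold temporary values. -/
abbrev numVars : ℕ := 40

namespace Arith

/-- Evaluate an expression into register `d`, using registers from `d` on only. -/
def compile : Arith → ℕ → Cmd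
  | var r, d => .instr (.copy d r)
  | lit v, d => .instr (.const d v)
  | add a b, d => .seq (a.compile d) (.seq (b.compile (d + 1)) (.instr (.add d d (d + 1))))
  | sub a b, d => .seq (a.compile d) (.seq (b.compile (d + 1)) (.instr (.sub d d (d + 1))))
  | mul a b, d => .seq (a.compile d) (.seq (b.compile (d + 1)) (.instr (.mul d d (d + 1))))
  | div a b, d => .seq (a.compile d) (.seq (b.compile (d + 1)) (.instr (.div d d (d + 1))))
  | mem a, d => .seq (a.compile d) (.instr (.load d d))
  | pat a, d => .seq (a.compile d) (.instr (.pat d d))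
  | txt a, d => .seq (a.compile d) (.instr (.txt d d))

/-- The number of steps of `compile`. -/
def cost : Arith → ℕ
  | var _ | lit _ => 1
  | add a b | sub a b | mul a b | div a b => a.cost + b.cost + 1
  | mem a | pat a | txt a => a.cost + 1

/-- The value of an expression when no overflow occurs. -/
def eval {σ : ℕ} (E : Env σ) (s : State) : Arith → ℕ
  | var r => s.reg r
  | lit v => v
  | add a b => a.eval E s + b.eval E s
  | sub a b => a.eval E s - b.eval E s
  | mul a b => a.eval E s * b.eval E s
  | div a b => a.eval E s / b.eval E s
  | mem a => s.mem (a.eval E s)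
  | pat a => letter E.pattern (a.eval E s)
  | txt a => letter E.text (a.eval E s)

/-- No overflow and no illegal access occurs in the evaluation of the expression. -/
def Ok {σ : ℕ} (E : Env σ) (s : State) : Arith → Prop
  | var r => r < 40
  | lit v => v < E.word
  | add a b => a.Ok E s ∧ b.Ok E s ∧ a.eval E s + b.eval E s < E.word
  | sub a b => a.Ok E s ∧ b.Ok E s
  | mul a b => a.Ok E s ∧ b.Ok E s ∧ a.eval E s * b.eval E s < E.word
  | div a b => a.Ok E s ∧ b.Ok E s
  | mem a => a.Ok E s ∧ a.eval E s < E.size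
  | pat a => a.Ok E s ∧ a.eval E s < E.pattern.length
  | txt a => a.Ok E s ∧ a.eval E s < E.text.length

end Arith

/-- `s₀` and `s` agree but for the temporary registers, and `s₀` holds reduced values only. -/
structure Sim {σ : ℕ} (E : Env σ) (s₀ s : State) : Prop where
  reg : ∀ r < numVars, s₀.reg r = s.reg r
  mem : s₀.mem = s.mem
  out : s₀.out = s.out
  reg_lt : ∀ r, s₀.reg r < E.word
  mem_lt : ∀ a, s₀.mem a < E.word

theorem Sim.setReg_temp {σ : ℕ} {E : Env σ} {s₀ s : State} (h : Sim E s₀ s) {d : ℕ}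
    (hd : numVars ≤ d) (v : ℕ) : Sim E (s₀.setReg E.word d v) s := by
  have hW : 0 < E.word := (Nat.zero_le _).trans_lt (h.reg_lt 0)
  refine ⟨fun r hr => ?_, h.mem, h.out, fun r => ?_, h.mem_lt⟩
  · have : r ≠ d := by omega
    simp [State.setReg, this, h.reg r hr]
  · by_cases hr : r = d
    · subst hr; simpa [State.setReg] using Nat.mod_lt _ hW
    · simpa [State.setReg, hr] using h.reg_lt r

/-- Temporaries follow a stack discipline: evaluation into `d` leaves all registers below `d` alone,
so a left operand survives the evaluation of the right one. -/
theorem Arith.compile_exec {σ : ℕ} {E : Env σ} (hσ : σ ≤ E.word) {s : State} (e : Arith)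
    (he : e.Ok E s) :
    ∀ {d : ℕ}, numVars ≤ d → ∀ {s₀ : State}, Sim E s₀ s →
      ∃ s₁, Exec E (e.compile d) s₀ e.cost s₁ ∧ Sim E s₁ s ∧ s₁.reg d = e.eval E s ∧
        ∀ r < d, s₁.reg r = s₀.reg r := by
  have bin : ∀ (i : Instr) (v : ℕ → ℕ → ℕ) (a b : Arith) (d : ℕ),
      (∀ s : State, i.run E s = some (s.setReg E.word d (v (s.reg d) (s.reg (d + 1))))) →
      numVars ≤ d → ∀ s₀ : State,
      (∃ s₁, Exec E (a.compile d) s₀ a.cost s₁ ∧ Sim E s₁ s ∧ s₁.reg d = a.eval E s ∧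
        ∀ r < d, s₁.reg r = s₀.reg r) →
      (∀ s₁, Sim E s₁ s → ∃ s₂, Exec E (b.compile (d + 1)) s₁ b.cost s₂ ∧ Sim E s₂ s ∧
        s₂.reg (d + 1) = b.eval E s ∧ ∀ r < d + 1, s₂.reg r = s₁.reg r) →
      ((∀ s₂ : State, Sim E s₂ s → s₂.reg d = a.eval E s → s₂.reg (d + 1) = b.eval E s →
        v (a.eval E s) (b.eval E s) < E.word)) →
      ∃ s₁, Exec E (.seq (a.compile d) (.seq (b.compile (d + 1)) (.instr i))) s₀
          (a.cost + b.cost + 1) s₁ ∧ Sim E s₁ s ∧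
        s₁.reg d = v (a.eval E s) (b.eval E s) ∧ ∀ r < d, s₁.reg r = s₀.reg r := by
    intro i v a b d hi hd s₀ ha hb hv
    obtain ⟨s₁, h₁, hs₁, hr₁, hf₁⟩ := ha
    obtain ⟨s₂, h₂, hs₂, hr₂, hf₂⟩ := hb s₁ hs₁
    have hda : s₂.reg d = a.eval E s := by rw [hf₂ d (by omega), hr₁]
    refine ⟨_, by
      rw [add_assoc]
      exact Exec.seq h₁ (Exec.seq h₂ (Exec.instr (hi s₂))), hs₂.setReg_temp hd _, ?_, ?_⟩
    · simp only [State.setReg, Function.update_self, hda, hr₂]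
      exact Nat.mod_eq_of_lt (hv s₂ hs₂ hda hr₂)
    · intro r hr
      have : r ≠ d := by omega
      simp only [State.setReg, Function.update_of_ne this]
      rw [hf₂ r (by omega), hf₁ r hr]
  induction e with
  | var r =>
    intro d hd s₀ hs
    have hr : r < numVars := he
    refine ⟨_, Exec.instr rfl, hs.setReg_temp hd _, ?_, fun r' hr' => ?_⟩
    · simp only [State.setReg, Function.update_self, eval, ← hs.reg r hr]
      exact Nat.mod_eq_of_lt (hs.reg_lt r)
    · have : r' ≠ d := by omega
      simp [State.setReg, this]
  | lit v =>
    intro d hd s₀ hs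
    refine ⟨_, Exec.instr rfl, hs.setReg_temp hd _, ?_, fun r' hr' => ?_⟩
    · simp only [State.setReg, Function.update_self, eval]
      exact Nat.mod_eq_of_lt he
    · have : r' ≠ d := by omega
      simp [State.setReg, this]
  | add a b iha ihb =>
    intro d hd s₀ hs
    exact bin (.add d d (d + 1)) (· + ·) a b d (fun _ => rfl) hd s₀ (iha he.1 hd hs)
      (fun s₁ hs₁ => ihb he.2.1 (by omega) hs₁) (fun _ _ _ _ => he.2.2)
  | sub a b iha ihb =>
    intro d hd s₀ hs
    -- No overflow condition is needed here: a truncated difference never exceeds its left operand,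
    -- which is already reduced.
    exact bin (.sub d d (d + 1)) (· - ·) a b d (fun _ => rfl) hd s₀ (iha he.1 hd hs)
      (fun s₁ hs₁ => ihb he.2 (by omega) hs₁) (fun s₂ hs₂ h _ => by
        have := hs₂.reg_lt d
        omega)
  | mul a b iha ihb =>
    intro d hd s₀ hs
    exact bin (.mul d d (d + 1)) (· * ·) a b d (fun _ => rfl) hd s₀ (iha he.1 hd hs)
      (fun s₁ hs₁ => ihb he.2.1 (by omega) hs₁) (fun _ _ _ _ => he.2.2)
  | div a b iha ihb =>
    intro d hd s₀ hs
    exact bin (.div d d (d + 1)) (· / ·) a b d (fun _ => rfl) hd s₀ (iha he.1 hd hs)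
      (fun s₁ hs₁ => ihb he.2 (by omega) hs₁) (fun s₂ hs₂ h _ => by
        have := hs₂.reg_lt d
        exact (Nat.div_le_self _ _).trans_lt (h ▸ this))
  | mem a iha =>
    intro d hd s₀ hs
    obtain ⟨s₁, h₁, hs₁, hr₁, hf₁⟩ := iha he.1 hd hs
    have hlt : s₁.reg d < E.size := hr₁ ▸ he.2
    refine ⟨_, Exec.seq h₁ (Exec.instr (if_pos hlt)),
      hs₁.setReg_temp hd _, ?_, fun r hr => ?_⟩
    · simp only [State.setReg, Function.update_self, hr₁, eval, ← hs₁.mem]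
      exact Nat.mod_eq_of_lt (hs₁.mem_lt _)
    · have : r ≠ d := by omega
      simp [State.setReg, this, hf₁ r hr]
  | pat a iha =>
    intro d hd s₀ hs
    obtain ⟨s₁, h₁, hs₁, hr₁, hf₁⟩ := iha he.1 hd hs
    have hlt : s₁.reg d < E.pattern.length := hr₁ ▸ he.2
    refine ⟨_, Exec.seq h₁ (Exec.instr (dif_pos hlt)),
      hs₁.setReg_temp hd _, ?_, fun r hr => ?_⟩
    · simp only [State.setReg, Function.update_self, eval, letter_of_lt he.2, hr₁]
      exact Nat.mod_eq_of_lt ((Fin.is_lt _).trans_le hσ)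
    · have : r ≠ d := by omega
      simp [State.setReg, this, hf₁ r hr]
  | txt a iha =>
    intro d hd s₀ hs
    obtain ⟨s₁, h₁, hs₁, hr₁, hf₁⟩ := iha he.1 hd hs
    have hlt : s₁.reg d < E.text.length := hr₁ ▸ he.2
    refine ⟨_, Exec.seq h₁ (Exec.instr (dif_pos hlt)),
      hs₁.setReg_temp hd _, ?_, fun r hr => ?_⟩
    · simp only [State.setReg, Function.update_self, eval, letter_of_lt he.2, hr₁]
      exact Nat.mod_eq_of_lt ((Fin.is_lt _).trans_le hσ)
    · have : r ≠ d := by omega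
      simp [State.setReg, this, hf₁ r hr]

/-- Total correctness with a time bound: started in any state that looks like `s`, the program `c`
halts after at most `t` steps in a state that looks like one with property `Q`. -/
def HT {σ : ℕ} (E : Env σ) (c : Cmd) (s : State) (t : ℕ) (Q : State → Prop) : Prop :=
  ∀ s₀, Sim E s₀ s → ∃ T s₁ s', Exec E c s₀ T s₁ ∧ T ≤ t ∧ Sim E s₁ s' ∧ Q s'

/-- Change of one register. -/
def State.set (s : State) (r v : ℕ) : State := { s with reg := Function.update s.reg r v }

/-- Change of one memory cell. -/
def State.put (s : State) (a v : ℕ) : State := { s with mem := Function.update s.mem a v }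

@[simp] theorem State.set_reg (s : State) (r v r' : ℕ) :
    (s.set r v).reg r' = if r' = r then v else s.reg r' := by
  simp [State.set, Function.update_apply]

@[simp] theorem State.set_mem (s : State) (r v : ℕ) : (s.set r v).mem = s.mem := rfl

@[simp] theorem State.set_out (s : State) (r v : ℕ) : (s.set r v).out = s.out := rfl

@[simp] theorem State.put_reg (s : State) (a v : ℕ) : (s.put a v).reg = s.reg := rfl

@[simp] theorem State.put_out (s : State) (a v : ℕ) : (s.put a v).out = s.out := rfl

@[simp] theorem State.put_mem (s : State) (a v a' : ℕ) :
    (s.put a v).mem a' = if a' = a then v else s.mem a' := by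
  simp [State.put, Function.update_apply]

/-- Append a pair to the output. -/
def State.emit (s : State) (p : ℕ × ℕ) : State := { s with out := s.out ++ [p] }

@[simp] theorem State.emit_reg (s : State) (p : ℕ × ℕ) : (s.emit p).reg = s.reg := rfl

@[simp] theorem State.emit_mem (s : State) (p : ℕ × ℕ) : (s.emit p).mem = s.mem := rfl

@[simp] theorem State.emit_out (s : State) (p : ℕ × ℕ) : (s.emit p).out = s.out ++ [p] := rfl

/-- Assignment of an expression to a variable. -/
def assign (r : ℕ) (e : Arith) : Cmd := .seq (e.compile numVars) (.instr (.copy r numVars))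

/-- Assignment of an expression to a memory cell. -/
def storeAt (a e : Arith) : Cmd :=
  .seq (a.compile numVars)
    (.seq (e.compile (numVars + 1)) (.instr (.store numVars (numVars + 1))))

/-- Output of a pair of values. -/
def emitPair (a e : Arith) : Cmd :=
  .seq (a.compile numVars)
    (.seq (e.compile (numVars + 1)) (.instr (.report numVars (numVars + 1))))

/-- Conditional execution. -/
def whenLt (a b : Arith) (c : Cmd) : Cmd :=
  .seq (a.compile numVars)
    (.seq (b.compile (numVars + 1))
      (.ite numVars (numVars + 1) c (.instr (.copy numVars numVars))))

/-- `for i := 0 to e - 1 do c`, with the value of `e` kept in the variable `u`. -/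
def forTo (i u : ℕ) (e : Arith) (c : Cmd) : Cmd :=
  .seq (assign u e) (.seq (assign i (.lit 0))
    (.loop i u (.seq c (assign i (.add (.var i) (.lit 1))))))

namespace HT

variable {σ : ℕ} {E : Env σ} {s : State} {t t₁ t₂ : ℕ} {Q : State → Prop}

theorem le {c : Cmd} (h : HT E c s t₁ Q) (ht : t₁ ≤ t₂) : HT E c s t₂ Q := by
  intro s₀ hs
  obtain ⟨T, s₁, s', h₁, h₂, h₃⟩ := h s₀ hs
  exact ⟨T, s₁, s', h₁, h₂.trans ht, h₃⟩

theorem mono {c : Cmd} {P : State → Prop} (h : HT E c s t P) (hPQ : ∀ s, P s → Q s) :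
    HT E c s t Q := by
  intro s₀ hs
  obtain ⟨T, s₁, s', h₁, h₂, h₃, h₄⟩ := h s₀ hs
  exact ⟨T, s₁, s', h₁, h₂, h₃, hPQ _ h₄⟩

theorem seq {c₁ c₂ : Cmd} (h : HT E c₁ s t₁ fun s' => HT E c₂ s' t₂ Q) :
    HT E (.seq c₁ c₂) s (t₁ + t₂) Q := by
  intro s₀ hs
  obtain ⟨T₁, s₁, s', h₁, hT₁, hs₁, h₂⟩ := h s₀ hs
  obtain ⟨T₂, s₂, s'', h₃, hT₂, hs₂, hQ⟩ := h₂ s₁ hs₁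
  exact ⟨_, s₂, s'', h₁.seq h₃, Nat.add_le_add hT₁ hT₂, hs₂, hQ⟩

theorem assign (hσ : σ ≤ E.word) {r : ℕ} {e : Arith} (hr : r < numVars) (he : e.Ok E s)
    (hQ : Q (s.set r (e.eval E s))) : HT E (assign r e) s (e.cost + 1) Q := by
  intro s₀ hs
  obtain ⟨s₁, h₁, hs₁, hv, -⟩ := e.compile_exec hσ he le_rfl hs
  refine ⟨_, _, _, h₁.seq (Exec.instr rfl), le_rfl, ?_, hQ⟩
  have hmod : e.eval E s % E.word = e.eval E s :=
    Nat.mod_eq_of_lt (hv ▸ hs₁.reg_lt _)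
  refine ⟨fun r' hr' => ?_, hs₁.mem, hs₁.out, fun r' => ?_, hs₁.mem_lt⟩
  · by_cases h : r' = r
    · subst h; simp [State.setReg, hv, hmod]
    · simp [State.setReg, h, hs₁.reg r' hr']
  · by_cases h : r' = r
    · subst h; simpa [State.setReg, hv, hmod] using hv ▸ hs₁.reg_lt numVars
    · simpa [State.setReg, h] using hs₁.reg_lt r'

theorem storeAt (hσ : σ ≤ E.word) {a e : Arith} (ha : a.Ok E s) (hsize : a.eval E s < E.size)
    (he : e.Ok E s) (hQ : Q (s.put (a.eval E s) (e.eval E s))) :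
    HT E (storeAt a e) s (a.cost + e.cost + 1) Q := by
  intro s₀ hs
  obtain ⟨s₁, h₁, hs₁, hv₁, -⟩ := a.compile_exec hσ ha le_rfl hs
  obtain ⟨s₂, h₂, hs₂, hv₂, hf⟩ := e.compile_exec hσ he (Nat.le_succ numVars) hs₁
  have hva : s₂.reg numVars = a.eval E s := by rw [hf _ (Nat.lt_succ_self _), hv₁]
  refine ⟨_, _, _, h₁.seq (h₂.seq (Exec.instr (by
    simp only [Instr.run]; rw [if_pos (by rw [hva]; exact hsize)]))), by rw [add_assoc], ?_, hQ⟩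
  refine ⟨hs₂.reg, ?_, hs₂.out, hs₂.reg_lt, fun x => ?_⟩
  · simp only [State.put, hva, hv₂, hs₂.mem]
  · simp only [Function.update_apply]
    split_ifs
    · exact hs₂.reg_lt _
    · exact hs₂.mem_lt _

theorem emitPair (hσ : σ ≤ E.word) {a e : Arith} (ha : a.Ok E s) (he : e.Ok E s)
    (hQ : Q (s.emit (a.eval E s, e.eval E s))) :
    HT E (emitPair a e) s (a.cost + e.cost + 1) Q := by
  intro s₀ hs
  obtain ⟨s₁, h₁, hs₁, hv₁, -⟩ := a.compile_exec hσ ha le_rfl hs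
  obtain ⟨s₂, h₂, hs₂, hv₂, hf⟩ := e.compile_exec hσ he (Nat.le_succ numVars) hs₁
  have hva : s₂.reg numVars = a.eval E s := by rw [hf _ (Nat.lt_succ_self _), hv₁]
  refine ⟨_, _, _, h₁.seq (h₂.seq (Exec.instr rfl)), by rw [add_assoc], ?_, hQ⟩
  exact ⟨hs₂.reg, hs₂.mem, by simp only [State.emit, hva, hv₂, hs₂.out], hs₂.reg_lt, hs₂.mem_lt⟩

/-- The branch not taken is a dummy copy of one step, hence `1 ≤ t`. -/
theorem whenLt (hσ : σ ≤ E.word) {a b : Arith} {c : Cmd} (ha : a.Ok E s) (hb : b.Ok E s)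
    (ht : 1 ≤ t) (hc : a.eval E s < b.eval E s → HT E c s t Q)
    (hQ : ¬ a.eval E s < b.eval E s → Q s) :
    HT E (whenLt a b c) s (a.cost + b.cost + (t + 1)) Q := by
  intro s₀ hs
  obtain ⟨s₁, h₁, hs₁, hv₁, -⟩ := a.compile_exec hσ ha le_rfl hs
  obtain ⟨s₂, h₂, hs₂, hv₂, hf⟩ := b.compile_exec hσ hb (Nat.le_succ numVars) hs₁
  have hva : s₂.reg numVars = a.eval E s := by rw [hf _ (Nat.lt_succ_self _), hv₁]
  by_cases h : a.eval E s < b.eval E s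
  · obtain ⟨T, s₃, s', h₃, hT, hs', hq⟩ := hc h s₂ hs₂
    exact ⟨_, s₃, s', h₁.seq (h₂.seq (Exec.iteTrue (by rw [hva, hv₂]; exact h) h₃)), by omega,
      hs', hq⟩
  · exact ⟨_, _, s, h₁.seq (h₂.seq (Exec.iteFalse (by rw [hva, hv₂]; exact h) (Exec.instr rfl))),
      by omega, hs₂.setReg_temp le_rfl _, hQ h⟩

/-- Loops with an invariant `Inv j` before the `j`-th of `N` rounds, which takes `t j` steps. -/
theorem loop {a b : ℕ} {c : Cmd} (ha : a < numVars) (hb : b < numVars) (Inv : ℕ → State → Prop)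
    (N : ℕ) (t : ℕ → ℕ) (h0 : Inv 0 s)
    (hstep : ∀ j < N, ∀ s, Inv j s → s.reg a < s.reg b ∧ HT E c s (t j) (Inv (j + 1)))
    (hN : ∀ s, Inv N s → ¬ s.reg a < s.reg b ∧ Q s) :
    HT E (.loop a b c) s ((∑ j ∈ Finset.range N, (t j + 1)) + 1) Q := by
  suffices H : ∀ d i, i + d = N → ∀ s, Inv i s →
      HT E (.loop a b c) s ((∑ j ∈ Finset.range d, (t (i + j) + 1)) + 1) Q by
    simpa using H N 0 (by omega) s h0
  clear h0
  intro d
  induction d with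
  | zero =>
    intro i hi s hI s₀ hs
    obtain rfl : i = N := by omega
    obtain ⟨h₁, h₂⟩ := hN s hI
    exact ⟨_, s₀, s, Exec.loopDone (by rwa [hs.reg a ha, hs.reg b hb]), by simp, hs, h₂⟩
  | succ d ih =>
    intro i hi s hI s₀ hs
    obtain ⟨hab, h₁⟩ := hstep i (by omega) s hI
    obtain ⟨T₁, s₁, s', e₁, hT₁, hs₁, hI'⟩ := h₁ s₀ hs
    obtain ⟨T₂, s₂, s'', e₂, hT₂, hs₂, hq⟩ := ih (i + 1) (by omega) s' hI' s₁ hs₁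
    refine ⟨_, s₂, s'', Exec.loopStep (by rwa [hs.reg a ha, hs.reg b hb]) e₁ e₂, ?_, hs₂, hq⟩
    rw [Finset.sum_range_succ']
    simp only [add_zero]
    have : ∀ j, i + 1 + j = i + (j + 1) := by intro j; omega
    simp only [this] at hT₂
    omega

/-- The 5 per round pays for the increment (4) and the test (1); the 4 outside pays for storing the
bound, clearing the counter and the last test. The invariant is required after the increment, so
that bodies need not mention it. -/
theorem forTo (hσ : σ ≤ E.word) {i u : ℕ} {e : Arith} {c : Cmd} (hi : i < numVars)
    (hu : u < numVars) (hiu : i ≠ u) {N : ℕ} (he : e.Ok E s) (hN : e.eval E s = N)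
    (hW : N < E.word) (h1 : 1 < E.word) (Inv : ℕ → State → Prop) (t : ℕ → ℕ)
    (h0 : Inv 0 ((s.set u N).set i 0))
    (hstep : ∀ j < N, ∀ s, s.reg i = j → s.reg u = N → Inv j s →
      HT E c s (t j) fun s' => s'.reg i = j ∧ s'.reg u = N ∧ Inv (j + 1) (s'.set i (j + 1)))
    (hQ : ∀ s, s.reg i = N → s.reg u = N → Inv N s → Q s) :
    HT E (forTo i u e c) s (e.cost + 4 + ∑ j ∈ Finset.range N, (t j + 5)) Q := by
  have h0' : 0 < E.word := by omega
  refine le (seq (assign hσ hu he (seq (t₂ := (∑ j ∈ Finset.range N, (t j + 4 + 1)) + 1)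
    (assign hσ hi h0' ?_)))) (le_of_eq ?_)
  · refine loop hi hu (fun j s => s.reg i = j ∧ s.reg u = N ∧ Inv j s) N (fun j => t j + 4) ?_ ?_ ?_
    · simp [hN, hiu.symm, Arith.eval]
      simpa using h0
    · rintro j hj s ⟨h₁, h₂, h₃⟩
      refine ⟨by omega, seq (mono (hstep j hj s h₁ h₂ h₃) ?_)⟩
      rintro s' ⟨h₄, h₅, h₆⟩
      refine assign hσ hi ⟨hi, h1, ?_⟩ ?_
      · simp only [Arith.eval]; omega
      · simp only [Arith.eval, h₄]
        exact ⟨by simp, by simp [hiu.symm, h₅], h₆⟩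
    · rintro s ⟨h₁, h₂, h₃⟩
      exact ⟨by omega, hQ s h₁ h₂ h₃⟩
  · simp only [Arith.cost, add_assoc]
    ring_nf

/-- Loops whose rounds all take at most `t` steps. -/
theorem forTo_const (hσ : σ ≤ E.word) {i u : ℕ} {e : Arith} {c : Cmd} (hi : i < numVars)
    (hu : u < numVars) (hiu : i ≠ u) {N : ℕ} (he : e.Ok E s) (hN : e.eval E s = N)
    (hW : N < E.word) (h1 : 1 < E.word) (Inv : ℕ → State → Prop) (t : ℕ)
    (h0 : Inv 0 ((s.set u N).set i 0))
    (hstep : ∀ j < N, ∀ s, s.reg i = j → s.reg u = N → Inv j s →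
      HT E c s t fun s' => s'.reg i = j ∧ s'.reg u = N ∧ Inv (j + 1) (s'.set i (j + 1)))
    (hQ : ∀ s, s.reg i = N → s.reg u = N → Inv N s → Q s) :
    HT E (CircularMatching.forTo i u e c) s (e.cost + 4 + N * (t + 5)) Q := by
  have := forTo hσ hi hu hiu he hN hW h1 Inv (fun _ => t) h0 hstep hQ
  simpa using this

/-- Symbolic execution: the time budget `t` is handed on, reduced by the cost of each command, and
the spec state is updated in closed form. -/
theorem assign_seq (hσ : σ ≤ E.word) {r v : ℕ} {e : Arith} {c : Cmd} (he : e.Ok E s)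
    (hv : e.eval E s = v) (h : HT E c (s.set r v) (t - (e.cost + 1)) Q)
    (hr : r < numVars := by decide)
    (ht : e.cost + 1 ≤ t := by simp only [Arith.cost]; omega) :
    HT E (.seq (CircularMatching.assign r e) c) s t Q :=
  le (seq (assign hσ hr he (by rw [hv]; exact h))) (by omega)

theorem assign_end (hσ : σ ≤ E.word) {r v : ℕ} {e : Arith} (he : e.Ok E s)
    (hv : e.eval E s = v) (h : Q (s.set r v)) (hr : r < numVars := by decide)
    (ht : e.cost + 1 ≤ t := by simp only [Arith.cost]; omega) :
    HT E (CircularMatching.assign r e) s t Q :=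
  le (assign hσ hr he (by rw [hv]; exact h)) (by omega)

theorem storeAt_seq (hσ : σ ≤ E.word) {x v : ℕ} {a e : Arith} {c : Cmd} (ha : a.Ok E s)
    (hx : a.eval E s = x) (hsize : x < E.size) (he : e.Ok E s) (hv : e.eval E s = v)
    (h : HT E c (s.put x v) (t - (a.cost + e.cost + 1)) Q)
    (ht : a.cost + e.cost + 1 ≤ t := by simp only [Arith.cost]; omega) :
    HT E (.seq (CircularMatching.storeAt a e) c) s t Q :=
  le (seq (storeAt hσ ha (by rwa [hx]) he (by rw [hx, hv]; exact h))) (by omega)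

theorem storeAt_end (hσ : σ ≤ E.word) {x v : ℕ} {a e : Arith} (ha : a.Ok E s)
    (hx : a.eval E s = x) (hsize : x < E.size) (he : e.Ok E s) (hv : e.eval E s = v)
    (h : Q (s.put x v)) (ht : a.cost + e.cost + 1 ≤ t := by simp only [Arith.cost]; omega) :
    HT E (CircularMatching.storeAt a e) s t Q :=
  le (storeAt hσ ha (by rwa [hx]) he (by rw [hx, hv]; exact h)) (by omega)

theorem call_seq {c₁ c₂ : Cmd} {P : State → Prop} (h₁ : HT E c₁ s t₁ P) (ht : t₁ ≤ t)
    (h₂ : ∀ s', P s' → HT E c₂ s' (t - t₁) Q) : HT E (.seq c₁ c₂) s t Q :=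
  le (seq (mono h₁ h₂)) (by omega)

end HT

/-! ### Dynamic programming -/

/-- The array cell with index `e` of the array whose address is in register `b`. -/
abbrev Arith.cell (b : ℕ) (e : Arith) : Arith := .mem (.add (.var b) e)

/-- The minimum of two expressions. -/
abbrev Arith.min (a b : Arith) : Arith := .sub a (.sub a b)

/-- The recurrence of the edit distance of suffixes, given by their lengths; deleting an initial
or final part of `V` costs `lam` per letter when the suffix of `U` is used up. -/
def dp (lam : ℕ) (U V : ℕ → ℕ) : ℕ → ℕ → ℕ
  | 0, b => lam * b
  | a + 1, 0 => a + 1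
  | a + 1, b + 1 =>
      min (dp lam U V a b + if U a = V b then 0 else 1)
        (min (dp lam U V a (b + 1) + 1) (dp lam U V (a + 1) b + 1))

/-- Keeps all table entries below the word size. -/
theorem dp_le {lam : ℕ} (hlam : lam ≤ 1) (U V : ℕ → ℕ) : ∀ a b, dp lam U V a b ≤ a + b
  | 0, b => by simp only [dp]; nlinarith
  | a + 1, 0 => by simp [dp]
  | a + 1, b + 1 => by
    have := dp_le hlam U V a (b + 1)
    simp only [dp]; omega

theorem dp_zero_right (lam : ℕ) (U V : ℕ → ℕ) (a : ℕ) : dp lam U V a 0 = a := by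
  cases a <;> simp [dp]

/-- One cell of the table: the row in memory is updated in place. -/
def dpCell : Cmd :=
  .seq (assign 35 (.cell 8 (.add (.var 32) (.lit 1))))
  (.seq (assign 36 (.add (.sub (.cell 5 (.var 30)) (.cell 7 (.var 32)))
    (.sub (.cell 7 (.var 32)) (.cell 5 (.var 30)))))
  (.seq (assign 36 (.add (.var 34) (.min (.var 36) (.lit 1))))
  (.seq (assign 37 (.add (.min (.var 35) (.cell 8 (.var 32))) (.lit 1)))
  (.seq (storeAt (.add (.var 8) (.add (.var 32) (.lit 1))) (.min (.var 36) (.var 37)))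
    (assign 34 (.var 35))))))

/-- One row of the table. -/
def dpRow : Cmd :=
  .seq (assign 34 (.cell 8 (.lit 0)))
  (.seq (storeAt (.add (.var 8) (.lit 0)) (.add (.var 30) (.lit 1)))
    (forTo 32 33 (.var 25) dpCell))

/-- The last row of the table for arrays of lengths in registers `24` and `25` at the addresses in
registers `5` and `7`, written to the address in register `8`; register `26` holds `lam`. -/
def dpTable : Cmd :=
  .seq (forTo 32 33 (.add (.var 25) (.lit 1))
    (storeAt (.add (.var 8) (.var 32)) (.mul (.var 26) (.var 32))))
    (forTo 30 31 (.var 24) dpRow)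

/-- What the table computation needs and does not change. -/
structure DPInput {σ : ℕ} (E : Env σ) (AU AV AR la lb lam : ℕ) (U V : ℕ → ℕ) (s : State) :
    Prop where
  r5 : s.reg 5 = AU
  r7 : s.reg 7 = AV
  r8 : s.reg 8 = AR
  r24 : s.reg 24 = la
  r25 : s.reg 25 = lb
  r26 : s.reg 26 = lam
  memU : ∀ a < la, s.mem (AU + a) = U a
  memV : ∀ b < lb, s.mem (AV + b) = V b

/-- The registers below `28`, the output, and the memory outside `[x, y)` are the same. -/
structure SameBut (s s' : State) (f x y : ℕ) : Prop where
  reg : ∀ r < f, s'.reg r = s.reg r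
  mem : ∀ a, a < x ∨ y ≤ a → s'.mem a = s.mem a
  out : s'.out = s.out

theorem SameBut.refl (s : State) (f x y : ℕ) : SameBut s s f x y :=
  ⟨fun _ _ => rfl, fun _ _ => rfl, rfl⟩

theorem SameBut.trans {s s' s'' : State} {f x y : ℕ} (h : SameBut s s' f x y)
    (h' : SameBut s' s'' f x y) : SameBut s s'' f x y :=
  ⟨fun r hr => (h'.reg r hr).trans (h.reg r hr), fun a ha => (h'.mem a ha).trans (h.mem a ha),
    h'.out.trans h.out⟩

theorem SameBut.mono {s s' : State} {f f' x x' y y' : ℕ} (h : SameBut s s' f x y) (hf : f' ≤ f)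
    (hx : x' ≤ x) (hy : y ≤ y') : SameBut s s' f' x' y' :=
  ⟨fun r hr => h.reg r (hr.trans_le hf), fun a ha => h.mem a (by omega), h.out⟩

theorem SameBut.set {s s' : State} {f x y : ℕ} (h : SameBut s s' f x y) {r : ℕ} (hr : f ≤ r)
    (v : ℕ) : SameBut s (s'.set r v) f x y :=
  ⟨fun r' hr' => by have : r' ≠ r := by omega
                    simp [this, h.reg r' hr'], h.mem, h.out⟩

theorem SameBut.put {s s' : State} {f x y : ℕ} (h : SameBut s s' f x y) {a : ℕ} (hx : x ≤ a)
    (hy : a < y) (v : ℕ) : SameBut s (s'.put a v) f x y :=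
  ⟨h.reg, fun a' ha' => by have : a' ≠ a := by omega
                           simp [this, h.mem a' ha'], h.out⟩

theorem DPInput.of_same {σ : ℕ} {E : Env σ} {AU AV AR la lb lam : ℕ} {U V : ℕ → ℕ} {s s' : State}
    (h : DPInput E AU AV AR la lb lam U V s) (h' : SameBut s s' 28 AR (AR + lb + 1))
    (hU : AU + la ≤ AR) (hV : AV + lb ≤ AR) : DPInput E AU AV AR la lb lam U V s' := by
  constructor
  · rw [h'.reg _ (by omega), h.r5]
  · rw [h'.reg _ (by omega), h.r7]
  · rw [h'.reg _ (by omega), h.r8]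
  · rw [h'.reg _ (by omega), h.r24]
  · rw [h'.reg _ (by omega), h.r25]
  · rw [h'.reg _ (by omega), h.r26]
  · intro a ha; rw [h'.mem _ (by omega), h.memU a ha]
  · intro b hb; rw [h'.mem _ (by omega), h.memV b hb]

section
variable {σ : ℕ} {E : Env σ} {AU AV AR la lb lam : ℕ} {U V : ℕ → ℕ} {s : State}

theorem dpCell_spec (hσ : σ ≤ E.word) (hlam : lam ≤ 1)
    (hs : DPInput E AU AV AR la lb lam U V s) (hU : AU + la ≤ AR)
    (hV : AV + lb ≤ AR) (hR : AR + lb + 1 ≤ E.size) (hW : AR + la + lb + 5 ≤ E.word)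
    (hUW : ∀ a < la, U a < E.word) (hVW : ∀ b < lb, V b < E.word)
    {a b : ℕ} (ha : a < la) (hb : b < lb) (h30 : s.reg 30 = a) (h32 : s.reg 32 = b)
    (h34 : s.reg 34 = dp lam U V a b)
    (hlo : s.mem (AR + b) = dp lam U V (a + 1) b)
    (hhi : s.mem (AR + (b + 1)) = dp lam U V a (b + 1)) :
    HT E dpCell s 60 fun s' => s'.reg 30 = a ∧ s'.reg 31 = s.reg 31 ∧ s'.reg 32 = b ∧
      s'.reg 33 = s.reg 33 ∧ s'.reg 34 = dp lam U V a (b + 1) ∧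
      s'.mem (AR + (b + 1)) = dp lam U V (a + 1) (b + 1) ∧
      SameBut s s' 28 (AR + (b + 1)) (AR + (b + 1) + 1) := by
  obtain ⟨h5, h7, h8, h24, h25, h26, hmU, hmV⟩ := hs
  have e1 := hmU a ha
  have e2 := hmV b hb
  have b1 := hUW a ha
  have b2 := hVW b hb
  have d1 := dp_le hlam U V a b
  have d2 := dp_le hlam U V a (b + 1)
  have d3 := dp_le hlam U V (a + 1) b
  -- Truncated subtraction supplies what the machine lacks: `x - (x - y)` is a minimum, `(x - y) +
  -- (y - x)` an absolute difference, and the minimum of the latter with 1 is the cost of a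
  -- mismatch.
  have key : dp lam U V (a + 1) (b + 1) =
      (dp lam U V a b + ((U a - V b + (V b - U a)) - ((U a - V b + (V b - U a)) - 1))) -
      ((dp lam U V a b + ((U a - V b + (V b - U a)) - ((U a - V b + (V b - U a)) - 1))) -
      (dp lam U V a (b + 1) - (dp lam U V a (b + 1) - dp lam U V (a + 1) b) + 1)) := by
    rw [dp]
    split_ifs <;> omega
  unfold dpCell
  refine HT.assign_seq hσ (v := dp lam U V a (b + 1)) ?_ ?_ ?_
  · simp [Arith.Ok, Arith.eval, h8, h32]; omega
  · simp [Arith.eval, h8, h32, hhi]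
  refine HT.assign_seq hσ (v := U a - V b + (V b - U a)) ?_ ?_ ?_
  · simp [Arith.Ok, Arith.eval, h5, h7, h30, h32, e1, e2]; omega
  · simp [Arith.eval, h5, h7, h30, h32, e1, e2]
  refine HT.assign_seq hσ (v := dp lam U V a b +
      ((U a - V b + (V b - U a)) - ((U a - V b + (V b - U a)) - 1))) ?_ ?_ ?_
  · simp [Arith.Ok, Arith.eval, h34]; omega
  · simp [Arith.eval, h34]
  refine HT.assign_seq hσ (v := dp lam U V a (b + 1) -
      (dp lam U V a (b + 1) - dp lam U V (a + 1) b) + 1) ?_ ?_ ?_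
  · simp [Arith.Ok, Arith.eval, h8, h32, hlo]; omega
  · simp [Arith.eval, h8, h32, hlo]
  refine HT.storeAt_seq hσ (x := AR + (b + 1)) (v := dp lam U V (a + 1) (b + 1)) ?_ ?_ ?_ ?_ ?_ ?_
  · simp [Arith.Ok, Arith.eval, h8, h32]; omega
  · simp [Arith.eval, h8, h32]
  · omega
  · simp [Arith.Ok]
  · simp [Arith.eval, key]
  refine HT.assign_end hσ (v := dp lam U V a (b + 1)) ?_ ?_ ?_
  · simp [Arith.Ok]
  · simp [Arith.eval]
  refine ⟨by simp [h30], by simp, by simp [h32], by simp, by simp, by simp, ?_⟩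
  exact SameBut.set (SameBut.put (SameBut.set (SameBut.set (SameBut.set (SameBut.set
    (SameBut.refl s _ _ _) (by omega) _) (by omega) _) (by omega) _) (by omega) _) (by omega)
      (by omega) _) (by omega) _

theorem dpRow_spec (hσ : σ ≤ E.word) (hlam : lam ≤ 1)
    (hs : DPInput E AU AV AR la lb lam U V s) (hU : AU + la ≤ AR)
    (hV : AV + lb ≤ AR) (hR : AR + lb + 1 ≤ E.size) (hW : AR + la + lb + 5 ≤ E.word)
    (hUW : ∀ a < la, U a < E.word) (hVW : ∀ b < lb, V b < E.word)
    {a : ℕ} (ha : a < la) (h30 : s.reg 30 = a)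
    (hrow : ∀ b ≤ lb, s.mem (AR + b) = dp lam U V a b) :
    HT E dpRow s (30 + lb * 65) fun s' => s'.reg 30 = a ∧ s'.reg 31 = s.reg 31 ∧
      (∀ b ≤ lb, s'.mem (AR + b) = dp lam U V (a + 1) b) ∧
      SameBut s s' 28 AR (AR + lb + 1) := by
  have hs' := hs
  obtain ⟨h5, h7, h8, h24, h25, h26, hmU, hmV⟩ := hs'
  have hrow0 := hrow 0 (by omega)
  simp only [add_zero] at hrow0
  unfold dpRow
  refine HT.assign_seq hσ (v := dp lam U V a 0) ?_ ?_ ?_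
  · simp [Arith.Ok, Arith.eval, h8]; omega
  · simp [Arith.eval, h8, hrow0]
  refine HT.storeAt_seq hσ (x := AR) (v := a + 1) ?_ ?_ ?_ ?_ ?_ ?_
  · simp [Arith.Ok, Arith.eval, h8]; omega
  · simp [Arith.eval, h8]
  · omega
  · simp [Arith.Ok, Arith.eval, h30]; omega
  · simp [Arith.eval, h30]
  -- In round `b` the stored row is new up to index `b` and old beyond it. Register 34 keeps the old
  -- entry at `b`, which is already overwritten but still needed as the diagonal neighbour.
  refine HT.le (HT.forTo_const hσ (N := lb) (by decide) (by decide) (by decide) ?_ ?_ (by omega)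
    (by omega) (fun b s' => s'.reg 30 = a ∧ s'.reg 31 = s.reg 31 ∧ s'.reg 34 = dp lam U V a b ∧
      (∀ b' ≤ b, s'.mem (AR + b') = dp lam U V (a + 1) b') ∧
      (∀ b', b < b' → b' ≤ lb → s'.mem (AR + b') = dp lam U V a b') ∧
      SameBut s s' 28 AR (AR + lb + 1)) 60 ?_ ?_ ?_) ?_
  · simp [Arith.Ok]
  · simp [Arith.eval, h25]
  · refine ⟨by simp [h30], by simp, by simp, ?_, ?_, ?_⟩
    · intro b' hb'
      obtain rfl : b' = 0 := by omega
      simp [dp]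
    · intro b' hb' hb''
      have : b' ≠ 0 := by omega
      simp [this, hrow b' hb'']
    · exact SameBut.set (SameBut.set (SameBut.put (SameBut.set (SameBut.refl s _ _ _)
        (by omega) _) (by omega) (by omega) _) (by omega) _) (by omega) _
  · rintro b hb s' h32 h33 ⟨i1, i2, i3, i4, i5, i6⟩
    refine (dpCell_spec hσ hlam (hs.of_same i6 hU hV) hU hV hR hW hUW hVW ha hb i1 h32 i3
      (i4 b le_rfl) (i5 (b + 1) (by omega) (by omega))).mono ?_
    rintro s'' ⟨j1, j2, j3, j4, j5, j6, j7⟩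
    refine ⟨j3, by rw [j4, h33], by simp [j1], by simp [j2, i2], by simp [j5], ?_, ?_, ?_⟩
    · intro b' hb'
      rcases Nat.lt_or_ge b b' with h | h
      · obtain rfl : b' = b + 1 := by omega
        simp [j6]
      · simp only [State.set_mem]; rw [j7.mem _ (by omega), i4 b' h]
    · intro b' h1 h2
      simp only [State.set_mem]; rw [j7.mem _ (by omega), i5 b' (by omega) h2]
    · exact (i6.trans (j7.mono le_rfl (by omega) (by omega))).set (by omega) _
  · rintro s' - - ⟨i1, i2, i3, i4, i5, i6⟩
    exact ⟨i1, i2, i4, i6⟩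
  · simp [Arith.cost]; omega

theorem dpTable_spec (hσ : σ ≤ E.word) (hlam : lam ≤ 1)
    (hs : DPInput E AU AV AR la lb lam U V s) (hU : AU + la ≤ AR)
    (hV : AV + lb ≤ AR) (hR : AR + lb + 1 ≤ E.size) (hW : AR + la + lb + 5 ≤ E.word)
    (hUW : ∀ a < la, U a < E.word) (hVW : ∀ b < lb, V b < E.word) :
    HT E dpTable s (65 * ((la + 1) * (lb + 1))) fun s' =>
      (∀ b ≤ lb, s'.mem (AR + b) = dp lam U V la b) ∧ SameBut s s' 28 AR (AR + lb + 1) := by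
  have hs' := hs
  obtain ⟨h5, h7, h8, h24, h25, h26, hmU, hmV⟩ := hs'
  unfold dpTable
  refine HT.call_seq (HT.forTo_const hσ (N := lb + 1) (by decide) (by decide) (by decide) ?_ ?_
    (by omega) (by omega) (fun b s' => (∀ b' < b, s'.mem (AR + b') = dp lam U V 0 b') ∧
      SameBut s s' 28 AR (AR + lb + 1)) 7 ?_ ?_ (fun s' _ _ h => h)) ?_ ?_
  · simp [Arith.Ok, Arith.eval, h25]; omega
  · simp [Arith.eval, h25]
  · exact ⟨by simp, ((SameBut.refl s _ _ _).set (by omega) _).set (by omega) _⟩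
  · rintro b hb s' h32 h33 ⟨i1, i2⟩
    have h8' : s'.reg 8 = AR := (i2.reg 8 (by omega)).trans h8
    have h26' : s'.reg 26 = lam := (i2.reg 26 (by omega)).trans h26
    refine HT.storeAt_end hσ (x := AR + b) (v := lam * b) ?_ ?_ ?_ ?_ ?_ ?_
    · simp [Arith.Ok, Arith.eval, h8', h32]; omega
    · simp [Arith.eval, h8', h32]
    · omega
    · have : lam * b ≤ b := by nlinarith
      simp [Arith.Ok, Arith.eval, h26', h32]; omega
    · simp [Arith.eval, h26', h32]
    refine ⟨by simp [h32], by simp [h33], ?_, (i2.put (by omega) (by omega) _).set (by omega) _⟩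
    intro b' hb'
    by_cases h : b' = b
    · simp [h, dp]
    · simp [h, i1 b' (by omega)]
  · simp only [Arith.cost]; nlinarith
  · rintro s₁ ⟨i1, i2⟩
    refine HT.le (HT.forTo_const hσ (N := la) (by decide) (by decide) (by decide) ?_ ?_
      (by omega) (by omega) (fun a s' => (∀ b ≤ lb, s'.mem (AR + b) = dp lam U V a b) ∧
      SameBut s s' 28 AR (AR + lb + 1)) (30 + lb * 65) ?_ ?_ (fun s' _ _ h => h)) ?_
    · simp [Arith.Ok]
    · simp [Arith.eval, i2.reg 24, h24]
    · exact ⟨fun b hb => by simp [i1 b (by omega)], (i2.set (by omega) _).set (by omega) _⟩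
    · rintro a ha s' h30 h31 ⟨i1, i2⟩
      refine (dpRow_spec hσ hlam (hs.of_same i2 hU hV) hU hV hR hW hUW hVW ha h30 i1).mono ?_
      rintro s'' ⟨j1, j2, j3, j4⟩
      exact ⟨j1, j2.trans h31, j3, (i2.trans j4).set (by omega) _⟩
    · simp only [Arith.cost]
      apply Nat.le_sub_of_add_le
      ring_nf
      omega
end

/-! ### Loading arrays into memory -/

/-- Letters of the rotation by `o` of the pattern, repeated to length `lb`, from last to first. -/
def patFun {σ : ℕ} (x : List (Fin σ)) (o lb b : ℕ) : ℕ := letter x ((o + (lb - 1 - b)) % x.length)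

/-- Letters of the factor of length `l` at position `p`, from last to first. -/
def textFun {σ : ℕ} (t : List (Fin σ)) (p l a : ℕ) : ℕ := letter t (p + (l - 1 - a))

/-- Digits of a number in base `σ`, starting with the least significant one. -/
def digitFun (σ c a : ℕ) : ℕ := c / σ ^ a % σ

/-- `mem[AV + b] := patFun x o lb b` for `b < lb`, with `lb` in register `25`, `o` in `27`. -/
def loadPattern : Cmd :=
  forTo 28 29 (.var 25)
    (.seq (assign 30 (.add (.var 27) (.sub (.sub (.var 25) (.lit 1)) (.var 28))))
      (storeAt (.add (.var 7) (.var 28))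
        (.pat (.sub (.var 30) (.mul (.div (.var 30) (.var 0)) (.var 0))))))

/-- `mem[AU + a] := textFun t p l a` for `a < l`, with `l` in register `24`, `p` in `22`. -/
def loadText : Cmd :=
  forTo 28 29 (.var 24)
    (storeAt (.add (.var 5) (.var 28))
      (.txt (.add (.var 22) (.sub (.sub (.var 24) (.lit 1)) (.var 28)))))

/-- `mem[AU + a] := digitFun σ c a` for `a < l`, with `l` in register `24`, `c` in `23`. -/
def loadDigits (σ : ℕ) : Cmd :=
  .seq (assign 30 (.var 23))
    (forTo 28 29 (.var 24)
      (.seq (storeAt (.add (.var 5) (.var 28))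
          (.sub (.var 30) (.mul (.div (.var 30) (.lit σ)) (.lit σ))))
        (assign 30 (.div (.var 30) (.lit σ)))))

/-- The machine has no remainder instruction; programs compute residues in this form. -/
theorem sub_div_mul_eq_mod (a b : ℕ) : a - a / b * b = a % b := by
  rw [Nat.mod_eq_sub, mul_comm]

section
variable {σ : ℕ} {E : Env σ} {s : State}

theorem loadPattern_spec (hσ : σ ≤ E.word) {AV lb o m : ℕ} (h0 : s.reg 0 = m)
    (hm : E.pattern.length = m) (hm0 : 0 < m) (h7 : s.reg 7 = AV) (h25 : s.reg 25 = lb)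
    (h27 : s.reg 27 = o) (hsize : AV + lb ≤ E.size) (hW : AV + lb + o + 2 ≤ E.word) :
    HT E loadPattern s (10 + 30 * lb) fun s' =>
      (∀ b < lb, s'.mem (AV + b) = patFun E.pattern o lb b) ∧ SameBut s s' 28 AV (AV + lb) := by
  unfold loadPattern
  refine HT.le (HT.forTo_const hσ (N := lb) (by decide) (by decide) (by decide) ?_ ?_
    (by omega) (by omega) (fun b s' => (∀ b' < b, s'.mem (AV + b') = patFun E.pattern o lb b') ∧
      SameBut s s' 28 AV (AV + lb)) 20 ?_ ?_ (fun s' _ _ h => h)) ?_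
  · simp [Arith.Ok]
  · simp [Arith.eval, h25]
  · exact ⟨by simp, ((SameBut.refl s _ _ _).set (by omega) _).set (by omega) _⟩
  · rintro b hb s' h28 h29 ⟨i1, i2⟩
    have e0 := (i2.reg 0 (by omega)).trans h0
    have e7 := (i2.reg 7 (by omega)).trans h7
    have e25 := (i2.reg 25 (by omega)).trans h25
    have e27 := (i2.reg 27 (by omega)).trans h27
    have hmod : (o + (lb - 1 - b)) % m < m := Nat.mod_lt _ hm0
    have hmul := Nat.div_mul_le_self (o + (lb - 1 - b)) m
    refine HT.assign_seq hσ (v := o + (lb - 1 - b)) ?_ ?_ ?_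
    · simp [Arith.Ok, Arith.eval, e27, e25, h28]; omega
    · simp [Arith.eval, e27, e25, h28]
    refine HT.storeAt_end hσ (x := AV + b) (v := patFun E.pattern o lb b) ?_ ?_ ?_ ?_ ?_ ?_
    · simp [Arith.Ok, Arith.eval, e7, h28]; omega
    · simp [Arith.eval, e7, h28]
    · omega
    · simp [Arith.Ok, Arith.eval, e0, sub_div_mul_eq_mod, hm, hmod]; omega
    · simp [Arith.eval, e0, sub_div_mul_eq_mod, patFun, hm]
    refine ⟨by simp [h28], by simp [h29], ?_,
      ((i2.set (by omega) _).put (by omega) (by omega) _).set (by omega) _⟩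
    intro b' hb'
    by_cases h : b' = b
    · simp [h]
    · simp [h, i1 b' (by omega)]
  · simp only [Arith.cost]; omega

theorem loadText_spec (hσ : σ ≤ E.word) {AU l p : ℕ} (h5 : s.reg 5 = AU) (h24 : s.reg 24 = l)
    (h22 : s.reg 22 = p) (hp : p + l ≤ E.text.length) (hsize : AU + l ≤ E.size)
    (hW : AU + l + p + 2 ≤ E.word) :
    HT E loadText s (10 + 20 * l) fun s' =>
      (∀ a < l, s'.mem (AU + a) = textFun E.text p l a) ∧ SameBut s s' 28 AU (AU + l) := by
  unfold loadText
  refine HT.le (HT.forTo_const hσ (N := l) (by decide) (by decide) (by decide) ?_ ?_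
    (by omega) (by omega) (fun b s' => (∀ b' < b, s'.mem (AU + b') = textFun E.text p l b') ∧
      SameBut s s' 28 AU (AU + l)) 15 ?_ ?_ (fun s' _ _ h => h)) ?_
  · simp [Arith.Ok]
  · simp [Arith.eval, h24]
  · exact ⟨by simp, ((SameBut.refl s _ _ _).set (by omega) _).set (by omega) _⟩
  · rintro b hb s' h28 h29 ⟨i1, i2⟩
    have e5 := (i2.reg 5 (by omega)).trans h5
    have e24 := (i2.reg 24 (by omega)).trans h24
    have e22 := (i2.reg 22 (by omega)).trans h22
    refine HT.storeAt_end hσ (x := AU + b) (v := textFun E.text p l b) ?_ ?_ ?_ ?_ ?_ ?_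
    · simp [Arith.Ok, Arith.eval, e5, h28]; omega
    · simp [Arith.eval, e5, h28]
    · omega
    · simp [Arith.Ok, Arith.eval, e22, e24, h28]; omega
    · simp [Arith.eval, e22, e24, h28, textFun]
    refine ⟨by simp [h28], by simp [h29], ?_, (i2.put (by omega) (by omega) _).set (by omega) _⟩
    intro b' hb'
    by_cases h : b' = b
    · simp [h]
    · simp [h, i1 b' (by omega)]
  · simp only [Arith.cost]; omega

theorem loadDigits_spec (hσ : σ < E.word) {AU l c : ℕ} (h5 : s.reg 5 = AU) (h24 : s.reg 24 = l)
    (h23 : s.reg 23 = c) (hsize : AU + l ≤ E.size) (hW : AU + l + c + 2 ≤ E.word) :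
    HT E (loadDigits σ) s (10 + 25 * l) fun s' =>
      (∀ a < l, s'.mem (AU + a) = digitFun σ c a) ∧ SameBut s s' 28 AU (AU + l) := by
  unfold loadDigits
  refine HT.assign_seq hσ.le (v := c) (by simp [Arith.Ok]) (by simp [Arith.eval, h23]) ?_
  refine HT.le (HT.forTo_const hσ.le (N := l) (by decide) (by decide) (by decide) ?_ ?_
    (by omega) (by omega) (fun b s' => (∀ b' < b, s'.mem (AU + b') = digitFun σ c b') ∧
      s'.reg 30 = c / σ ^ b ∧ SameBut s s' 28 AU (AU + l)) 20 ?_ ?_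
      (fun s' _ _ h => ⟨h.1, h.2.2⟩)) ?_
  · simp [Arith.Ok]
  · simp [Arith.eval, h24]
  · exact ⟨by simp, by simp,
      (((SameBut.refl s _ _ _).set (by omega) _).set (by omega) _).set (by omega) _⟩
  · rintro b hb s' h28 h29 ⟨i1, i3, i2⟩
    have e5 := (i2.reg 5 (by omega)).trans h5
    have hle := Nat.div_le_self c (σ ^ b)
    have hmul := Nat.div_mul_le_self (c / σ ^ b) σ
    refine HT.storeAt_seq hσ.le (x := AU + b) (v := digitFun σ c b) ?_ ?_ ?_ ?_ ?_ ?_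
    · simp [Arith.Ok, Arith.eval, e5, h28]; omega
    · simp [Arith.eval, e5, h28]
    · omega
    · simp [Arith.Ok, Arith.eval, i3, hσ]; omega
    · simp [Arith.eval, i3, sub_div_mul_eq_mod, digitFun]
    refine HT.assign_end hσ.le (v := c / σ ^ (b + 1)) ?_ ?_ ?_
    · simp [Arith.Ok, hσ]
    · simp [Arith.eval, i3, pow_succ, Nat.div_div_eq_div_mul]
    refine ⟨by simp [h28], by simp [h29], ?_, by simp,
      ((i2.put (by omega) (by omega) _).set (by omega) _).set (by omega) _⟩
    intro b' hb'
    by_cases h : b' = b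
    · simp [h]
    · simp [h, i1 b' (by omega)]
  · simp only [Arith.cost]; omega

end

/-! ### The preprocessing -/

/-- The minimum of `f 0, …, f n`. -/
def minTo (f : ℕ → ℕ) : ℕ → ℕ
  | 0 => f 0
  | n + 1 => min (minTo f n) (f (n + 1))

theorem minTo_le (f : ℕ → ℕ) {n b : ℕ} (h : b ≤ n) : minTo f n ≤ f b := by
  induction n with
  | zero => obtain rfl : b = 0 := by omega
            simp [minTo]
  | succ n ih =>
    rcases Nat.lt_or_ge n b with h' | h'
    · obtain rfl : b = n + 1 := by omega
      exact min_le_right _ _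
    · exact (min_le_left _ _).trans (ih h')

theorem exists_minTo_eq (f : ℕ → ℕ) (n : ℕ) : ∃ b ≤ n, minTo f n = f b := by
  induction n with
  | zero => exact ⟨0, le_rfl, rfl⟩
  | succ n ih =>
    obtain ⟨b, hb, h⟩ := ih
    rcases min_choice (minTo f n) (f (n + 1)) with h' | h'
    · exact ⟨b, by omega, by rw [minTo, h', h]⟩
    · exact ⟨n + 1, le_rfl, by rw [minTo, h']⟩

/-- The table entry for a `q`-gram with code `c`: its distance from the closest factor of the
doubled pattern. -/
def gramDist {σ : ℕ} (x : List (Fin σ)) (q c : ℕ) : ℕ :=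
  minTo (dp 0 (digitFun σ c) (patFun x 0 (2 * x.length)) q) (2 * x.length)

/-- Index 0 of the last row belongs to the empty factor, at distance `q`. -/
theorem gramDist_le {σ : ℕ} (x : List (Fin σ)) (q c : ℕ) : gramDist x q c ≤ q :=
  (minTo_le _ (Nat.zero_le _)).trans_eq (dp_zero_right _ _ _ _)

/-- Compute the table entry for the code in register `10`. -/
def tableEntry (σ : ℕ) : Cmd :=
  .seq (assign 23 (.var 10))
  (.seq (loadDigits σ)
  (.seq dpTable
  (.seq (assign 12 (.cell 8 (.lit 0)))
  (.seq (forTo 13 14 (.var 25)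
      (assign 12 (.min (.var 12) (.cell 8 (.add (.var 13) (.lit 1))))))
    (storeAt (.var 10) (.var 12))))))

/-- Memory layout: the table in `[0, SQ)`, the gram from `SQ`, the doubled pattern from `SQ + 2 m`,
the working row from `SQ + 4 m`. The postcondition keeps the finished entries and the pattern, so
the entries can be computed one after another. -/
theorem tableEntry_spec {σ : ℕ} {E : Env σ} {s : State} (hσ : σ < E.word) (hσ0 : 0 < σ)
    {SQ q m c : ℕ} (hm : E.pattern.length = m)
    (h5 : s.reg 5 = SQ) (h7 : s.reg 7 = SQ + 2 * m) (h8 : s.reg 8 = SQ + 4 * m)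
    (h24 : s.reg 24 = q) (h25 : s.reg 25 = 2 * m) (h26 : s.reg 26 = 0) (h10 : s.reg 10 = c)
    (hV : ∀ b < 2 * m, s.mem (SQ + 2 * m + b) = patFun E.pattern 0 (2 * m) b)
    (hc : c < SQ) (hq : q ≤ m) (hsize : SQ + 6 * m + 2 ≤ E.size)
    (hW : 2 * SQ + 8 * m + 100 ≤ E.word) (hm0 : 0 < m) :
    HT E (tableEntry σ) s (300 * ((q + 1) * m)) fun s' =>
      s'.reg 10 = c ∧ s'.reg 11 = s.reg 11 ∧ s'.mem c = gramDist E.pattern q c ∧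
      (∀ r < 10, s'.reg r = s.reg r) ∧ (∀ r, 23 < r → r < 28 → s'.reg r = s.reg r) ∧
      (∀ a < SQ, a ≠ c → s'.mem a = s.mem a) ∧
      (∀ b < 2 * m, s'.mem (SQ + 2 * m + b) = patFun E.pattern 0 (2 * m) b) := by
  have hlet : ∀ l : List (Fin σ), ∀ i, letter l i < E.word := by
    intro l i
    by_cases hi : i < l.length
    · rw [letter_of_lt hi]; exact (Fin.is_lt _).trans hσ
    · have : l[i]? = none := by simpa using hi
      simp [letter, this]; omega
  unfold tableEntry
  refine HT.assign_seq hσ.le (v := c) (by simp [Arith.Ok]) (by simp [Arith.eval, h10]) ?_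
    (by decide) (by simp only [Arith.cost]; nlinarith)
  refine HT.call_seq (loadDigits_spec hσ (AU := SQ) (l := q) (c := c) ?_ ?_ ?_ ?_ ?_) ?_ ?_
  · simp [h5]
  · simp [h24]
  · simp
  · omega
  · omega
  · simp only [Arith.cost]
    apply Nat.le_sub_of_add_le
    nlinarith
  rintro s₁ ⟨i1, i2⟩
  have hreg : ∀ r < 28, r ≠ 23 → s₁.reg r = s.reg r := by
    intro r hr hr'
    rw [i2.reg r hr]; simp [hr']
  refine HT.call_seq (dpTable_spec hσ.le (AU := SQ) (AV := SQ + 2 * m) (AR := SQ + 4 * m)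
    (la := q) (lb := 2 * m) (lam := 0) (U := digitFun σ c) (V := patFun E.pattern 0 (2 * m))
    (by omega) ?_ (by omega) (by omega) (by omega) (by omega) ?_ ?_) ?_ ?_
  · refine ⟨?_, ?_, ?_, ?_, ?_, ?_, i1, ?_⟩
    · rw [hreg _ (by omega) (by omega), h5]
    · rw [hreg _ (by omega) (by omega), h7]
    · rw [hreg _ (by omega) (by omega), h8]
    · rw [hreg _ (by omega) (by omega), h24]
    · rw [hreg _ (by omega) (by omega), h25]
    · rw [hreg _ (by omega) (by omega), h26]
    · intro b hb
      rw [i2.mem _ (by omega)]; simpa using hV b hb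
  · intro a _; exact (Nat.mod_lt _ hσ0).trans hσ
  · intro b _; exact hlet _ _
  · simp only [Arith.cost]
    apply Nat.le_sub_of_add_le
    apply Nat.le_sub_of_add_le
    nlinarith
  rintro s₂ ⟨j1, j2⟩
  have hreg2 : ∀ r < 28, r ≠ 23 → s₂.reg r = s.reg r := by
    intro r hr hr'
    rw [j2.reg r hr, hreg r hr hr']
  have hg : ∀ b ≤ 2 * m, minTo (dp 0 (digitFun σ c) (patFun E.pattern 0 (2 * m)) q) b ≤ q := by
    intro b _
    exact (minTo_le _ (Nat.zero_le _)).trans_eq (dp_zero_right _ _ _ _)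
  have j10 := j1 0 (by omega)
  rw [add_zero] at j10
  refine HT.assign_seq hσ.le
    (v := minTo (dp 0 (digitFun σ c) (patFun E.pattern 0 (2 * m)) q) 0) ?_ ?_ ?_
    (by decide) ?_
  · simp [Arith.Ok, Arith.eval, hreg2, h8]; omega
  · simp [Arith.eval, hreg2, h8, j10, minTo]
  rotate_left
  · simp only [Arith.cost]
    apply Nat.le_sub_of_add_le
    apply Nat.le_sub_of_add_le
    apply Nat.le_sub_of_add_le
    nlinarith
  refine HT.call_seq (HT.forTo_const hσ.le (N := 2 * m) (by decide) (by decide) (by decide) ?_ ?_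
    (by omega) (by omega) (fun b s' =>
      s'.reg 12 = minTo (dp 0 (digitFun σ c) (patFun E.pattern 0 (2 * m)) q) b ∧
      s'.mem = s₂.mem ∧ ∀ r < 28, r < 12 ∨ 23 < r → s'.reg r = s.reg r) 12
      ?_ ?_ (fun s' _ _ h => h)) ?_ ?_
  · simp [Arith.Ok]
  · simp [Arith.eval, hreg2, h25]
  · refine ⟨by simp, by simp, ?_⟩
    intro r hr hr'
    have h1 : r ≠ 13 := by omega
    have h2 : r ≠ 14 := by omega
    have h3 : r ≠ 12 := by omega
    simp [h1, h2, h3, hreg2 r hr (by omega)]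
  · rintro b hb s' h13 h14 ⟨k1, k2, k3⟩
    have e8 := k3 8 (by omega) (by omega)
    refine HT.assign_end hσ.le
      (v := minTo (dp 0 (digitFun σ c) (patFun E.pattern 0 (2 * m)) q) (b + 1)) ?_ ?_ ?_
    · simp [Arith.Ok, Arith.eval, e8, h8, h13]; omega
    · simp only [Arith.eval, k1, e8, h8, h13, k2, minTo, j1 (b + 1) (by omega)]; omega
    · refine ⟨by simp [h13], by simp [h14], by simp, by simp [k2], ?_⟩
      intro r hr hr'
      have h1 : r ≠ 13 := by omega
      have h3 : r ≠ 12 := by omega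
      simp [h1, h3, k3 r hr hr']
  · simp only [Arith.cost]
    apply Nat.le_sub_of_add_le
    apply Nat.le_sub_of_add_le
    apply Nat.le_sub_of_add_le
    apply Nat.le_sub_of_add_le
    nlinarith
  rintro s₃ ⟨k1, k2, k3⟩
  have e10 := (k3 10 (by omega) (by omega)).trans h10
  refine HT.storeAt_end hσ.le (x := c) (v := gramDist E.pattern q c) ?_ ?_ ?_ ?_ ?_ ?_ ?_
  · simp [Arith.Ok]
  · simp [Arith.eval, e10]
  · omega
  · simp [Arith.Ok]
  · simp [Arith.eval, k1, gramDist, hm]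
  · refine ⟨by simp [e10], by simp [k3], by simp, ?_, ?_, ?_, ?_⟩
    · intro r hr; simp [k3 r (by omega) (by omega)]
    · intro r hr hr'; simp [k3 r hr' (by omega)]
    · intro a ha hac
      simp only [State.put_mem, if_neg hac, k2]
      rw [j2.mem _ (by omega), i2.mem _ (by omega)]; rfl
    · intro b hb
      have : SQ + 2 * m + b ≠ c := by omega
      simp only [State.put_mem, if_neg this, k2]
      rw [j2.mem _ (by omega), i2.mem _ (by omega)]; exact hV b hb
  · simp only [Arith.cost]
    apply Nat.le_sub_of_add_le
    apply Nat.le_sub_of_add_le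
    apply Nat.le_sub_of_add_le
    apply Nat.le_sub_of_add_le
    apply Nat.le_sub_of_add_le
    nlinarith

/-- The length of the grams that the algorithm uses. -/
def gramLen (σ R N m : ℕ) : ℕ := R * N * Nat.log σ m

/-- The number of grams that the algorithm reads in a window. -/
def gramCount (σ R N m k : ℕ) : ℕ := k / ((R - 1) * N * Nat.log σ m) + 11

/-- The number of starting positions that are served by one window. -/
def windowShift (σ R N m k : ℕ) : ℕ := m - k - gramCount σ R N m k * gramLen σ R N m + 1

/-- The preprocessing program. -/
def prepCmd (σ R N : ℕ) : Cmd :=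
  .seq (assign 12 (.lit σ))
  (.seq (assign 13 (.add (.var 0) (.lit 1)))
  (.seq (assign 3 (.lit 0))
  (.seq (.loop 12 13 (.seq (assign 12 (.mul (.var 12) (.lit σ)))
    (assign 3 (.add (.var 3) (.lit 1)))))
  (.seq (assign 6 (.mul (.lit ((R - 1) * N)) (.var 3)))
  (.seq (assign 3 (.mul (.lit (R * N)) (.var 3)))
  (.seq (assign 4 (.add (.div (.var 1) (.var 6)) (.lit 11)))
  (.seq (assign 6 (.add (.sub (.sub (.var 0) (.var 1)) (.mul (.var 4) (.var 3))) (.lit 1)))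
  (.seq (assign 5 (.lit 1))
  (.seq (forTo 28 29 (.var 3) (assign 5 (.mul (.var 5) (.lit σ))))
  (.seq (assign 7 (.add (.var 5) (.mul (.lit 2) (.var 0))))
  (.seq (assign 8 (.add (.var 5) (.mul (.lit 4) (.var 0))))
  (.seq (assign 24 (.var 3))
  (.seq (assign 25 (.mul (.lit 2) (.var 0)))
  (.seq loadPattern
    (forTo 10 11 (.var 5) (tableEntry σ))))))))))))))))

/-- The state after the preprocessing. -/
structure Ready {σ : ℕ} (x : List (Fin σ)) (k q L sh SQ : ℕ) (s : State) : Prop where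
  r0 : s.reg 0 = x.length
  r1 : s.reg 1 = k
  r3 : s.reg 3 = q
  r4 : s.reg 4 = L
  r5 : s.reg 5 = SQ
  r6 : s.reg 6 = sh
  r7 : s.reg 7 = SQ + 2 * x.length
  r8 : s.reg 8 = SQ + 4 * x.length
  table : ∀ c < SQ, s.mem c = gramDist x q c

-- The `σ ^ q` table entries, at `300 (q + 1) m` steps each, dominate; the logarithm, the power and
-- the copy of the pattern are absorbed in the constant.
set_option maxHeartbeats 1000000 in
theorem prepCmd_spec {σ R N m k q L sh : ℕ} {E : Env σ} (hσ2 : 2 ≤ σ) (hR : 2 ≤ R) (hN : 1 ≤ N)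
    (hm : E.pattern.length = m) (hσm : σ ≤ m) (hq : gramLen σ R N m = q)
    (hL : gramCount σ R N m k = L) (hsh : windowShift σ R N m k = sh) (hLq : L * q + k ≤ m)
    (hW : σ * m + 2 * σ ^ q + 10 * m + 200 ≤ E.word) (hsize : σ ^ q + 6 * m + 2 ≤ E.size) :
    HT E (prepCmd σ R N) (State.init m k) (1000 * (σ ^ q * m * q))
      (Ready E.pattern k q L sh (σ ^ q)) := by
  have hm0 : m ≠ 0 := by omega
  have hlog : 1 ≤ Nat.log σ m := Nat.log_pos (by omega) hσm
  set lam := Nat.log σ m with hlam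
  have hq1 : R * N ≤ q := by rw [← hq]; unfold gramLen; nlinarith [Nat.zero_le (R * N)]
  have hq2 : lam ≤ q := by
    rw [← hq]; unfold gramLen
    exact Nat.le_mul_of_pos_left _ (by positivity)
  have hqpos : 1 ≤ q := by nlinarith
  have hL11 : 11 ≤ L := by rw [← hL]; exact Nat.le_add_left 11 _
  have hqm : q ≤ m := by nlinarith
  have hh : (R - 1) * N * lam ≤ q := by
    rw [← hq]; unfold gramLen
    exact Nat.mul_le_mul_right _ (Nat.mul_le_mul_right _ (by omega))
  have hRN1 : (R - 1) * N ≤ R * N := Nat.mul_le_mul_right _ (by omega)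
  have hSQ : 1 ≤ σ ^ q := Nat.one_le_pow _ _ (by omega)
  have hσW : σ < E.word := by nlinarith
  have hpw : ∀ j ≤ lam, σ ^ j ≤ m := fun j hj =>
    (Nat.pow_le_pow_right (by omega) hj).trans (Nat.pow_log_le_self σ hm0)
  have hlt : m < σ ^ (lam + 1) := Nat.lt_pow_succ_log_self (by omega) m
  have hT1 : σ ^ q * m * q ≥ m := by
    calc m = 1 * m * 1 := by ring
      _ ≤ σ ^ q * m * q := by gcongr
  have hT2 : σ ^ q * m * q ≥ σ ^ q * (m * 1) := by
    rw [mul_assoc]; gcongr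
  unfold prepCmd
  refine HT.assign_seq hσW.le (v := σ) (by simpa [Arith.Ok] using hσW) (by simp [Arith.eval]) ?_
    (by decide) (by simp only [Arith.cost]; omega)
  refine HT.assign_seq hσW.le (v := m + 1) ?_ ?_ ?_
    (by decide) (by simp only [Arith.cost]; omega)
  · simp [Arith.Ok, Arith.eval, State.init]; omega
  · simp [Arith.eval, State.init]
  refine HT.assign_seq hσW.le (v := 0) ?_ ?_ ?_
    (by decide) (by simp only [Arith.cost]; omega)
  · simp [Arith.Ok]; omega
  · simp [Arith.eval]
  -- The loop stops at the first `j` with `m < σ ^ (j + 1)`, which is `Nat.log σ m`. Registers 26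
  -- and 27 are only carried along: their initial value 0 later serves as `lam` and as the offset of
  -- the pattern.
  refine HT.call_seq (HT.loop (by decide) (by decide) (fun j s =>
    s.reg 0 = m ∧ s.reg 1 = k ∧ s.reg 26 = 0 ∧ s.reg 27 = 0 ∧ s.reg 12 = σ ^ (j + 1) ∧
    s.reg 13 = m + 1 ∧ s.reg 3 = j) lam (fun _ => 9) ?_ ?_ (fun s hs => ⟨?_, hs⟩)) ?_ ?_
  · simp [State.init]
  · rintro j hj s ⟨i0, i1, i26, i27, i12, i13, i3⟩
    have := hpw (j + 1) (by omega)
    -- The last power computed exceeds `m`, but by at most a factor `σ`; this is why `σ * m` must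
    -- fit into a word.
    have hb : σ ^ (j + 1) * σ ≤ σ * m := by rw [mul_comm]; exact Nat.mul_le_mul_left _ this
    have hbj : j < σ ^ j := Nat.lt_pow_self (by omega)
    have hbj' := hpw j (by omega)
    refine ⟨by omega, ?_⟩
    refine HT.assign_seq hσW.le (v := σ ^ (j + 1 + 1)) ?_ ?_ ?_
    · simp [Arith.Ok, Arith.eval, i12, hσW]; omega
    · simp [Arith.eval, i12, pow_succ]
    refine HT.assign_end hσW.le (v := j + 1) ?_ ?_ ?_
    · simp [Arith.Ok, Arith.eval, i3]; omega
    · simp [Arith.eval, i3]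
    simp [*]
  · obtain ⟨i0, i1, i26, i27, i12, i13, i3⟩ := hs
    rw [i12, i13]; omega
  · simp only [Arith.cost]; simp; omega
  rintro s₁ ⟨i0, i1, i26, i27, i12, i13, i3⟩
  simp only [Arith.cost, Finset.sum_const, Finset.card_range, smul_eq_mul]
  refine HT.assign_seq hσW.le (v := (R - 1) * N * lam) ?_ ?_ ?_
    (by decide) (by simp only [Arith.cost]; omega)
  · simp [Arith.Ok, Arith.eval, i3]; omega
  · simp [Arith.eval, i3]
  refine HT.assign_seq hσW.le (v := q) ?_ ?_ ?_
    (by decide) (by simp only [Arith.cost]; omega)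
  · have hq' : R * N * lam = q := hq
    simp [Arith.Ok, Arith.eval, i3, hq']; omega
  · simp [Arith.eval, i3, ← hq, gramLen, hlam]
  have hkd : k / ((R - 1) * N * lam) ≤ k := Nat.div_le_self _ _
  refine HT.assign_seq hσW.le (v := L) ?_ ?_ ?_
    (by decide) (by simp only [Arith.cost]; omega)
  · simp [Arith.Ok, Arith.eval, i1]; omega
  · simp [Arith.eval, i1, ← hL, gramCount, hlam]
  refine HT.assign_seq hσW.le (v := sh) ?_ ?_ ?_
    (by decide) (by simp only [Arith.cost]; omega)
  · simp [Arith.Ok, Arith.eval, i0, i1]; omega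
  · simp [Arith.eval, i0, i1, ← hsh, windowShift, hL, hq]
  refine HT.assign_seq hσW.le (v := 1) ?_ ?_ ?_
    (by decide) (by simp only [Arith.cost]; omega)
  · simp [Arith.Ok]; omega
  · simp [Arith.eval]
  simp only [Arith.cost]
  refine HT.call_seq (HT.forTo_const hσW.le (N := q) (by decide) (by decide) (by decide) ?_ ?_
    (by omega) (by omega) (fun j s => s.reg 5 = σ ^ j ∧ s.reg 0 = m ∧ s.reg 1 = k ∧ s.reg 3 = q ∧
      s.reg 4 = L ∧ s.reg 6 = sh ∧ s.reg 26 = 0 ∧ s.reg 27 = 0) 4 ?_ ?_ (fun s' _ _ h => h)) ?_ ?_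
  · simp [Arith.Ok]
  · simp [Arith.eval]
  · simp [*]
  · rintro j hj s h28 h29 ⟨j5, j0, j1, j3, j4, j6, j26, j27⟩
    have : σ ^ j * σ ≤ σ ^ q := by
      rw [← pow_succ]; exact Nat.pow_le_pow_right (by omega) (by omega)
    refine HT.assign_end hσW.le (v := σ ^ (j + 1)) ?_ ?_ ?_
    · simp [Arith.Ok, Arith.eval, j5, hσW]; omega
    · simp [Arith.eval, j5, pow_succ]
    simp [*]
  · simp only [Arith.cost]; omega
  rintro s₂ ⟨j5, j0, j1, j3, j4, j6, j26, j27⟩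
  simp only [Arith.cost]
  set SQ := σ ^ q with hSQdef
  refine HT.assign_seq hσW.le (v := SQ + 2 * m) ?_ ?_ ?_
    (by decide) (by simp only [Arith.cost]; omega)
  · simp [Arith.Ok, Arith.eval, j0, j5]; omega
  · simp [Arith.eval, j0, j5]
  refine HT.assign_seq hσW.le (v := SQ + 4 * m) ?_ ?_ ?_
    (by decide) (by simp only [Arith.cost]; omega)
  · simp [Arith.Ok, Arith.eval, j0, j5]; omega
  · simp [Arith.eval, j0, j5]
  refine HT.assign_seq hσW.le (v := q) ?_ ?_ ?_
    (by decide) (by simp only [Arith.cost]; omega)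
  · simp [Arith.Ok]
  · simp [Arith.eval, j3]
  refine HT.assign_seq hσW.le (v := 2 * m) ?_ ?_ ?_
    (by decide) (by simp only [Arith.cost]; omega)
  · simp [Arith.Ok, Arith.eval, j0]; omega
  · simp [Arith.eval, j0]
  refine HT.call_seq (loadPattern_spec hσW.le (AV := SQ + 2 * m) (lb := 2 * m) (o := 0) (m := m)
    ?_ hm (by omega) ?_ ?_ ?_ ?_ ?_) ?_ ?_
  · simp [j0]
  · simp
  · simp
  · simp [j27]
  · omega
  · omega
  · simp only [Arith.cost]; omega
  rintro s₃ ⟨l1, l2⟩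
  simp only [Arith.cost]
  have reg3 : ∀ r < 28, s₃.reg r = _ := l2.reg
  refine HT.le (HT.forTo_const hσW.le (N := SQ) (by decide) (by decide) (by decide) ?_ ?_
    (by omega) (by omega) (fun c s => (∀ r < 10, s.reg r = s₃.reg r) ∧
      (∀ r, 23 < r → r < 28 → s.reg r = s₃.reg r) ∧
      (∀ c' < c, s.mem c' = gramDist E.pattern q c') ∧
      (∀ b < 2 * m, s.mem (SQ + 2 * m + b) = patFun E.pattern 0 (2 * m) b))
    (300 * ((q + 1) * m)) ?_ ?_ ?_) ?_
  · simp [Arith.Ok]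
  · simp [Arith.eval, reg3, j5]
  · refine ⟨?_, ?_, by simp, ?_⟩
    · intro r hr
      have h1 : r ≠ 10 := by omega
      have h2 : r ≠ 11 := by omega
      simp [h1, h2]
    · intro r hr hr'
      have h1 : r ≠ 10 := by omega
      have h2 : r ≠ 11 := by omega
      simp [h1, h2]
    · intro b hb; simpa using l1 b hb
  · rintro c hc s h10 h11 ⟨k1, k2, k3, k4⟩
    refine (tableEntry_spec hσW (by omega) hm ?_ ?_ ?_ ?_ ?_ ?_ h10 k4 hc hqm hsize (by omega)
      (by omega)).mono ?_
    · rw [k1 _ (by omega), reg3 _ (by omega)]; simp [j5]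
    · rw [k1 _ (by omega), reg3 _ (by omega)]; simp
    · rw [k1 _ (by omega), reg3 _ (by omega)]; simp
    · rw [k2 _ (by omega) (by omega), reg3 _ (by omega)]; simp
    · rw [k2 _ (by omega) (by omega), reg3 _ (by omega)]; simp
    · rw [k2 _ (by omega) (by omega), reg3 _ (by omega)]; simp [j26]
    rintro s' ⟨n1, n2, n3, n4, n5, n6, n7⟩
    refine ⟨n1, by rw [n2, h11], ?_, ?_, ?_, ?_⟩
    · intro r hr
      have h1 : r ≠ 10 := by omega
      simp [h1, n4 r hr, k1 r hr]
    · intro r hr hr'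
      have h1 : r ≠ 10 := by omega
      simp [h1, n5 r hr hr', k2 r hr hr']
    · intro c' hc'
      by_cases h : c' = c
      · simp [h, n3]
      · simp only [State.set_mem]
        rw [n6 c' (by omega) h, k3 c' (by omega)]
    · intro b hb; simpa using n7 b hb
  · rintro s - - ⟨k1, k2, k3, k4⟩
    subst hm
    constructor
    · rw [k1 _ (by omega), reg3 _ (by omega)]; simp [j0]
    · rw [k1 _ (by omega), reg3 _ (by omega)]; simp [j1]
    · rw [k1 _ (by omega), reg3 _ (by omega)]; simp [j3]
    · rw [k1 _ (by omega), reg3 _ (by omega)]; simp [j4]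
    · rw [k1 _ (by omega), reg3 _ (by omega)]; simp [j5]
    · rw [k1 _ (by omega), reg3 _ (by omega)]; simp [j6]
    · rw [k1 _ (by omega), reg3 _ (by omega)]; simp
    · rw [k1 _ (by omega), reg3 _ (by omega)]; simp
    · exact k3
  · have e1 : SQ * (300 * ((q + 1) * m) + 5) ≤ 605 * (SQ * m * q) := by
      have : 300 * ((q + 1) * m) + 5 ≤ 605 * (m * q) := by nlinarith
      calc _ ≤ SQ * (605 * (m * q)) := Nat.mul_le_mul_left _ this
        _ = _ := by ring
    simp only [Arith.cost]
    omega

/-! ### The search -/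

/-- Test the factor with position in register `22` and length in register `24` against all
rotations of the pattern, and report it for each that is close. -/
def checkFactor : Cmd :=
  .seq loadText
    (forTo 27 17 (.var 0)
      (.seq loadPattern
      (.seq dpTable
        (whenLt (.cell 8 (.var 25)) (.add (.var 1) (.lit 1)) (emitPair (.var 22) (.var 24))))))

/-- Test all factors that start at one of the positions of the window. -/
def verifyWindow : Cmd :=
  forTo 14 15 (.var 6)
    (.seq (assign 22 (.add (.var 12) (.var 14)))
      (forTo 24 16 (.add (.add (.var 0) (.var 1)) (.lit 1))
        (whenLt (.add (.var 22) (.var 24)) (.add (.var 2) (.lit 1)) checkFactor)))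

/-- Add the table entry of one gram of the window to register `13`. -/
def addGram (σ : ℕ) : Cmd :=
  .seq (assign 16 (.lit 0))
  (.seq (assign 19 (.add (.add (.var 12) (.sub (.var 6) (.lit 1))) (.mul (.var 14) (.var 3))))
  (.seq (forTo 17 18 (.var 3)
      (assign 16 (.add (.mul (.var 16) (.lit σ)) (.txt (.add (.var 19) (.var 17))))))
    (assign 13 (.add (.var 13) (.mem (.var 16))))))

/-- Process the window with number in register `10`. -/
def searchWindow (σ : ℕ) : Cmd :=
  .seq (assign 12 (.mul (.var 10) (.var 6)))
  (.seq (assign 13 (.lit 0))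
  (.seq (forTo 14 15 (.var 4) (addGram σ))
    (whenLt (.var 13) (.add (.var 1) (.lit 1)) verifyWindow)))

/-- The search program. -/
def searchCmd (σ : ℕ) : Cmd :=
  .seq (assign 25 (.var 0))
  (.seq (assign 26 (.lit 1))
    (forTo 10 11 (.add (.div (.sub (.var 2) (.sub (.var 0) (.var 1))) (.var 6)) (.lit 1))
      (searchWindow σ)))

/-- The code of the `q`-gram at position `p` of a text. -/
def gramCode {σ : ℕ} (t : List (Fin σ)) (p : ℕ) : ℕ → ℕ
  | 0 => 0
  | q + 1 => gramCode t p q * σ + letter t (p + q)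

/-- The sum of the distances of `L` consecutive `q`-grams from position `p` on. -/
def gramSum {σ : ℕ} (x t : List (Fin σ)) (q L p : ℕ) : ℕ :=
  ∑ i ∈ Finset.range L, gramDist x q (gramCode t (p + i * q) q)

theorem gramSum_le {σ : ℕ} (x t : List (Fin σ)) (q L p : ℕ) : gramSum x t q L p ≤ L * q := by
  simpa [gramSum] using Finset.sum_le_card_nsmul (Finset.range L) _ q fun i _ => gramDist_le x q _

/-- The factor of length `l` at position `p` of `t` is close to the rotation of `x` by `j`. -/
def Hit {σ : ℕ} (x t : List (Fin σ)) (k p l j : ℕ) : Prop :=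
  dp 1 (textFun t p l) (patFun x j x.length) l x.length ≤ k

theorem letter_lt {σ : ℕ} (hσ : 0 < σ) (l : List (Fin σ)) (i : ℕ) : letter l i < σ := by
  by_cases hi : i < l.length
  · rw [letter_of_lt hi]; exact Fin.is_lt _
  · have : l[i]? = none := by simpa using hi
    simpa [letter, this] using hσ

theorem gramCode_lt {σ : ℕ} (hσ : 0 < σ) (t : List (Fin σ)) (p q : ℕ) :
    gramCode t p q < σ ^ q := by
  induction q with
  | zero => simp [gramCode]
  | succ q ih =>
    have := letter_lt hσ t (p + q)
    rw [gramCode, pow_succ]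
    nlinarith

/-- The state during the search. -/
structure Searching {σ : ℕ} (x : List (Fin σ)) (k n q L sh SQ : ℕ) (s : State) : Prop
    extends Ready x k q L sh SQ s where
  r2 : s.reg 2 = n
  r25 : s.reg 25 = x.length
  r26 : s.reg 26 = 1

/-- Only the registers below 10, the registers 25 and 26, and the table persist through the search;
all else is scratch space. -/
theorem Searching.of_eq {σ : ℕ} {x : List (Fin σ)} {k n q L sh SQ : ℕ} {s s' : State}
    (h : Searching x k n q L sh SQ s)
    (hreg : ∀ r, r < 10 ∨ r = 25 ∨ r = 26 → s'.reg r = s.reg r)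
    (hmem : ∀ a < SQ, s'.mem a = s.mem a) : Searching x k n q L sh SQ s' := by
  obtain ⟨⟨h0, h1, h3, h4, h5, h6, h7, h8, h9⟩, h2, h25, h26⟩ := h
  refine ⟨⟨?_, ?_, ?_, ?_, ?_, ?_, ?_, ?_, ?_⟩, ?_, ?_, ?_⟩
  iterate 8 rw [hreg _ (by omega)]; assumption
  · intro c hc; rw [hmem c hc, h9 c hc]
  iterate 3 rw [hreg _ (by omega)]; assumption

theorem Searching.set {σ : ℕ} {x : List (Fin σ)} {k n q L sh SQ : ℕ} {s : State}
    (h : Searching x k n q L sh SQ s) {r : ℕ} (v : ℕ)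
    (hr : 10 ≤ r ∧ r ≠ 25 ∧ r ≠ 26 := by decide) : Searching x k n q L sh SQ (s.set r v) :=
  h.of_eq (fun r' hr' => by
    have : r' ≠ r := by omega
    simp [this]) fun _ _ => rfl

theorem Searching.emit {σ : ℕ} {x : List (Fin σ)} {k n q L sh SQ : ℕ} {s : State}
    (h : Searching x k n q L sh SQ s) (p : ℕ × ℕ) : Searching x k n q L sh SQ (s.emit p) :=
  h.of_eq (fun _ _ => rfl) fun _ _ => rfl

theorem Searching.same {σ : ℕ} {x : List (Fin σ)} {k n q L sh SQ a b : ℕ} {s s' : State}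
    (h : Searching x k n q L sh SQ s) (h' : SameBut s s' 28 a b) (ha : SQ ≤ a) :
    Searching x k n q L sh SQ s' :=
  h.of_eq (fun r hr => h'.reg r (by omega)) fun c hc => h'.mem c (by omega)

section
variable {σ : ℕ} {E : Env σ} {s : State} {k m n q L sh SQ : ℕ}

-- A quadratic table for each of `m` rotations gives the cube. A factor may be reported once per
-- rotation, which is harmless because only membership in the output matters. The registers below 17
-- hold the counters of the enclosing loops.
set_option maxHeartbeats 1000000 in
theorem checkFactor_spec (hσ : σ ≤ E.word) (hσ0 : 0 < σ) (hm : E.pattern.length = m)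
    (hn : E.text.length = n) (hm0 : 0 < m) (hk : k < m)
    (hW : SQ + 12 * m + 2 * n + 200 ≤ E.word)
    (hsize : SQ + 6 * m + 2 ≤ E.size) (hs : Searching E.pattern k n q L sh SQ s)
    {p l : ℕ} (h22 : s.reg 22 = p) (h24 : s.reg 24 = l) (hpl : p + l ≤ n) (hl : l ≤ m + k) :
    HT E checkFactor s (600 * m ^ 3) fun s' => Searching E.pattern k n q L sh SQ s' ∧
      (∀ r < 17, s'.reg r = s.reg r) ∧ s'.reg 22 = p ∧ s'.reg 24 = l ∧
      ∀ y, y ∈ s'.out ↔ y ∈ s.out ∨ (y = (p, l) ∧ ∃ j < m, Hit E.pattern E.text k p l j) := by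
  have hm3 : m ^ 3 ≥ 1 := Nat.one_le_pow _ _ hm0
  have hm3' : m ^ 3 ≥ m := by nlinarith [Nat.one_le_pow 2 m hm0, pow_succ m 2]
  have hm2 : m ^ 2 ≥ m := by nlinarith
  unfold checkFactor
  refine HT.call_seq (loadText_spec hσ (AU := SQ) (l := l) (p := p) hs.r5 h24 h22 (by omega)
    (by omega) (by omega)) (by omega) ?_
  rintro s₁ ⟨i1, i2⟩
  have hs₁ := hs.same i2 le_rfl
  refine HT.le (HT.forTo_const hσ (N := m) (by decide) (by decide) (by decide) ?_ ?_
    (by omega) (by omega) (fun j s' => Searching E.pattern k n q L sh SQ s' ∧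
      (∀ r < 17, s'.reg r = s.reg r) ∧ s'.reg 22 = p ∧ s'.reg 24 = l ∧
      (∀ a < l, s'.mem (SQ + a) = textFun E.text p l a) ∧
      ∀ y, y ∈ s'.out ↔ y ∈ s.out ∨ (y = (p, l) ∧ ∃ j' < j, Hit E.pattern E.text k p l j'))
    (450 * m ^ 2 + 60) ?_ ?_ (fun s' _ _ h => ⟨h.1, h.2.1, h.2.2.1, h.2.2.2.1, h.2.2.2.2.2⟩)) ?_
  · simp [Arith.Ok]
  · simp [Arith.eval, hs₁.r0, hm]
  · refine ⟨(hs₁.set _).set _, fun r hr => ?_, ?_, ?_, ?_, ?_⟩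
    · have h1 : r ≠ 27 := by omega
      have h2 : r ≠ 17 := by omega
      simp [h1, h2, i2.reg r (by omega)]
    · simp [i2.reg 22, h22]
    · simp [i2.reg 24, h24]
    · intro a ha; simpa using i1 a ha
    · simp [i2.out]
  · rintro j hj s' h27 h17 ⟨j1, j2, j3, j4, j5, j6⟩
    have hr0 := j1.r0
    rw [hm] at hr0
    have hr7 := j1.r7
    rw [hm] at hr7
    have hr8 := j1.r8
    rw [hm] at hr8
    have hr25 := j1.r25
    rw [hm] at hr25
    refine HT.call_seq (loadPattern_spec hσ (AV := SQ + 2 * m) (lb := m) (o := j) hr0 hm hm0 hr7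
      hr25 h27 (by omega) (by omega)) (by omega) ?_
    rintro s₂ ⟨k1, k2⟩
    have hs₂ := j1.same k2 (by omega)
    have hlm : (l + 1) * (m + 1) ≤ 4 * m ^ 2 := by
      calc _ ≤ (2 * m) * (2 * m) := by gcongr <;> omega
        _ = _ := by ring
    refine HT.call_seq (dpTable_spec hσ (AU := SQ) (AV := SQ + 2 * m) (AR := SQ + 4 * m)
      (la := l) (lb := m) (lam := 1) (U := textFun E.text p l) (V := patFun E.pattern j m)
      (by omega) ⟨hs₂.r5, ?_, ?_, ?_, ?_, hs₂.r26, ?_, k1⟩ (by omega) (by omega) (by omega)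
      (by omega) ?_ ?_) ?_ ?_
    · rw [hs₂.r7, hm]
    · rw [hs₂.r8, hm]
    · rw [k2.reg _ (by omega), j4]
    · rw [hs₂.r25, hm]
    · intro a ha; rw [k2.mem _ (by omega), j5 a ha]
    · intro a _; exact (letter_lt hσ0 _ _).trans_le hσ
    · intro a _; exact (letter_lt hσ0 _ _).trans_le hσ
    · omega
    rintro s₃ ⟨l1, l2⟩
    have hs₃ := hs₂.same l2 (by omega)
    have hreg : ∀ r < 28, s₃.reg r = s'.reg r := fun r hr =>
      (l2.reg r hr).trans (k2.reg r hr)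
    have hdp := dp_le (lam := 1) le_rfl (textFun E.text p l) (patFun E.pattern j m) l m
    have l1m := l1 m le_rfl
    refine HT.le (HT.whenLt hσ (t := 3) ?_ ?_ (by omega) ?_ ?_) ?_
    · simp [Arith.Ok, Arith.eval, hs₃.r8, hs₃.r25, hm]; omega
    · simp [Arith.Ok, Arith.eval, hs₃.r1]; omega
    · intro hlt
      simp only [Arith.eval, hs₃.r8, hs₃.r25, hs₃.r1, hm, l1m] at hlt
      refine HT.emitPair hσ (by simp [Arith.Ok]) (by simp [Arith.Ok]) ?_
      simp only [Arith.eval, hreg 22 (by omega), hreg 24 (by omega), j3, j4]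
      refine ⟨by simp [hreg, h27], by simp [hreg, h17], (hs₃.emit _).set _, fun r hr => ?_,
        by simp [hreg, j3], by simp [hreg, j4], fun a ha => ?_, fun y => ?_⟩
      · have h1 : r ≠ 27 := by omega
        simp [h1, hreg r (by omega), j2 r hr]
      · simp only [State.set_mem, State.emit_mem]
        rw [l2.mem _ (by omega), k2.mem _ (by omega), j5 a ha]
      · have hhit : Hit E.pattern E.text k p l j := by
          unfold Hit; rw [hm]; omega
        simp only [State.set_out, State.emit_out, List.mem_append, List.mem_singleton, l2.out,
          k2.out, j6]
        constructor
        · rintro ((h | ⟨h, j', hj', h'⟩) | h)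
          · exact .inl h
          · exact .inr ⟨h, j', by omega, h'⟩
          · exact .inr ⟨h, j, by omega, hhit⟩
        · rintro (h | ⟨h, -⟩)
          · exact .inl (.inl h)
          · exact .inr h
    · intro hlt
      simp only [Arith.eval, hs₃.r8, hs₃.r25, hs₃.r1, hm, l1m] at hlt
      refine ⟨by simp [hreg, h27], by simp [hreg, h17], hs₃.set _, fun r hr => ?_,
        by simp [hreg, j3], by simp [hreg, j4], fun a ha => ?_, fun y => ?_⟩
      · have h1 : r ≠ 27 := by omega
        simp [h1, hreg r (by omega), j2 r hr]
      · simp only [State.set_mem]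
        rw [l2.mem _ (by omega), k2.mem _ (by omega), j5 a ha]
      · have hhit : ¬ Hit E.pattern E.text k p l j := by
          unfold Hit; rw [hm]; omega
        simp only [State.set_out, l2.out, k2.out, j6]
        constructor
        · rintro (h | ⟨h, j', hj', h'⟩)
          · exact .inl h
          · exact .inr ⟨h, j', by omega, h'⟩
        · rintro (h | ⟨h, j', hj', h'⟩)
          · exact .inl h
          · refine .inr ⟨h, j', ?_, h'⟩
            rcases Nat.lt_or_ge j' j with h'' | h''
            · exact h''
            · obtain rfl : j' = j := by omega
              exact absurd h' hhit
    · simp only [Arith.cost]; omega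
  · have : m * (450 * m ^ 2 + 60 + 5) = 450 * m ^ 3 + 65 * m := by ring
    simp only [Arith.cost]; omega

/-- At most `m` starting positions, at most `2 m` lengths and a cubic test for each pair give the
fifth power. Lengths above `m + k` are left out since such factors are too long to be close. -/
theorem verifyWindow_spec (hσ : σ ≤ E.word) (hσ0 : 0 < σ) (hm : E.pattern.length = m)
    (hn : E.text.length = n) (hm0 : 0 < m) (hk : k < m)
    (hW : SQ + 12 * m + 2 * n + 200 ≤ E.word)
    (hsize : SQ + 6 * m + 2 ≤ E.size) (hs : Searching E.pattern k n q L sh SQ s) (hsh : sh ≤ m)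
    {p : ℕ} (h12 : s.reg 12 = p) (hp : p ≤ n) :
    HT E verifyWindow s (3000 * m ^ 5) fun s' => Searching E.pattern k n q L sh SQ s' ∧
      (∀ r < 12, s'.reg r = s.reg r) ∧
      ∀ i l, (i, l) ∈ s'.out ↔ (i, l) ∈ s.out ∨ ((∃ e < sh, i = p + e) ∧ l ≤ m + k ∧ i + l ≤ n ∧
        ∃ j < m, Hit E.pattern E.text k i l j) := by
  have hm3 : m ^ 3 ≥ 1 := Nat.one_le_pow _ _ hm0
  have hm4 : m ^ 4 ≥ 1 := Nat.one_le_pow _ _ hm0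
  have hm5 : m ^ 5 ≥ 1 := Nat.one_le_pow _ _ hm0
  unfold verifyWindow
  refine HT.le (HT.forTo_const hσ (N := sh) (by decide) (by decide) (by decide) ?_ ?_
    (by omega) (by omega) (fun e s' => Searching E.pattern k n q L sh SQ s' ∧
      (∀ r < 14, s'.reg r = s.reg r) ∧
      ∀ i l, (i, l) ∈ s'.out ↔ (i, l) ∈ s.out ∨ ((∃ e' < e, i = p + e') ∧ l ≤ m + k ∧ i + l ≤ n ∧
        ∃ j < m, Hit E.pattern E.text k i l j))
    (20 + 2 * m * (600 * m ^ 3 + 20)) ?_ ?_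
    (fun s' _ _ h => ⟨h.1, fun r hr => h.2.1 r (by omega), h.2.2⟩)) ?_
  · simp [Arith.Ok]
  · simp [Arith.eval, hs.r6]
  · refine ⟨(hs.set _).set _, fun r hr => ?_, by simp⟩
    have h1 : r ≠ 14 := by omega
    have h2 : r ≠ 15 := by omega
    simp [h1, h2]
  · rintro e he s₁ h14 h15 ⟨i1, i2, i3⟩
    have e12 := (i2 12 (by omega)).trans h12
    refine HT.assign_seq hσ (v := p + e) ?_ ?_ ?_
    · simp [Arith.Ok, Arith.eval, e12, h14]; omega
    · simp [Arith.eval, e12, h14]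
    refine HT.le (HT.forTo_const hσ (N := m + k + 1) (by decide) (by decide) (by decide) ?_ ?_
      (by omega) (by omega) (fun l s' => Searching E.pattern k n q L sh SQ s' ∧
        (∀ r < 16, s'.reg r = s₁.reg r) ∧ s'.reg 22 = p + e ∧
        ∀ i l', (i, l') ∈ s'.out ↔ (i, l') ∈ s₁.out ∨ (i = p + e ∧ l' < l ∧ i + l' ≤ n ∧
          ∃ j < m, Hit E.pattern E.text k i l' j))
      (600 * m ^ 3 + 8) ?_ ?_ ?_) ?_
    · simp [Arith.Ok, Arith.eval, i1.r0, i1.r1, hm]; omega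
    · simp [Arith.eval, i1.r0, i1.r1, hm]
    · refine ⟨((i1.set _).set _).set _, fun r hr => ?_, by simp, by simp⟩
      have h1 : r ≠ 24 := by omega
      have h2 : r ≠ 16 := by omega
      have h3 : r ≠ 22 := by omega
      simp [h1, h2, h3]
    · rintro l hl s₂ h24 h16 ⟨j1, j2, j3, j4⟩
      refine HT.le (HT.whenLt hσ (t := 600 * m ^ 3) ?_ ?_ (by omega) ?_ ?_) ?_
      · simp [Arith.Ok, Arith.eval, j3, h24]; omega
      · simp [Arith.Ok, Arith.eval, j1.r2]; omega
      · intro hlt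
        simp only [Arith.eval, j3, h24, j1.r2] at hlt
        refine (checkFactor_spec hσ hσ0 hm hn hm0 hk hW hsize j1 j3 h24 (by omega)
          (by omega)).mono ?_
        rintro s₃ ⟨k1, k2, k3, k4, k5⟩
        refine ⟨k4, by rw [k2 _ (by omega), h16], k1.set _, fun r hr => ?_, by simp [k3], ?_⟩
        · have h1 : r ≠ 24 := by omega
          simp [h1, k2 r (by omega), j2 r hr]
        · intro i l'
          simp only [State.set_out, k5, j4, Prod.mk.injEq]
          constructor
          · rintro ((h | ⟨h, h1, h2⟩) | ⟨⟨h1, h2⟩, h3⟩)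
            · exact .inl h
            · exact .inr ⟨h, by omega, h2⟩
            · subst h1 h2; exact .inr ⟨rfl, by omega, by omega, h3⟩
          · rintro (h | ⟨h, h1, h2, h3⟩)
            · exact .inl (.inl h)
            · rcases Nat.lt_or_ge l' l with h' | h'
              · exact .inl (.inr ⟨h, h', h2, h3⟩)
              · obtain rfl : l' = l := by omega
                subst h
                exact .inr ⟨⟨rfl, rfl⟩, h3⟩
      · intro hlt
        simp only [Arith.eval, j3, h24, j1.r2] at hlt
        refine ⟨h24, h16, j1.set _, fun r hr => ?_, by simp [j3], ?_⟩
        · have h1 : r ≠ 24 := by omega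
          simp [h1, j2 r hr]
        · intro i l'
          simp only [State.set_out, j4]
          constructor
          · rintro (h | ⟨h, h1, h2⟩)
            · exact .inl h
            · exact .inr ⟨h, by omega, h2⟩
          · rintro (h | ⟨h, h1, h2, h3⟩)
            · exact .inl h
            · exact .inr ⟨h, by omega, h2, h3⟩
      · simp only [Arith.cost]; omega
    · rintro s₂ - - ⟨j1, j2, j3, j4⟩
      refine ⟨by rw [j2 _ (by omega), h14], by rw [j2 _ (by omega), h15], j1.set _,
        fun r hr => ?_, ?_⟩
      · have h1 : r ≠ 14 := by omega
        simp [h1, j2 r (by omega), i2 r hr]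
      · intro i l
        simp only [State.set_out, j4, i3]
        constructor
        · rintro ((h | ⟨⟨e', h, h'⟩, h2⟩) | ⟨h1, h2, h3⟩)
          · exact .inl h
          · exact .inr ⟨⟨e', by omega, h'⟩, h2⟩
          · exact .inr ⟨⟨e, by omega, h1⟩, by omega, h3⟩
        · rintro (h | ⟨⟨e', h, h'⟩, h2, h3⟩)
          · exact .inl (.inl h)
          · rcases Nat.lt_or_ge e' e with h4 | h4
            · exact .inl (.inr ⟨⟨e', h4, h'⟩, h2, h3⟩)
            · obtain rfl : e' = e := by omega
              exact .inr ⟨h', by omega, h3⟩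
    · simp only [Arith.cost]
      have : (m + k + 1) * (600 * m ^ 3 + 8 + 5) ≤ 2 * m * (600 * m ^ 3 + 13) := by
        gcongr; omega
      apply Nat.le_sub_of_add_le
      nlinarith
  · simp only [Arith.cost]
    have h1 : sh * (20 + 2 * m * (600 * m ^ 3 + 20) + 5) ≤
        m * (20 + 2 * m * (600 * m ^ 3 + 20) + 5) := by gcongr
    have h2 : m ^ 5 ≥ m := by nlinarith [pow_succ m 4]
    have h3 : m ^ 5 ≥ m ^ 2 := Nat.pow_le_pow_right hm0 (by omega)
    have h4 : m * (20 + 2 * m * (600 * m ^ 3 + 20) + 5) = 1200 * m ^ 5 + 40 * m ^ 2 + 25 * m := by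
      ring
    omega

theorem addGram_spec (hσ : σ < E.word) (hσ0 : 0 < σ)
    (hn : E.text.length = n)
    (hW : SQ + 2 * n + 200 ≤ E.word) (hSQ : SQ = σ ^ q)
    (hsize : SQ ≤ E.size) (hs : Searching E.pattern k n q L sh SQ s)
    {p i v : ℕ} (h12 : s.reg 12 = p) (h13 : s.reg 13 = v) (h14 : s.reg 14 = i)
    (hv : v + q ≤ n) (hp : p + (sh - 1) + i * q + q ≤ n) :
    HT E (addGram σ) s (30 + 15 * q) fun s' => Searching E.pattern k n q L sh SQ s' ∧
      (∀ r < 13, s'.reg r = s.reg r) ∧ s'.reg 14 = i ∧ s'.reg 15 = s.reg 15 ∧ s'.out = s.out ∧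
      s'.reg 13 = v + gramDist E.pattern q (gramCode E.text (p + (sh - 1) + i * q) q) := by
  unfold addGram
  refine HT.assign_seq hσ.le (v := 0) ?_ ?_ ?_
  · simp [Arith.Ok]; omega
  · simp [Arith.eval]
  refine HT.assign_seq hσ.le (v := p + (sh - 1) + i * q) ?_ ?_ ?_
  · simp [Arith.Ok, Arith.eval, h12, h14, hs.r6, hs.r3]; omega
  · simp [Arith.eval, h12, h14, hs.r6, hs.r3]
  refine HT.call_seq (HT.forTo_const hσ.le (N := q) (by decide) (by decide) (by decide) ?_ ?_
    (by omega) (by omega) (fun a s' => Searching E.pattern k n q L sh SQ s' ∧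
      (∀ r < 16, s'.reg r = s.reg r) ∧ s'.out = s.out ∧ s'.reg 19 = p + (sh - 1) + i * q ∧
      s'.reg 16 = gramCode E.text (p + (sh - 1) + i * q) a) 10 ?_ ?_ (fun s' _ _ h => h)) ?_ ?_
  · simp [Arith.Ok]
  · simp [Arith.eval, hs.r3]
  · refine ⟨(((hs.set _).set _).set _).set _, fun r hr => ?_, by simp, by simp, ?_⟩
    · have h1 : r ≠ 17 := by omega
      have h2 : r ≠ 18 := by omega
      have h3 : r ≠ 19 := by omega
      have h4 : r ≠ 16 := by omega
      simp [h1, h2, h3, h4]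
    · simp [gramCode]
  · rintro a ha s₁ h17 h18 ⟨i1, i2, i5, i3, i4⟩
    -- The code is built by Horner's rule, and every intermediate value is itself the code of a
    -- shorter gram, so nothing overflows.
    have hc : gramCode E.text (p + (sh - 1) + i * q) (a + 1) < SQ := by
      rw [hSQ]
      exact (gramCode_lt hσ0 _ _ _).trans_le (Nat.pow_le_pow_right hσ0 (by omega))
    rw [gramCode] at hc
    refine HT.assign_end hσ.le (v := gramCode E.text (p + (sh - 1) + i * q) (a + 1)) ?_ ?_ ?_
    · simp [Arith.Ok, Arith.eval, i3, i4, h17, hσ]; omega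
    · simp [Arith.eval, i3, i4, h17, gramCode]
    · refine ⟨by simp [h17], by simp [h18], (i1.set _).set _, fun r hr => ?_, by simp [i5],
        by simp [i3], by simp⟩
      have h1 : r ≠ 17 := by omega
      have h4 : r ≠ 16 := by omega
      simp [h1, h4, i2 r hr]
  · simp only [Arith.cost]; omega
  rintro s₁ ⟨i1, i2, i5, i3, i4⟩
  have hc : gramCode E.text (p + (sh - 1) + i * q) q < SQ := hSQ ▸ gramCode_lt hσ0 _ _ _
  have hg := gramDist_le E.pattern q (gramCode E.text (p + (sh - 1) + i * q) q)
  have e13 := (i2 13 (by omega)).trans h13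
  refine HT.assign_end hσ.le
    (v := v + gramDist E.pattern q (gramCode E.text (p + (sh - 1) + i * q) q)) ?_ ?_ ?_ ?_ ?_
  · simp [Arith.Ok, Arith.eval, i4, i1.table _ hc, e13]; omega
  · simp [Arith.eval, i4, i1.table _ hc, e13]
  · refine ⟨i1.set _, fun r hr => ?_, by simp [i2, h14], by simp [i2], by simp [i5], by simp⟩
    have h1 : r ≠ 13 := by omega
    simp [h1, i2 r (by omega)]
  · decide
  · simp only [Arith.cost]; omega

/-- Reading the grams always costs `O(L q)`. The price of verification stays conditional on the
text, so that it can be averaged later. -/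
theorem searchWindow_spec (hσ : σ < E.word) (hσ0 : 0 < σ) (hm : E.pattern.length = m)
    (hn : E.text.length = n) (hm0 : 0 < m) (hk : k < m) (hSQ : SQ = σ ^ q)
    (hW : SQ + 12 * m + 2 * n + 200 ≤ E.word)
    (hsize : SQ + 6 * m + 2 ≤ E.size) (hs : Searching E.pattern k n q L sh SQ s) (hsh : sh ≤ m)
    (hq : 1 ≤ q) (hL : 1 ≤ L) {g : ℕ} (h10 : s.reg 10 = g)
    (hg : g * sh + (sh - 1) + L * q ≤ n) :
    HT E (searchWindow σ) s (80 * (L * q) +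
      if gramSum E.pattern E.text q L (g * sh + (sh - 1)) ≤ k then 3000 * m ^ 5 else 0) fun s' =>
      Searching E.pattern k n q L sh SQ s' ∧ s'.reg 10 = g ∧ s'.reg 11 = s.reg 11 ∧
      ∀ i l, (i, l) ∈ s'.out ↔ (i, l) ∈ s.out ∨
        (gramSum E.pattern E.text q L (g * sh + (sh - 1)) ≤ k ∧ (∃ e < sh, i = g * sh + e) ∧
          l ≤ m + k ∧ i + l ≤ n ∧ ∃ j < m, Hit E.pattern E.text k i l j) := by
  have hm5 : m ^ 5 ≥ 1 := Nat.one_le_pow _ _ hm0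
  have hLq : L ≤ L * q := Nat.le_mul_of_pos_right _ hq
  have hLq' : L * (30 + 15 * q + 5) = 35 * L + 15 * (L * q) := by ring
  unfold searchWindow
  refine HT.assign_seq hσ.le (v := g * sh) ?_ ?_ ?_ (by decide)
    (by simp only [Arith.cost]; omega)
  · simp [Arith.Ok, Arith.eval, h10, hs.r6]; omega
  · simp [Arith.eval, h10, hs.r6]
  refine HT.assign_seq hσ.le (v := 0) ?_ ?_ ?_ (by decide)
    (by simp only [Arith.cost]; omega)
  · simp [Arith.Ok]; omega
  · simp [Arith.eval]
  refine HT.call_seq (HT.forTo_const hσ.le (N := L) (by decide) (by decide) (by decide) ?_ ?_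
    (by omega) (by omega) (fun i s' => Searching E.pattern k n q L sh SQ s' ∧
      s'.reg 10 = g ∧ s'.reg 11 = s.reg 11 ∧ s'.reg 12 = g * sh ∧ s'.out = s.out ∧
      s'.reg 13 = gramSum E.pattern E.text q i (g * sh + (sh - 1))) (30 + 15 * q) ?_ ?_
      (fun s' _ _ h => h)) ?_ ?_
  · simp [Arith.Ok]
  · simp [Arith.eval, hs.r4]
  · exact ⟨(((hs.set _).set _).set _).set _, by simp [h10], by simp, by simp, by simp,
      by simp [gramSum]⟩
  · rintro i hi s₁ h14 h15 ⟨i1, i2, i3, i4, i5, i6⟩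
    have h1 : (i + 1) * q ≤ L * q := Nat.mul_le_mul_right _ (by omega)
    have h2 : (i + 1) * q = i * q + q := by ring
    have h3 := gramSum_le E.pattern E.text q i (g * sh + (sh - 1))
    refine (addGram_spec hσ hσ0 hn (by omega) hSQ (by omega) i1 i4 i6 h14 (by omega)
      (by omega)).mono ?_
    rintro s₂ ⟨j1, j2, j3, j4, j5, j6⟩
    refine ⟨j3, j4.trans h15, j1.set _, by simp [j2, i2], by simp [j2, i3], by simp [j2, i4],
      by simp [j5, i5], ?_⟩
    simp [j6, gramSum, Finset.sum_range_succ]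
  · simp only [Arith.cost]; omega
  rintro s₁ ⟨i1, i2, i3, i4, i5, i6⟩
  refine HT.le (HT.whenLt hσ.le
    (t := if gramSum E.pattern E.text q L (g * sh + (sh - 1)) ≤ k then 3000 * m ^ 5 else 1)
    ?_ ?_ ?_ ?_ ?_) ?_
  · simp [Arith.Ok]
  · simp [Arith.Ok, Arith.eval, i1.r1]; omega
  · split_ifs <;> omega
  · intro hlt
    simp only [Arith.eval, i6, i1.r1] at hlt
    have hle : gramSum E.pattern E.text q L (g * sh + (sh - 1)) ≤ k := by omega
    rw [if_pos hle]
    refine (verifyWindow_spec hσ.le hσ0 hm hn hm0 hk hW hsize i1 hsh i4 (by omega)).mono ?_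
    rintro s₂ ⟨j1, j2, j3⟩
    refine ⟨j1, by rw [j2 _ (by omega), i2], by rw [j2 _ (by omega), i3], ?_⟩
    intro i l
    simp [j3, i5, hle]
  · intro hlt
    simp only [Arith.eval, i6, i1.r1] at hlt
    have hle : ¬ gramSum E.pattern E.text q L (g * sh + (sh - 1)) ≤ k := by omega
    exact ⟨i1, i2, i3, by simp [i5, hle]⟩
  · simp only [Arith.cost]
    split_ifs <;> omega

theorem searchCmd_spec (hσ : σ < E.word) (hσ0 : 0 < σ) (hm : E.pattern.length = m)
    (hn : E.text.length = n) (hm0 : 0 < m) (hk : k < m) (hmn : m < n) (hSQ : SQ = σ ^ q)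
    (hW : SQ + 12 * m + 2 * n + 200 ≤ E.word)
    (hsize : SQ + 6 * m + 2 ≤ E.size) (hs : Ready E.pattern k q L sh SQ s) (h2 : s.reg 2 = n)
    (hsh : sh = m - k - L * q + 1) (hLq : L * q + k ≤ m)
    (hq : 1 ≤ q) (hL : 1 ≤ L) {G : ℕ} (hG : G = (n - (m - k)) / sh + 1) :
    HT E (searchCmd σ) s (20 + ∑ g ∈ Finset.range G, (85 * (L * q) +
      if gramSum E.pattern E.text q L (g * sh + (sh - 1)) ≤ k then 3000 * m ^ 5 else 0)) fun s' =>
      ∀ i l, (i, l) ∈ s'.out ↔ (i, l) ∈ s.out ∨ ∃ g < G,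
        (gramSum E.pattern E.text q L (g * sh + (sh - 1)) ≤ k ∧ (∃ e < sh, i = g * sh + e) ∧
          l ≤ m + k ∧ i + l ≤ n ∧ ∃ j < m, Hit E.pattern E.text k i l j) := by
  have hLq1 : 1 ≤ L * q := Nat.mul_pos hL hq
  have hdiv : (n - (m - k)) / sh ≤ n - (m - k) := Nat.div_le_self _ _
  unfold searchCmd
  refine HT.assign_seq hσ.le (v := m) ?_ ?_ ?_ (by decide)
    (by simp only [Arith.cost]; omega)
  · simp [Arith.Ok]
  · simp [Arith.eval, hs.r0, hm]
  refine HT.assign_seq hσ.le (v := 1) ?_ ?_ ?_ (by decide)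
    (by simp only [Arith.cost]; omega)
  · simp [Arith.Ok]; omega
  · simp [Arith.eval]
  have hS : Searching E.pattern k n q L sh SQ ((s.set 25 m).set 26 1) := by
    obtain ⟨h0, h1, h3, h4, h5, h6, h7, h8, h9⟩ := hs
    exact ⟨⟨by simp [h0], by simp [h1], by simp [h3], by simp [h4], by simp [h5], by simp [h6],
      by simp [h7], by simp [h8], h9⟩, by simp [h2], by simp [hm], by simp⟩
  refine HT.le (HT.forTo hσ.le (N := G) (by decide) (by decide) (by decide) ?_ ?_
    (by omega) (by omega) (fun g s' => Searching E.pattern k n q L sh SQ s' ∧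
      ∀ i l, (i, l) ∈ s'.out ↔ (i, l) ∈ s.out ∨ ∃ g' < g,
        (gramSum E.pattern E.text q L (g' * sh + (sh - 1)) ≤ k ∧ (∃ e < sh, i = g' * sh + e) ∧
          l ≤ m + k ∧ i + l ≤ n ∧ ∃ j < m, Hit E.pattern E.text k i l j))
      (fun g => 80 * (L * q) +
        if gramSum E.pattern E.text q L (g * sh + (sh - 1)) ≤ k then 3000 * m ^ 5 else 0)
    ?_ ?_ (fun s' _ _ h => h.2)) ?_
  · simp [Arith.Ok, Arith.eval, h2, hs.r0, hs.r1, hs.r6, hm]; omega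
  · simp [Arith.eval, h2, hs.r0, hs.r1, hs.r6, hm, hG]
  · exact ⟨(hS.set _).set _, by simp⟩
  · rintro g hg s₁ h10 h11 ⟨i1, i2⟩
    -- Since `sh - 1 + L q = m - k`, this says exactly that the block of grams ends inside the text.
    have hgs : g * sh ≤ n - (m - k) :=
      (Nat.mul_le_mul_right _ (by omega : g ≤ (n - (m - k)) / sh)).trans (Nat.div_mul_le_self _ _)
    refine (searchWindow_spec hσ hσ0 hm hn hm0 hk hSQ hW hsize i1 (by omega) hq hL h10
      (by omega)).mono ?_
    rintro s₂ ⟨j1, j2, j3, j4⟩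
    refine ⟨j2, j3.trans h11, j1.set _, fun i l => ?_⟩
    simp only [State.set_out, j4, i2]
    constructor
    · rintro ((h | ⟨g', h, h'⟩) | h)
      · exact .inl h
      · exact .inr ⟨g', by omega, h'⟩
      · exact .inr ⟨g, by omega, h⟩
    · rintro (h | ⟨g', h, h'⟩)
      · exact .inl (.inl h)
      · rcases Nat.lt_or_ge g' g with h1 | h1
        · exact .inl (.inr ⟨g', h1, h'⟩)
        · obtain rfl : g' = g := by omega
          exact .inr h'
  · have : ∀ g ∈ Finset.range G, (80 * (L * q) +
        (if gramSum E.pattern E.text q L (g * sh + (sh - 1)) ≤ k then 3000 * m ^ 5 else 0) + 5) ≤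
        (85 * (L * q) +
        if gramSum E.pattern E.text q L (g * sh + (sh - 1)) ≤ k then 3000 * m ^ 5 else 0) := by
      intro g _; omega
    have := Finset.sum_le_sum this
    simp only [Arith.cost]
    omega

end

/-! ### Edit distances and the tables -/

section
variable {α β : Type*} [DecidableEq α] [DecidableEq β]

/-- Connects the letters in `Fin σ` with the numbers that the programs compare. -/
theorem editDist_map {f : α → β} (hf : Function.Injective f) (u v : List α) :
    editDist (u.map f) (v.map f) = editDist u v := by
  induction u generalizing v with
  | nil => simp [editDist]
  | cons a u ih =>
    induction v with
    | nil => simp [editDist]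
    | cons b v ihv =>
      have h₁ := ih (b :: v)
      simp only [List.map_cons] at *
      rw [editDist, editDist, ih v, h₁, ihv]
      simp [hf.eq_iff]

theorem length_le_editDist (u v : List α) : u.length ≤ v.length + editDist u v := by
  induction u generalizing v with
  | nil => simp
  | cons a u ih =>
    induction v with
    | nil => simp [editDist]
    | cons b v ihv =>
      have h₁ := ih (b :: v)
      have h₂ := ih v
      simp only [List.length_cons] at *
      rw [editDist]
      omega

theorem length_le_editDist' (u v : List α) : v.length ≤ u.length + editDist u v := by
  induction u generalizing v with
  | nil => simp [editDist]
  | cons a u ih =>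
    induction v with
    | nil => simp
    | cons b v ihv =>
      have h₁ := ih (b :: v)
      have h₂ := ih v
      simp only [List.length_cons] at *
      rw [editDist]
      omega

/-- The edit distance is at least the sum of the edit distances of suitable pieces. -/
theorem exists_split_editDist_le (u₁ u₂ y : List α) :
    ∃ y₁ y₂, y = y₁ ++ y₂ ∧ editDist u₁ y₁ + editDist u₂ y₂ ≤ editDist (u₁ ++ u₂) y := by
  induction u₁ generalizing y with
  | nil => exact ⟨[], y, rfl, by simp [editDist]⟩
  | cons a u ih =>
    induction y with
    | nil => exact ⟨[], [], rfl, by simp [editDist_nil_right]; omega⟩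
    | cons b y ihy =>
      obtain ⟨p, p', hp, hp'⟩ := ih y
      obtain ⟨r, r', hr, hr'⟩ := ih (b :: y)
      obtain ⟨s, s', hs, hs'⟩ := ihy
      have e := editDist.eq_3 a (u ++ u₂) b y
      rw [← List.cons_append] at e
      -- Follow whichever operation attains the minimum: `b` joins the first piece unless the
      -- operation deletes `a`.
      rcases min_choice (editDist (u ++ u₂) y + if a = b then 0 else 1)
        (min (editDist (u ++ u₂) (b :: y) + 1) (editDist (a :: u ++ u₂) y + 1)) with h | h
      · refine ⟨b :: p, p', by simp [hp], ?_⟩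
        rw [e, h, editDist]
        omega
      · rcases min_choice (editDist (u ++ u₂) (b :: y) + 1)
          (editDist (a :: u ++ u₂) y + 1) with h' | h'
        · refine ⟨r, r', hr, ?_⟩
          rw [e, h, h']
          have := editDist_cons_left_le a u r
          omega
        · refine ⟨b :: s, s', by simp [hs], ?_⟩
          rw [e, h, h']
          have := editDist_cons_right_le b (a :: u) s
          omega

/-- A factor is at least as close to some factor. -/
theorem exists_infix_editDist_le (u₁ u₂ u₃ y : List α) :
    ∃ y₂, y₂ <:+: y ∧ editDist u₂ y₂ ≤ editDist (u₁ ++ u₂ ++ u₃) y := by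
  obtain ⟨z, z', rfl, h⟩ := exists_split_editDist_le (u₁ ++ u₂) u₃ y
  obtain ⟨w, w', rfl, h'⟩ := exists_split_editDist_le u₁ u₂ z
  exact ⟨w', ⟨w, z', rfl⟩, by omega⟩

end

/-! ### Strings stored back to front, and the meaning of the tables -/

/-- The list `U (a - 1), …, U 0`. -/
def lst (U : ℕ → ℕ) : ℕ → List ℕ
  | 0 => []
  | a + 1 => U a :: lst U a

theorem length_lst (U : ℕ → ℕ) (a : ℕ) : (lst U a).length = a := by
  induction a with
  | zero => rfl
  | succ a ih => simp [lst, ih]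

theorem getElem?_lst (U : ℕ → ℕ) (a i : ℕ) :
    (lst U a)[i]? = if i < a then some (U (a - 1 - i)) else none := by
  induction a generalizing i with
  | zero => simp [lst]
  | succ a ih =>
    cases i with
    | zero => simp [lst]
    | succ i =>
      simp only [lst, List.getElem?_cons_succ, ih]
      have : a - 1 - i = a + 1 - 1 - (i + 1) := by omega
      simp [this]

theorem lst_eq {σ : ℕ} {U : ℕ → ℕ} {a : ℕ} {l : List (Fin σ)} (hl : l.length = a)
    (h : ∀ i < a, U (a - 1 - i) = letter l i) : lst U a = l.map Fin.val := by
  apply List.ext_getElem?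
  intro i
  rw [getElem?_lst, List.getElem?_map]
  split_ifs with hi
  · rw [h i hi, letter_of_lt (by omega)]
    simp [hl, hi]
  · have : l[i]? = none := by simp; omega
    simp [this]

theorem letter_drop {σ : ℕ} (l : List (Fin σ)) (c i : ℕ) :
    letter (l.drop c) i = letter l (c + i) := by
  simp [letter]

theorem letter_take {σ : ℕ} (l : List (Fin σ)) {c i : ℕ} (h : i < c) :
    letter (l.take c) i = letter l i := by
  simp [letter, h]

theorem letter_rotate {σ : ℕ} (x : List (Fin σ)) {j i : ℕ} (hi : i < x.length) :
    letter (x.rotate j) i = letter x ((j + i) % x.length) := by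
  rw [letter_of_lt (by simpa using hi),
    letter_of_lt (Nat.mod_lt _ (by omega)), List.getElem_rotate]
  simp [add_comm]

theorem letter_append_self {σ : ℕ} (x : List (Fin σ)) {i : ℕ} (hi : i < 2 * x.length) :
    letter (x ++ x) i = letter x (i % x.length) := by
  rcases Nat.lt_or_ge i x.length with h | h
  · rw [Nat.mod_eq_of_lt h]; simp [letter, List.getElem?_append_left h]
  · have : i % x.length = i - x.length := by
      rw [Nat.mod_eq_sub_mod h, Nat.mod_eq_of_lt (by omega)]
    simp [letter, List.getElem?_append_right h, this]

theorem lst_textFun {σ : ℕ} {t : List (Fin σ)} {p l : ℕ} (h : p + l ≤ t.length) :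
    lst (textFun t p l) l = ((t.drop p).take l).map Fin.val := by
  refine lst_eq (by simp; omega) fun i hi => ?_
  rw [letter_take _ hi, letter_drop, textFun]
  congr 1; omega

theorem lst_patFun_rotate {σ : ℕ} (x : List (Fin σ)) (j : ℕ) :
    lst (patFun x j x.length) x.length = (x.rotate j).map Fin.val := by
  refine lst_eq (by simp) fun i hi => ?_
  rw [letter_rotate x hi, patFun]
  congr 3; omega

theorem lst_patFun_double {σ : ℕ} (x : List (Fin σ)) {b : ℕ} (hb : b ≤ 2 * x.length) :
    lst (patFun x 0 (2 * x.length)) b = ((x ++ x).drop (2 * x.length - b)).map Fin.val := by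
  refine lst_eq (by simp; omega) fun i hi => ?_
  rw [letter_drop, letter_append_self x (by omega), patFun]
  congr 2; omega

/-- The first letter of a gram is the most significant digit of its code, so reading digits from the
low end lists the gram backwards, as the tables expect. -/
theorem digitFun_gramCode {σ : ℕ} (hσ : 0 < σ) (t : List (Fin σ)) (p : ℕ) {q a : ℕ} (ha : a < q) :
    digitFun σ (gramCode t p q) a = letter t (p + (q - 1 - a)) := by
  induction q generalizing a with
  | zero => omega
  | succ q ih =>
    have hl := letter_lt hσ t (p + q)
    cases a with
    | zero =>
      simp [digitFun, gramCode, Nat.mod_eq_of_lt hl]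
    | succ a =>
      have : (gramCode t p q * σ + letter t (p + q)) / σ = gramCode t p q := by
        rw [mul_comm, Nat.mul_add_div hσ, Nat.div_eq_of_lt hl, add_zero]
      have h' := ih (a := a) (by omega)
      rw [digitFun] at h'
      rw [digitFun, gramCode, pow_succ', ← Nat.div_div_eq_div_mul, this, h']
      congr 2; omega

theorem lst_digitFun {σ : ℕ} (hσ : 0 < σ) {t : List (Fin σ)} {p q : ℕ} (h : p + q ≤ t.length) :
    lst (digitFun σ (gramCode t p q)) q = ((t.drop p).take q).map Fin.val := by
  refine lst_eq (by simp; omega) fun i hi => ?_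
  rw [letter_take _ hi, letter_drop, digitFun_gramCode hσ t p (by omega)]
  congr 1; omega

/-- Arrays run backwards, so an index counts the letters of a remaining suffix; with `lam = 1` the
recurrence is that of the edit distance itself. -/
theorem dp_one_eq (U V : ℕ → ℕ) : ∀ a b, dp 1 U V a b = editDist (lst U a) (lst V b)
  | 0, b => by simp [dp, lst, editDist, length_lst]
  | a + 1, 0 => by simp [dp, lst, editDist, length_lst]
  | a + 1, b + 1 => by
    rw [dp, lst, lst, editDist, dp_one_eq U V a b, dp_one_eq U V a (b + 1),
      dp_one_eq U V (a + 1) b]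
    rfl

theorem dp_zero_le (U V : ℕ → ℕ) : ∀ a b, dp 0 U V a b ≤ a
  | 0, b => by simp [dp]
  | a + 1, 0 => by simp [dp]
  | a + 1, b + 1 => by
    have := dp_zero_le U V a (b + 1)
    simp only [dp]; omega

/-- With `lam = 0` the rest of `V` is free once `U` is used up, so the table minimises over prefixes
of `lst V b`. This is the lower bound, needed for correctness. -/
theorem dp_zero_le_editDist (U V : ℕ → ℕ) :
    ∀ a b p, p <+: lst V b → dp 0 U V a b ≤ editDist (lst U a) p
  | 0, b, p, _ => by simp [dp]
  | a + 1, b, [], _ => by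
    simpa [editDist_nil_right, length_lst] using dp_zero_le U V (a + 1) b
  | a + 1, 0, c :: p, h => by simp [lst] at h
  | a + 1, b + 1, c :: p, h => by
    rw [lst, List.cons_prefix_cons] at h
    obtain ⟨rfl, h⟩ := h
    have h₁ := dp_zero_le_editDist U V a b p h
    have h₂ := dp_zero_le_editDist U V a (b + 1) (V b :: p) (by simpa [lst] using h)
    have h₃ := dp_zero_le_editDist U V (a + 1) b p h
    rw [lst] at h₃
    rw [dp, lst, editDist]
    omega

/-- The minimum is attained; this half is needed for counting the grams with small table entry. -/
theorem exists_editDist_le_dp_zero (U V : ℕ → ℕ) :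
    ∀ a b, ∃ p, p <+: lst V b ∧ editDist (lst U a) p ≤ dp 0 U V a b
  | 0, b => ⟨[], List.nil_prefix, by simp [lst, editDist]⟩
  | a + 1, 0 => ⟨[], List.nil_prefix, by simp [editDist_nil_right, length_lst, dp]⟩
  | a + 1, b + 1 => by
    obtain ⟨p₁, hp₁, h₁⟩ := exists_editDist_le_dp_zero U V a b
    obtain ⟨p₂, hp₂, h₂⟩ := exists_editDist_le_dp_zero U V a (b + 1)
    obtain ⟨p₃, hp₃, h₃⟩ := exists_editDist_le_dp_zero U V (a + 1) b
    rw [dp]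
    rcases min_choice (dp 0 U V a b + if U a = V b then 0 else 1)
      (min (dp 0 U V a (b + 1) + 1) (dp 0 U V (a + 1) b + 1)) with h | h
    · refine ⟨V b :: p₁, by simpa [lst] using hp₁, ?_⟩
      rw [h, lst, editDist]
      omega
    · rcases min_choice (dp 0 U V a (b + 1) + 1) (dp 0 U V (a + 1) b + 1) with h' | h'
      · refine ⟨p₂, hp₂, ?_⟩
        have := editDist_cons_left_le (U a) (lst U a) p₂
        rw [h, h', lst]; omega
      · refine ⟨V b :: p₃, by simpa [lst] using hp₃, ?_⟩
        have := editDist_cons_right_le (V b) (lst U (a + 1)) p₃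
        rw [h, h']; omega

theorem hit_iff {σ : ℕ} {x t : List (Fin σ)} {k p l j : ℕ} (h : p + l ≤ t.length) :
    Hit x t k p l j ↔ editDist ((t.drop p).take l) (x.rotate j) ≤ k := by
  rw [Hit, dp_one_eq, lst_textFun h, lst_patFun_rotate, editDist_map Fin.val_injective]

/-- A factor of `x ++ x` is a prefix of a suffix: the table minimises over prefixes and `minTo` over
suffixes. -/
theorem gramDist_le_editDist {σ : ℕ} (hσ : 0 < σ) {x t y : List (Fin σ)} {p q : ℕ}
    (h : p + q ≤ t.length) (hy : y <:+: x ++ x) :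
    gramDist x q (gramCode t p q) ≤ editDist ((t.drop p).take q) y := by
  obtain ⟨s, s', hs⟩ := hy
  have hlen : s.length + y.length + s'.length = 2 * x.length := by
    have := congrArg List.length hs
    simp at this; omega
  refine (minTo_le _ (b := 2 * x.length - s.length) (by omega)).trans ?_
  rw [← editDist_map Fin.val_injective, ← lst_digitFun hσ h]
  refine dp_zero_le_editDist _ _ _ _ _ ?_
  rw [lst_patFun_double x (by omega),
    show 2 * x.length - (2 * x.length - s.length) = s.length by omega, ← hs]
  simp

/-- Superadditivity of the edit distance, splitting off the last gram; both pieces of `y` are again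
factors of `x ++ x`. -/
theorem gramSum_le_editDist {σ : ℕ} (hσ : 0 < σ) {x t : List (Fin σ)} {q : ℕ} (L : ℕ) {p : ℕ}
    (h : p + L * q ≤ t.length) {y : List (Fin σ)} (hy : y <:+: x ++ x) :
    gramSum x t q L p ≤ editDist ((t.drop p).take (L * q)) y := by
  induction L generalizing y with
  | zero => simp [gramSum]
  | succ L ih =>
    have e : (L + 1) * q = L * q + q := by ring
    rw [e, List.take_add, List.drop_drop]
    obtain ⟨y₁, y₂, rfl, h'⟩ := exists_split_editDist_le ((t.drop p).take (L * q))
      ((t.drop (p + L * q)).take q) y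
    have h₁ := ih (by omega) ((List.infix_append [] y₁ y₂).trans hy)
    have h₂ := gramDist_le_editDist hσ (x := x) (t := t) (p := p + L * q) (q := q) (by omega)
      ((List.suffix_append y₁ y₂).isInfix.trans hy)
    rw [gramSum, Finset.sum_range_succ]
    rw [gramSum] at h₁
    omega

theorem rotate_infix {α : Type*} (x : List α) {j : ℕ} (hj : j < x.length) :
    x.rotate j <:+: x ++ x := by
  rw [List.rotate_eq_drop_append_take hj.le]
  refine ⟨x.take j, x.drop j, ?_⟩
  rw [← List.append_assoc, List.take_append_drop, List.append_assoc, List.take_append_drop]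

/-- The filter loses nothing: the block of grams lies inside the close factor, so it is at least as
close to some factor of the rotation. -/
theorem gramSum_le_of_close {σ : ℕ} (hσ : 0 < σ) {x t : List (Fin σ)} {q L p i l j k : ℕ}
    (hip : i ≤ p) (hpl : p + L * q ≤ i + l) (hl : i + l ≤ t.length) (hj : j < x.length)
    (h : editDist ((t.drop i).take l) (x.rotate j) ≤ k) : gramSum x t q L p ≤ k := by
  obtain ⟨y, hy, hy'⟩ := exists_infix_editDist_le ((t.drop i).take (p - i))
    ((t.drop p).take (L * q)) ((t.drop (p + L * q)).take (i + l - (p + L * q))) (x.rotate j)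
  have e : (t.drop i).take (p - i) ++ (t.drop p).take (L * q) ++
      (t.drop (p + L * q)).take (i + l - (p + L * q)) = (t.drop i).take l := by
    have e₁ : l = (p - i) + L * q + (i + l - (p + L * q)) := by omega
    conv_rhs => rw [e₁, List.take_add, List.take_add, List.drop_drop, List.drop_drop]
    rw [show i + (p - i) = p by omega, show i + (p - i + L * q) = p + L * q by omega]
  rw [e] at hy'
  exact (gramSum_le_editDist hσ L (by omega) (hy.trans (rotate_infix x hj))).trans (hy'.trans h)

/-- The windows find exactly the occurrences. -/
theorem isOccurrence_iff_window {σ : ℕ} (hσ : 0 < σ) {x t : List (Fin σ)} {m n k q L sh G : ℕ}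
    (hm : x.length = m) (hn : t.length = n) (hsh : sh = m - k - L * q + 1) (hLq : L * q + k ≤ m)
    (hG : G = (n - (m - k)) / sh + 1) (i l : ℕ) :
    IsOccurrence x t k i l ↔ ∃ g < G,
      (gramSum x t q L (g * sh + (sh - 1)) ≤ k ∧ (∃ e < sh, i = g * sh + e) ∧
        l ≤ m + k ∧ i + l ≤ n ∧ ∃ j < m, Hit x t k i l j) := by
  constructor
  · rintro ⟨hil, j, hj, h⟩
    have hlen : ((t.drop i).take l).length = l := by simp; omega
    -- The two comparisons give `m - k ≤ l ≤ m + k`: the lower bound puts the block of the window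
    -- inside the occurrence, the upper one puts `l` among the lengths tested.
    have h₁ := length_le_editDist ((t.drop i).take l) (x.rotate j)
    have h₂ := length_le_editDist' ((t.drop i).take l) (x.rotate j)
    rw [hlen, List.length_rotate] at h₁ h₂
    have hmod : i / sh * sh + i % sh = i := by rw [mul_comm]; exact Nat.div_add_mod i sh
    have hlt : i % sh < sh := Nat.mod_lt _ (by omega)
    refine ⟨i / sh, ?_, ?_, ⟨i % sh, hlt, hmod.symm⟩, by omega, by omega, j, by omega,
      (hit_iff hil).2 h⟩
    · rw [hG]
      exact Nat.lt_succ_of_le (Nat.div_le_div_right (by omega))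
    · exact gramSum_le_of_close hσ (by omega) (by omega) hil hj h
  · rintro ⟨g, -, -, -, -, hil, j, hj, h⟩
    exact ⟨by omega, j, by omega, (hit_iff (by omega)).1 h⟩

/-! ### Counting close strings -/

/-- The letters that an optimal alignment leaves unchanged; every other letter of either string
takes part in an edit operation. -/
theorem exists_common_sublist {α : Type*} [DecidableEq α] (u v : List α) :
    ∃ w : List α, w.Sublist u ∧ w.Sublist v ∧ u.length ≤ w.length + editDist u v ∧
      v.length ≤ w.length + editDist u v := by
  induction u generalizing v with
  | nil => exact ⟨[], by simp, by simp, by simp, by simp [editDist]⟩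
  | cons a u ih =>
    induction v with
    | nil => exact ⟨[], by simp, by simp, by simp [editDist], by simp⟩
    | cons b v ihv =>
      obtain ⟨w₁, h₁⟩ := ih v
      obtain ⟨w₂, h₂⟩ := ih (b :: v)
      obtain ⟨w₃, h₃⟩ := ihv
      simp only [List.length_cons] at h₂ h₃ ⊢
      rcases min_choice (editDist u v + if a = b then 0 else 1)
        (min (editDist u (b :: v) + 1) (editDist (a :: u) v + 1)) with h | h
      · rw [editDist, h]
        split_ifs with hab
        · subst hab
          refine ⟨a :: w₁, h₁.1.cons_cons a, h₁.2.1.cons_cons a, ?_, ?_⟩ <;>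
            simp only [List.length_cons] <;> omega
        · exact ⟨w₁, h₁.1.cons a, h₁.2.1.cons b, by omega, by omega⟩
      · rw [editDist, h]
        rcases min_choice (editDist u (b :: v) + 1) (editDist (a :: u) v + 1) with h' | h'
        · exact ⟨w₂, h₂.1.cons a, h₂.2.1, by omega, by omega⟩
        · exact ⟨w₃, h₃.1, h₃.2.1.cons b, by omega, by omega⟩

/-- An embedding of `w` skips at most `e` letters of `u`, so its first `r` letters land among the
first `r + e`. -/
theorem take_sublist_take {α : Type*} {w u : List α} (h : w.Sublist u) (r e : ℕ)
    (hl : u.length ≤ w.length + e) : (w.take r).Sublist (u.take (r + e)) := by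
  induction h generalizing r e with
  | slnil => simp
  | @cons w u a h ih =>
    have := h.length_le
    simp only [List.length_cons] at hl
    have := ih r (e - 1) (by omega)
    rw [show r + e = r + (e - 1) + 1 by omega, List.take_succ_cons]
    exact this.cons a
  | @cons_cons w u a h ih =>
    cases r with
    | zero => simp
    | succ r =>
      rw [show r + 1 + e = r + e + 1 by omega, List.take_succ_cons, List.take_succ_cons]
      simp only [List.length_cons] at hl
      exact (ih r e (by omega)).cons_cons a

section
variable {α : Type*} [DecidableEq α] [Fintype α]

/-- Pascal's rule: the first letter of the string is either free or matched with the first letter of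
`w`. -/
theorem card_sublist_ofFn_le (w : List α) (q : ℕ) (hq : w.length ≤ q) :
    (Finset.univ.filter fun v : Fin q → α => w.Sublist (List.ofFn v)).card ≤
      q.choose w.length * Fintype.card α ^ (q - w.length) := by
  classical
  induction q generalizing w with
  | zero =>
    obtain rfl : w = [] := List.length_eq_zero_iff.1 (by omega)
    simp
  | succ q ih =>
    cases w with
    | nil => simp
    | cons b w =>
      have e : (Finset.univ.filter fun v : Fin (q + 1) → α => (b :: w).Sublist (List.ofFn v)).card =
          (Finset.univ.filter fun p : α × (Fin q → α) =>
            (b :: w).Sublist (p.1 :: List.ofFn p.2)).card := by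
        refine Finset.card_equiv (Fin.consEquiv fun _ => α).symm fun v => ?_
        simp only [Finset.mem_filter, Finset.mem_univ, true_and, List.ofFn_succ]
        rfl
      rw [e]
      have hsub : (Finset.univ.filter fun p : α × (Fin q → α) =>
            (b :: w).Sublist (p.1 :: List.ofFn p.2)) ⊆
          (Finset.univ ×ˢ
            (Finset.univ.filter fun v : Fin q → α => (b :: w).Sublist (List.ofFn v))) ∪
          ({b} ×ˢ (Finset.univ.filter fun v : Fin q → α => w.Sublist (List.ofFn v))) := by
        rintro ⟨a, v⟩ hp
        simp only [Finset.mem_filter, Finset.mem_univ, true_and] at hp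
        simp only [Finset.mem_union, Finset.mem_product, Finset.mem_univ, Finset.mem_filter,
          true_and, Finset.mem_singleton]
        rw [List.sublist_cons_iff] at hp
        rcases hp with h | ⟨r, h, h'⟩
        · exact .inl h
        · obtain ⟨rfl, rfl⟩ := List.cons.inj h
          exact .inr ⟨rfl, h'⟩
      refine (Finset.card_le_card hsub).trans ((Finset.card_union_le _ _).trans ?_)
      rw [Finset.card_product, Finset.card_product, Finset.card_univ, Finset.card_singleton,
        one_mul]
      simp only [List.length_cons] at hq ⊢
      have h₂ := ih w (by omega)
      rw [Nat.choose_succ_succ', add_mul, add_comm,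
        show q + 1 - (w.length + 1) = q - w.length by omega]
      refine Nat.add_le_add h₂ ?_
      rcases Nat.lt_or_ge q (w.length + 1) with h | h
      · have : (Finset.univ.filter fun v : Fin q → α => (b :: w).Sublist (List.ofFn v)) = ∅ := by
          refine Finset.filter_eq_empty_iff.2 fun v _ hv => ?_
          have := hv.length_le
          simp at this; omega
        simp [this]
      · have h₁ := ih (b :: w) (by simpa using h)
        simp only [List.length_cons] at h₁
        calc _ ≤ Fintype.card α * (q.choose (w.length + 1) *
              Fintype.card α ^ (q - (w.length + 1))) := Nat.mul_le_mul_left _ h₁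
          _ = q.choose (w.length + 1) * Fintype.card α ^ (q - (w.length + 1) + 1) := by ring
          _ = _ := by congr 2; omega

/-- The number of strings of length `q` within distance `q - r` of a prefix of `u`. -/
theorem card_close_prefix_le (u : List α) {q r : ℕ} (hr : r ≤ q) (B : Finset (Fin q → α))
    (hB : ∀ v ∈ B, ∃ p, p <+: u ∧ editDist (List.ofFn v) p ≤ q - r) :
    B.card ≤ q.choose r ^ 2 * Fintype.card α ^ (q - r) := by
  classical
  have hsub : B ⊆
      ((u.take q).sublistsLen r).toFinset.biUnion fun w =>
        Finset.univ.filter fun v : Fin q → α => w.Sublist (List.ofFn v) := by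
    intro v hv
    obtain ⟨p, hp, h⟩ := hB v hv
    obtain ⟨w, hw₁, hw₂, hl₁, hl₂⟩ := exists_common_sublist (List.ofFn v) p
    rw [List.length_ofFn] at hl₁
    simp only [Finset.mem_biUnion, List.mem_toFinset, List.mem_sublistsLen, Finset.mem_filter,
      Finset.mem_univ, true_and]
    -- Truncation to `r` letters moves the common subsequence into the first `q` letters of `u`, so
    -- the number of choices does not depend on the length of `u`.
    refine ⟨w.take r, ⟨?_, by simp; omega⟩, (List.take_sublist r w).trans hw₁⟩
    have := take_sublist_take hw₂ r (q - r) (by omega)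
    rw [show r + (q - r) = q by omega] at this
    exact this.trans (hp.take q).sublist
  refine (Finset.card_le_card hsub).trans (Finset.card_biUnion_le.trans ?_)
  have hterm : ∀ w ∈ ((u.take q).sublistsLen r).toFinset,
      (Finset.univ.filter fun v : Fin q → α => w.Sublist (List.ofFn v)).card ≤
      q.choose r * Fintype.card α ^ (q - r) := by
    intro w hw
    rw [List.mem_toFinset, List.mem_sublistsLen] at hw
    have := card_sublist_ofFn_le w q (by omega)
    rwa [hw.2] at this
  refine (Finset.sum_le_card_nsmul _ _ _ hterm).trans ?_
  have hcard : ((u.take q).sublistsLen r).toFinset.card ≤ q.choose r := by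
    refine (List.toFinset_card_le _).trans ?_
    rw [List.length_sublistsLen]
    exact Nat.choose_le_choose r (by simp)
  calc _ ≤ q.choose r * (q.choose r * Fintype.card α ^ (q - r)) := Nat.mul_le_mul_right _ hcard
    _ = _ := by ring

end

/-! ### Independence of disjoint groups of coordinates -/

section
variable {N S : Type*} [DecidableEq N] [Fintype S] [DecidableEq S] {q : ℕ}

/-- An event that does not depend on the coordinates in the range of `e` is independent of them: all
fibres of `x ↦ x ∘ e` over `A` have the same size. -/
theorem card_filter_comp_mul (e : Fin q → N) (he : Function.Injective e) (A : Finset (N → S))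
    (hA : ∀ x ∈ A, ∀ x' : N → S, (∀ i, (∀ a, e a ≠ i) → x' i = x i) → x' ∈ A)
    (B : Finset (Fin q → S)) :
    (A.filter fun x => x ∘ e ∈ B).card * Fintype.card S ^ q = A.card * B.card := by
  classical
  have hext : ∀ (w : Fin q → S) (x : N → S) (i : N), (∀ a, e a ≠ i) →
      Function.extend e w x i = x i := fun w x i hi =>
    Function.extend_apply' _ _ _ fun ⟨a, ha⟩ => hi a ha
  -- Overwriting these coordinates by `w'` maps one fibre injectively into the other.
  have key : ∀ w w' : Fin q → S,
      (A.filter fun x => x ∘ e = w).card ≤ (A.filter fun x => x ∘ e = w').card := by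
    intro w w'
    refine Finset.card_le_card_of_injOn (fun x => Function.extend e w' x) ?_ ?_
    · intro x hx
      simp only [Finset.coe_filter, Set.mem_ofPred_eq] at hx ⊢
      exact ⟨hA x hx.1 _ (hext w' x), Function.extend_comp he _ _⟩
    · intro x hx y hy hxy
      simp only [Finset.coe_filter, Set.mem_ofPred_eq] at hx hy
      funext i
      by_cases hi : ∃ a, e a = i
      · obtain ⟨a, rfl⟩ := hi
        have h₁ := congrFun hx.2 a
        have h₂ := congrFun hy.2 a
        simp only [Function.comp] at h₁ h₂
        rw [h₁, h₂]
      · have h := congrFun hxy i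
        push Not at hi
        simp only [hext _ _ i hi] at h
        exact h
  have h₁ : (A.filter fun x => x ∘ e ∈ B).card =
      ∑ w ∈ B, (A.filter fun x => x ∘ e = w).card := by
    rw [Finset.card_eq_sum_card_fiberwise (f := fun x : N → S => x ∘ e) (t := B)]
    · refine Finset.sum_congr rfl fun w hw => ?_
      rw [Finset.filter_filter]
      congr 1
      ext x
      simp only [Finset.mem_filter]
      constructor
      · rintro ⟨h, -, h'⟩; exact ⟨h, h'⟩
      · rintro ⟨h, h'⟩; exact ⟨h, h' ▸ hw, h'⟩
    · intro x hx
      simp only [Finset.coe_filter, Set.mem_ofPred_eq] at hx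
      exact hx.2
  have h₂ : A.card = ∑ w : Fin q → S, (A.filter fun x => x ∘ e = w).card :=
    Finset.card_eq_sum_card_fiberwise fun x _ => Finset.mem_coe.2 (Finset.mem_univ _)
  have h₃ : ∀ w : Fin q → S, (A.filter fun x => x ∘ e = w).card * Fintype.card S ^ q = A.card := by
    intro w
    rw [h₂, Finset.sum_congr rfl fun w' _ => le_antisymm (key w' w) (key w w')]
    simp [mul_comm]
  rw [h₁, Finset.sum_mul, Finset.sum_congr rfl fun w _ => h₃ w, Finset.sum_const, smul_eq_mul,
    mul_comm]

theorem card_filter_forall_comp_mul [Fintype N] {I : Type*} [DecidableEq I] (J : Finset I)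
    (e : I → Fin q → N)
    (he : ∀ i ∈ J, ∀ j ∈ J, ∀ a b, e i a = e j b → i = j ∧ a = b) (B : Finset (Fin q → S)) :
    (Finset.univ.filter fun x : N → S => ∀ j ∈ J, x ∘ e j ∈ B).card *
      (Fintype.card S ^ q) ^ J.card = Fintype.card S ^ Fintype.card N * B.card ^ J.card := by
  classical
  induction J using Finset.induction_on with
  | empty => simp
  | insert j J hj ih =>
    have ih' := ih fun i hi i' hi' =>
      he i (Finset.mem_insert_of_mem hi) i' (Finset.mem_insert_of_mem hi')
    have h := card_filter_comp_mul (e j)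
      (fun a b hab => (he j (Finset.mem_insert_self _ _) j (Finset.mem_insert_self _ _) a b hab).2)
      (Finset.univ.filter fun x : N → S => ∀ j ∈ J, x ∘ e j ∈ B) (by
        intro x hx x' hx'
        simp only [Finset.mem_filter, Finset.mem_univ, true_and] at hx ⊢
        intro i hi
        have : x' ∘ e i = x ∘ e i := by
          funext a
          refine hx' _ fun b hb => ?_
          have := (he j (Finset.mem_insert_self _ _) i (Finset.mem_insert_of_mem hi) b a hb).1
          exact hj (this ▸ hi)
        rw [this]; exact hx i hi) B
    rw [Finset.filter_filter] at h
    have e : (Finset.univ.filter fun x : N → S => ∀ i ∈ insert j J, x ∘ e i ∈ B) =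
        (Finset.univ.filter fun x : N → S => (∀ i ∈ J, x ∘ e i ∈ B) ∧ x ∘ e j ∈ B) := by
      ext x
      simp [and_comm]
    rw [e, Finset.card_insert_of_notMem hj, pow_succ', pow_succ', ← mul_assoc, h,
      mul_right_comm, ih']
    ring

end

/-! ### The probability that a window is verified -/

/-- The grams that are close to some factor of the doubled pattern. -/
def closeGrams {σ : ℕ} (x : List (Fin σ)) (q h : ℕ) : Finset (Fin q → Fin σ) :=
  Finset.univ.filter fun v => gramDist x q (gramCode (List.ofFn v) 0 q) ≤ h

/-- A union over the `2 m + 1` suffixes of the doubled pattern. -/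
theorem card_closeGrams_le {σ : ℕ} (hσ : 0 < σ) (x : List (Fin σ)) {q r : ℕ} (hr : r ≤ q) :
    (closeGrams x q (q - r)).card ≤ (2 * x.length + 1) * (q.choose r ^ 2 * σ ^ (q - r)) := by
  classical
  have hsub : closeGrams x q (q - r) ⊆ (Finset.range (2 * x.length + 1)).biUnion fun c =>
      Finset.univ.filter fun v : Fin q → Fin σ =>
        ∃ p, p <+: (x ++ x).drop (2 * x.length - c) ∧ editDist (List.ofFn v) p ≤ q - r := by
    intro v hv
    simp only [closeGrams, Finset.mem_filter, Finset.mem_univ, true_and] at hv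
    obtain ⟨b, hb, h⟩ := exists_minTo_eq
      (dp 0 (digitFun σ (gramCode (List.ofFn v) 0 q)) (patFun x 0 (2 * x.length)) q) (2 * x.length)
    rw [gramDist, h] at hv
    obtain ⟨p, hp, h'⟩ := exists_editDist_le_dp_zero
      (digitFun σ (gramCode (List.ofFn v) 0 q)) (patFun x 0 (2 * x.length)) q b
    rw [lst_patFun_double x hb] at hp
    obtain ⟨p', hp', rfl⟩ := List.prefix_map_iff.1 hp
    rw [lst_digitFun hσ (by simp), editDist_map Fin.val_injective] at h'
    simp only [Finset.mem_biUnion, Finset.mem_range, Finset.mem_filter, Finset.mem_univ, true_and]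
    refine ⟨b, by omega, p', hp', ?_⟩
    have e : ((List.ofFn v).drop 0).take q = List.ofFn v := by
      rw [List.drop_zero]; exact List.take_of_length_le (by simp)
    rw [e] at h'
    exact h'.trans hv
  refine (Finset.card_le_card hsub).trans (Finset.card_biUnion_le.trans ?_)
  refine (Finset.sum_le_card_nsmul _ _ (q.choose r ^ 2 * σ ^ (q - r)) fun c _ => ?_).trans_eq ?_
  · simpa using card_close_prefix_le ((x ++ x).drop (2 * x.length - c)) hr _
      fun v hv => by simpa using hv
  · simp

theorem gramCode_congr {σ : ℕ} {t t' : List (Fin σ)} {p p' q : ℕ}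
    (h : ∀ a < q, letter t (p + a) = letter t' (p' + a)) : gramCode t p q = gramCode t' p' q := by
  induction q with
  | zero => rfl
  | succ q ih => rw [gramCode, gramCode, h q (by omega), ih fun a ha => h a (by omega)]

/-- The number of texts for which the grams read in a window do not exclude an occurrence. -/
theorem card_gramSum_le {σ : ℕ} (x : List (Fin σ)) {n k q h L p : ℕ} (hh : 0 < h)
    (hL : L = k / h + 11) (hp : p + L * q ≤ n) :
    (Finset.univ.filter fun t : Fin n → Fin σ => gramSum x (List.ofFn t) q L p ≤ k).card *
      (σ ^ q) ^ 10 ≤ L ^ 10 * (σ ^ n * (closeGrams x q h).card ^ 10) := by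
  classical
  have hL11 : 11 ≤ L := hL ▸ Nat.le_add_left 11 _
  -- Coordinates of the `i`-th gram of the block; the default value 0 is never met for `i < L`.
  let e : ℕ → Fin q → Fin n := fun i a =>
    if hi : p + i * q + a < n then ⟨p + i * q + a, hi⟩ else ⟨0, by
      have := a.2
      have : 1 * q ≤ L * q := Nat.mul_le_mul_right _ ((Nat.le_add_left 1 10).trans hL11)
      omega⟩
  have hlt : ∀ i < L, ∀ a : Fin q, p + i * q + a < n := by
    intro i hi a
    have h₁ : (i + 1) * q ≤ L * q := Nat.mul_le_mul_right _ hi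
    have h₂ : (i + 1) * q = i * q + q := by ring
    have := a.2
    omega
  have hev : ∀ i < L, ∀ a : Fin q, (e i a : ℕ) = p + i * q + a := by
    intro i hi a
    simp [e, hlt i hi a]
  have hinj : ∀ i < L, ∀ j < L, ∀ a b, e i a = e j b → i = j ∧ a = b := by
    intro i hi j hj a b hab
    have h' := congrArg Fin.val hab
    rw [hev i hi, hev j hj] at h'
    have ha := a.2
    have hb := b.2
    have hij : i = j := by
      rcases lt_trichotomy i j with hlt | heq | hgt
      · have h₁ : (i + 1) * q ≤ j * q := Nat.mul_le_mul_right _ hlt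
        have h₂ : (i + 1) * q = i * q + q := by ring
        omega
      · exact heq
      · have h₁ : (j + 1) * q ≤ i * q := Nat.mul_le_mul_right _ hgt
        have h₂ : (j + 1) * q = j * q + q := by ring
        omega
    subst hij
    exact ⟨rfl, Fin.ext (by omega)⟩
  have hclose : ∀ t : Fin n → Fin σ, ∀ i < L, t ∘ e i ∈ closeGrams x q h ↔
      gramDist x q (gramCode (List.ofFn t) (p + i * q) q) ≤ h := by
    intro t i hi
    rw [closeGrams, Finset.mem_filter, gramCode_congr (t := List.ofFn (t ∘ e i))
      (t' := List.ofFn t) (p' := p + i * q)]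
    · simp
    · intro a ha
      have h₁ := hev i hi ⟨a, ha⟩
      have h₂ := hlt i hi ⟨a, ha⟩
      rw [letter_of_lt (by simpa using ha), letter_of_lt (by simpa using h₂)]
      simp only [List.getElem_ofFn, Function.comp]
      congr 2
      ext
      simp [hev i hi]
  have hsub : (Finset.univ.filter fun t : Fin n → Fin σ =>
      gramSum x (List.ofFn t) q L p ≤ k) ⊆
      ((Finset.range L).powersetCard 10).biUnion fun J =>
        Finset.univ.filter fun t : Fin n → Fin σ => ∀ i ∈ J, t ∘ e i ∈ closeGrams x q h := by
    intro t ht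
    simp only [Finset.mem_filter, Finset.mem_univ, true_and] at ht
    obtain ⟨bad, hbad⟩ : ∃ b, b = (Finset.range L).filter fun i => t ∘ e i ∈ closeGrams x q h :=
      ⟨_, rfl⟩
    obtain ⟨good, hgood⟩ : ∃ b, b = (Finset.range L).filter
      fun i => ¬ t ∘ e i ∈ closeGrams x q h := ⟨_, rfl⟩
    -- Otherwise at least `k / h + 2` grams contribute at least `h + 1` each, more than `k` in
    -- total.
    have hcard : 10 ≤ bad.card := by
      by_contra hlt'
      have hsum : bad.card + good.card = L := by
        rw [hbad, hgood, Finset.card_filter_add_card_filter_not, Finset.card_range]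
      have h₁ : good.card * (h + 1) ≤ gramSum x (List.ofFn t) q L p := by
        refine (Finset.card_nsmul_le_sum _
          (fun i => gramDist x q (gramCode (List.ofFn t) (p + i * q) q)) (h + 1) ?_).trans
          (Finset.sum_le_sum_of_subset (hgood ▸ Finset.filter_subset _ _))
        intro i hi
        rw [hgood, Finset.mem_filter, Finset.mem_range] at hi
        rw [hclose t i hi.1] at hi
        omega
      have h₃ := Nat.lt_mul_div_succ k hh
      generalize k / h = c at *
      have h₂ : (c + 1) * (h + 1) ≤ good.card * (h + 1) := Nat.mul_le_mul_right _ (by omega)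
      have h₄ : (c + 1) * (h + 1) = h * (c + 1) + (c + 1) := by ring
      omega
    obtain ⟨J, hJ, hJc⟩ := Finset.exists_subset_card_eq hcard
    simp only [Finset.mem_biUnion, Finset.mem_powersetCard, Finset.mem_filter, Finset.mem_univ,
      true_and]
    exact ⟨J, ⟨hJ.trans (hbad ▸ Finset.filter_subset _ _), hJc⟩, fun i hi => by
      have := hJ hi
      rw [hbad, Finset.mem_filter] at this
      exact this.2⟩
  have hJcard : ∀ J ∈ (Finset.range L).powersetCard 10,
      (Finset.univ.filter fun t : Fin n → Fin σ => ∀ i ∈ J, t ∘ e i ∈ closeGrams x q h).card *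
        (σ ^ q) ^ 10 = σ ^ n * (closeGrams x q h).card ^ 10 := by
    intro J hJ
    rw [Finset.mem_powersetCard] at hJ
    have := card_filter_forall_comp_mul J e (fun i hi j hj => hinj i
      (Finset.mem_range.1 (hJ.1 hi)) j (Finset.mem_range.1 (hJ.1 hj))) (closeGrams x q h)
    simpa [hJ.2] using this
  calc _ ≤ (∑ J ∈ (Finset.range L).powersetCard 10, (Finset.univ.filter
        fun t : Fin n → Fin σ => ∀ i ∈ J, t ∘ e i ∈ closeGrams x q h).card) * (σ ^ q) ^ 10 :=
        Nat.mul_le_mul_right _ ((Finset.card_le_card hsub).trans Finset.card_biUnion_le)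
    _ = L.choose 10 * (σ ^ n * (closeGrams x q h).card ^ 10) := by
        rw [Finset.sum_mul, Finset.sum_congr rfl hJcard]
        simp
    _ ≤ _ := Nat.mul_le_mul_right _ (Nat.choose_le_pow _ _)

/-! ### The algorithm -/

/-- The matching algorithm. -/
def gramAlgorithm (σ R N : ℕ) : Algorithm := ⟨prepCmd σ R N, searchCmd σ⟩

/-- The grams are unlikely to be close to the pattern. -/
def GramsRare (σ R N : ℕ) : Prop :=
  ∀ a, (((R * (N * a)).choose (N * a)) ^ 2) ^ 2 * σ ^ (5 * a) ≤ σ ^ (2 * (N * a))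

section
variable {σ R N m k n q L sh : ℕ}

/-- The survival probability of a window is `O(m ^ (-5))`, which exactly offsets the cost of
verification. -/
theorem card_gramSum_mul_le (hσ : 2 ≤ σ) (hR : 2 ≤ R) (hN : 1 ≤ N) (hrare : GramsRare σ R N)
    {x : List (Fin σ)} (hm : x.length = m) (hσm : σ ≤ m) (hq : gramLen σ R N m = q)
    (hL : gramCount σ R N m k = L) (hLq : L * q + k ≤ m) {p : ℕ} (hp : p + L * q ≤ n) :
    (Finset.univ.filter fun t : Fin n → Fin σ => gramSum x (List.ofFn t) q L p ≤ k).card * m ^ 5 ≤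
      (9 * σ ^ 5) ^ 5 * σ ^ n := by
  have hlog : 1 ≤ Nat.log σ m := Nat.log_pos (by omega) hσm
  set lam := Nat.log σ m with hlam
  have hr : q = R * (N * lam) := by rw [← hq, gramLen, mul_assoc]
  have hrq : N * lam ≤ q := hr ▸ Nat.le_mul_of_pos_left _ (by omega)
  have hh : (R - 1) * N * lam = q - N * lam := by
    rw [hr, mul_assoc, Nat.sub_mul, one_mul]
  have hh0 : 0 < q - N * lam := by
    rw [← hh]; have : 0 < R - 1 := by omega
    positivity
  have hq1 : 1 ≤ q := by omega
  have hLm : L ≤ m := by nlinarith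
  have hlt : m < σ ^ (lam + 1) := Nat.lt_pow_succ_log_self (by omega) m
  have h₁ := card_gramSum_le (n := n) (k := k) (q := q) (h := q - N * lam) (L := L) (p := p) x hh0
    (by rw [← hL, gramCount, ← hlam, hh]) hp
  have h₂ := card_closeGrams_le (by omega) x hrq
  rw [hm] at h₂
  obtain ⟨F, hF⟩ : ∃ F, F = (Finset.univ.filter fun t : Fin n → Fin σ =>
    gramSum x (List.ofFn t) q L p ≤ k).card := ⟨_, rfl⟩
  obtain ⟨b, hb⟩ : ∃ b, b = (closeGrams x q (q - N * lam)).card := ⟨_, rfl⟩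
  rw [← hF] at h₁ ⊢
  rw [← hb] at h₁ h₂
  have hra := hrare lam
  rw [← hr] at hra
  obtain ⟨c, hc⟩ : ∃ c, c = q.choose (N * lam) ^ 2 := ⟨_, rfl⟩
  rw [← hc] at hra h₂
  have h3m : 2 * m + 1 ≤ 3 * m := by omega
  -- Squares avoid a half-integral exponent: by `GramsRare` a gram is close with probability `O(m ·
  -- m ^ (-5/2))`, the factor `m` counting suffixes of the doubled pattern.
  have h₃ : b ^ 2 * m ^ 5 ≤ 9 * σ ^ 5 * (σ ^ q) ^ 2 * m ^ 2 := by
    calc b ^ 2 * m ^ 5 ≤ (3 * m * (c * σ ^ (q - N * lam))) ^ 2 * (σ ^ (lam + 1)) ^ 5 := by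
          gcongr
          exact h₂.trans (Nat.mul_le_mul_right _ h3m)
      _ = 9 * σ ^ 5 * m ^ 2 * σ ^ (2 * (q - N * lam)) * (c ^ 2 * σ ^ (5 * lam)) := by
          rw [← pow_mul, add_mul, pow_add, mul_comm lam 5]; ring
      _ ≤ 9 * σ ^ 5 * m ^ 2 * σ ^ (2 * (q - N * lam)) * σ ^ (2 * (N * lam)) :=
          Nat.mul_le_mul_left _ hra
      _ = 9 * σ ^ 5 * m ^ 2 * σ ^ (2 * (q - N * lam) + 2 * (N * lam)) := by rw [pow_add]; ring
      _ = 9 * σ ^ 5 * m ^ 2 * σ ^ (q * 2) := by congr 2; omega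
      _ = _ := by rw [pow_mul]; ring
  have h₄ : b ^ 2 * m ^ 3 ≤ 9 * σ ^ 5 * (σ ^ q) ^ 2 := by
    refine Nat.le_of_mul_le_mul_right (c := m ^ 2) ?_ (by have : 0 < m := by omega
                                                          positivity)
    calc _ = b ^ 2 * m ^ 5 := by ring
      _ ≤ _ := h₃
  -- The fifth power of this bounds ten close grams, with `L ^ 10` choices for them, against `m ^
  -- 5`.
  have h₅ : (L * b) ^ 2 * m ≤ 9 * σ ^ 5 * (σ ^ q) ^ 2 := by
    calc (L * b) ^ 2 * m = L ^ 2 * (b ^ 2 * m) := by ring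
      _ ≤ m ^ 2 * (b ^ 2 * m) := by gcongr
      _ = b ^ 2 * m ^ 3 := by ring
      _ ≤ _ := h₄
  refine Nat.le_of_mul_le_mul_right (c := (σ ^ q) ^ 10) ?_ (by have : 0 < σ := by omega
                                                               positivity)
  calc F * m ^ 5 * (σ ^ q) ^ 10 = (F * (σ ^ q) ^ 10) * m ^ 5 := by ring
    _ ≤ (L ^ 10 * (σ ^ n * b ^ 10)) * m ^ 5 := Nat.mul_le_mul_right _ h₁
    _ = σ ^ n * ((L * b) ^ 2 * m) ^ 5 := by ring
    _ ≤ σ ^ n * (9 * σ ^ 5 * (σ ^ q) ^ 2) ^ 5 := by gcongr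
    _ = _ := by ring

/-- The constant in the bound of the expected search time. -/
def searchConst (σ : ℕ) : ℕ := 105 + 3000 * (9 * σ ^ 5) ^ 5

theorem gramAlgorithm_solves (hσ : 2 ≤ σ) (hR : 2 ≤ R) (hN : 1 ≤ N) (hrare : GramsRare σ R N)
    {x : List (Fin σ)} (hm : x.length = m) (hσm : σ ≤ m) (hm300 : 300 ≤ m)
    (hq : gramLen σ R N m = q)
    (hL : gramCount σ R N m k = L) (hLq : L * q + k ≤ m) (hsh : windowShift σ R N m k = sh)
    (hmn : m < n) {word size : ℕ} (hword : n ^ (R * N + 2) ≤ word) (hsize : 9 * σ ^ q ≤ size) :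
    ∃ (Tp : ℕ) (Ts : (Fin n → Fin σ) → ℕ),
      (gramAlgorithm σ R N).Solves word size x k n Tp Ts ∧ Tp ≤ 1000 * (σ ^ q * m * q) ∧
      ∑ t, Ts t ≤ σ ^ n * (((n - (m - k)) / sh + 1) * (searchConst σ * (L * q))) := by
  have hlog : 1 ≤ Nat.log σ m := Nat.log_pos (by omega) hσm
  set lam := Nat.log σ m with hlam
  have hr : q = R * N * lam := hq.symm
  have hRN : 2 ≤ R * N := by nlinarith
  have hq2 : lam + 1 ≤ q := by rw [hr]; nlinarith
  have hL11 : 11 ≤ L := by rw [← hL]; exact Nat.le_add_left 11 _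
  have hLq11 : 11 ≤ L * q := by nlinarith
  have hmq : m < σ ^ q := (Nat.lt_pow_succ_log_self (by omega) m).trans_le
    (Nat.pow_le_pow_right (by omega) hq2)
  have hqn : σ ^ q ≤ n ^ (R * N) := by
    calc σ ^ q = (σ ^ lam) ^ (R * N) := by rw [← pow_mul, hr, mul_comm]
      _ ≤ n ^ (R * N) := Nat.pow_le_pow_left
          ((Nat.pow_log_le_self σ (by omega)).trans hmn.le) _
  -- The power `n ^ (R N)` pays for `σ ^ q`; the two further factors `n`, with `n > 300`, absorb the
  -- rest.
  have hword' : σ * m + 2 * σ ^ q + 20 * n + 200 ≤ word := by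
    refine le_trans ?_ hword
    have h₁ : n ≤ n ^ (R * N) := Nat.le_self_pow (by omega) n
    obtain ⟨P, hP⟩ : ∃ P, P = n ^ (R * N) := ⟨_, rfl⟩
    rw [pow_add, ← hP]
    rw [← hP] at h₁ hqn
    have h₂ : σ * m ≤ n * P := Nat.mul_le_mul (by omega) (by omega)
    have h₃ : n * (300 * P) ≤ n * (n * P) :=
      Nat.mul_le_mul_left _ (Nat.mul_le_mul_right _ (by omega))
    have h₄ : 300 * P ≤ n * P := Nat.mul_le_mul_right _ (by omega)
    have h₅ : P * n ^ 2 = n * (n * P) := by ring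
    have h₆ : n * (300 * P) = 300 * (n * P) := by ring
    omega
  have hσW : σ < word := by omega
  set G := (n - (m - k)) / sh + 1 with hG
  have hshe : sh = m - k - L * q + 1 := by rw [← hsh, windowShift, hL, hq]
  obtain ⟨Tp, s₁, s', hex, hTp, hsim, hready⟩ := prepCmd_spec (σ := σ) (R := R) (N := N) (k := k)
    (E := ⟨word, size, x, []⟩) hσ hR hN hm hσm hq hL hsh hLq
    (show σ * m + 2 * σ ^ q + 10 * m + 200 ≤ word by omega)
    (show σ ^ q + 6 * m + 2 ≤ size by omega) (State.init m k)
    ⟨fun _ _ => rfl, rfl, rfl, fun r => by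
      simp only [State.init]; split_ifs <;> omega, fun a => by simp only [State.init]; omega⟩
  -- The simulation passes from preprocessing to search for every text: the environment enters it
  -- only through the word size.
  have hsim' : ∀ t : List (Fin σ), Sim ⟨word, size, x, t⟩ (s₁.startSearch n)
      (s'.startSearch n) := by
    intro t
    refine ⟨fun r hr => ?_, hsim.mem, rfl, fun r => ?_, hsim.mem_lt⟩
    · simp only [State.startSearch, Function.update_apply, hsim.reg r hr]
    · simp only [State.startSearch, Function.update_apply]
      split_ifs
      · show n < word; omega
      · exact hsim.reg_lt r
  have hready' : Ready x k q L sh (σ ^ q) (s'.startSearch n) := by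
    obtain ⟨h0, h1, h3, h4, h5, h6, h7, h8, h9⟩ := hready
    exact ⟨h0, h1, h3, h4, h5, h6, h7, h8, h9⟩
  have hsearch := fun t : Fin n → Fin σ =>
    searchCmd_spec (E := ⟨word, size, x, List.ofFn t⟩) hσW (by omega) hm (by simp)
      (by omega) (show k < m by omega) hmn rfl (show σ ^ q + 12 * m + 2 * n + 200 ≤ word by omega)
      (show σ ^ q + 6 * m + 2 ≤ size by omega) hready' (by simp [State.startSearch]) hshe hLq
      (by omega) (by omega) hG (s₁.startSearch n) (hsim' _)
  choose Ts s₂ s₂' hex₂ hTs hsim₂ hout using hsearch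
  refine ⟨Tp, Ts, ⟨s₁, by simpa [gramAlgorithm, hm] using hex, fun t => ⟨s₂ t, hex₂ t, ?_⟩⟩,
    hTp, ?_⟩
  · intro i l
    rw [(hsim₂ t).out, hout t, isOccurrence_iff_window (by omega) hm (by simp) hshe hLq hG]
    simp [State.startSearch]
  · have hsum : ∀ g < G, ∑ t : Fin n → Fin σ,
        (85 * (L * q) + if gramSum x (List.ofFn t) q L (g * sh + (sh - 1)) ≤ k
          then 3000 * m ^ 5 else 0) ≤ σ ^ n * (85 * (L * q) + 3000 * (9 * σ ^ 5) ^ 5) := by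
      intro g hg
      have hgs : g * sh ≤ n - (m - k) := (Nat.mul_le_mul_right _
        (by omega : g ≤ (n - (m - k)) / sh)).trans (Nat.div_mul_le_self _ _)
      have := card_gramSum_mul_le (n := n) (k := k) hσ hR hN hrare hm hσm hq hL hLq
        (p := g * sh + (sh - 1)) (by omega)
      rw [Finset.sum_add_distrib, ← Finset.sum_filter]
      simp only [Finset.sum_const, smul_eq_mul, Finset.card_univ, Fintype.card_fun,
        Fintype.card_fin]
      rw [mul_add]
      refine Nat.add_le_add le_rfl ?_
      linarith
    calc ∑ t, Ts t ≤ ∑ t : Fin n → Fin σ, (20 + ∑ g ∈ Finset.range G, (85 * (L * q) +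
          if gramSum x (List.ofFn t) q L (g * sh + (sh - 1)) ≤ k then 3000 * m ^ 5 else 0)) :=
          Finset.sum_le_sum fun t _ => hTs t
      _ = σ ^ n * 20 + ∑ g ∈ Finset.range G, ∑ t : Fin n → Fin σ, (85 * (L * q) +
          if gramSum x (List.ofFn t) q L (g * sh + (sh - 1)) ≤ k then 3000 * m ^ 5 else 0) := by
          rw [Finset.sum_add_distrib, Finset.sum_comm]
          simp
      _ ≤ σ ^ n * 20 + ∑ g ∈ Finset.range G,
          σ ^ n * (85 * (L * q) + 3000 * (9 * σ ^ 5) ^ 5) :=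
          Nat.add_le_add_left (Finset.sum_le_sum fun g hg => hsum g (Finset.mem_range.1 hg)) _
      _ = σ ^ n * (20 + G * (85 * (L * q) + 3000 * (9 * σ ^ 5) ^ 5)) := by
          simp only [Finset.sum_const, Finset.card_range, smul_eq_mul]; ring
      _ ≤ σ ^ n * (G * (searchConst σ * (L * q))) := by
          refine Nat.mul_le_mul_left _ ?_
          have h1 : 1 ≤ G := Nat.le_add_left 1 _
          have h2 : 20 + G * (85 * (L * q) + 3000 * (9 * σ ^ 5) ^ 5) ≤
              G * (20 * 1 + (85 * (L * q) + 3000 * (9 * σ ^ 5) ^ 5 * 1)) := by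
            have : G * (20 * 1 + (85 * (L * q) + 3000 * (9 * σ ^ 5) ^ 5 * 1)) =
              20 * G + G * (85 * (L * q) + 3000 * (9 * σ ^ 5) ^ 5) := by ring
            rw [this]
            exact Nat.add_le_add_right (by omega) _
          refine h2.trans (Nat.mul_le_mul_left _ ?_)
          have h3 : 3000 * (9 * σ ^ 5) ^ 5 * 1 ≤ 3000 * (9 * σ ^ 5) ^ 5 * (L * q) :=
            Nat.mul_le_mul_left _ (by omega)
          rw [searchConst, add_mul]
          omega

theorem gramCount_mul_gramLen_le (hR : 2 ≤ R) :
    gramCount σ R N m k * gramLen σ R N m ≤ 2 * k + 11 * (R * N * Nat.log σ m) := by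
  rw [gramCount, gramLen, add_mul]
  refine Nat.add_le_add ?_ le_rfl
  have h : R * N * Nat.log σ m ≤ 2 * ((R - 1) * N * Nat.log σ m) := by
    calc R * N * Nat.log σ m ≤ (2 * (R - 1)) * N * Nat.log σ m := by gcongr; omega
      _ = _ := by ring
  calc _ ≤ k / ((R - 1) * N * Nat.log σ m) * (2 * ((R - 1) * N * Nat.log σ m)) :=
        Nat.mul_le_mul_left _ h
    _ = 2 * (k / ((R - 1) * N * Nat.log σ m) * ((R - 1) * N * Nat.log σ m)) := by ring
    _ ≤ _ := Nat.mul_le_mul_left _ (Nat.div_mul_le_self _ _)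

end

/-! ### The choice of the parameters -/

/-- One term of the binomial expansion of `(p + (1 - p)) ^ n`. -/
theorem choose_mul_pow_le_one {p : ℝ} (h0 : 0 ≤ p) (h1 : p ≤ 1) {n r : ℕ} (hr : r ≤ n) :
    (n.choose r : ℝ) * (p ^ r * (1 - p) ^ (n - r)) ≤ 1 := by
  have h : ∑ i ∈ Finset.range (n + 1), p ^ i * (1 - p) ^ (n - i) * (n.choose i : ℝ) = 1 := by
    rw [← add_pow]; simp
  rw [mul_comm]
  refine le_trans ?_ h.le
  have h2 : 0 ≤ 1 - p := by linarith
  have hmem : r ∈ Finset.range (n + 1) := Finset.mem_range.2 (by omega)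
  exact Finset.single_le_sum (f := fun i => p ^ i * (1 - p) ^ (n - i) * (n.choose i : ℝ))
    (fun i _ => by positivity) hmem

/-- The base `θ` with `σ ^ (R * d) = θ` for the exponent `d` that belongs to `c = 1 - 1 / R`. -/
noncomputable def gramBase (σ R : ℕ) : ℝ := σ * ((1 - 1 / (R : ℝ)) ^ (R - 1)) ^ 2 / (R : ℝ) ^ 2

/-- Turns positivity of the exponent into `1 < gramBase σ R`, an elementary condition on `R`. -/
theorem gramExponent_eq {σ R : ℕ} (hσ : 2 ≤ σ) (hR : 2 ≤ R) :
    gramExponent σ (1 - 1 / (R : ℝ)) = Real.logb σ (gramBase σ R) / R := by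
  have hR' : (2 : ℝ) ≤ R := by exact_mod_cast hR
  have hR0 : (0 : ℝ) < R := by linarith
  have hc : (0 : ℝ) < 1 - 1 / R := by
    rw [sub_pos, div_lt_one hR0]; linarith
  have hσ' : (2 : ℝ) ≤ σ := by exact_mod_cast hσ
  have hσ0 : (0 : ℝ) < σ := by linarith
  have hcp : (0 : ℝ) < (1 - 1 / (R : ℝ)) ^ (R - 1) := by positivity
  have h1 : Real.logb σ (gramBase σ R) =
      1 + 2 * ((R - 1) * Real.logb σ (1 - 1 / (R : ℝ))) - 2 * Real.logb σ R := by
    rw [gramBase, Real.logb_div (by positivity) (by positivity),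
      Real.logb_mul (by positivity) (by positivity), Real.logb_pow, Real.logb_pow, Real.logb_pow,
      Real.logb_self_eq_one (by linarith), Nat.cast_sub (by omega)]
    push_cast; ring
  have h2 : Real.logb σ (1 - (1 - 1 / (R : ℝ))) = - Real.logb σ R := by
    rw [sub_sub_cancel, one_div, Real.logb_inv]
  rw [gramExponent, h2, h1]
  field_simp
  ring

/-- As `1 - 1 / R` is the inverse of `1 + 1 / (R - 1)`, this is `1 + y ≤ exp y` at `y = 1 / (R -
1)`, raised to the power `R - 1`. -/
theorem exp_neg_one_le_pow {R : ℕ} (hR : 2 ≤ R) : Real.exp (-1) ≤ (1 - 1 / (R : ℝ)) ^ (R - 1) := by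
  have hR' : (2 : ℝ) ≤ R := by exact_mod_cast hR
  have h1 : (0 : ℝ) < R - 1 := by linarith
  have h2 : Real.exp (-(1 / ((R : ℝ) - 1))) ≤ 1 - 1 / (R : ℝ) := by
    have h3 := Real.add_one_le_exp (1 / ((R : ℝ) - 1))
    have h4 : 1 - 1 / (R : ℝ) = (1 / ((R : ℝ) - 1) + 1)⁻¹ := by
      have : (R : ℝ) ≠ 0 := by linarith
      field_simp
      ring
    rw [Real.exp_neg, h4]
    exact inv_anti₀ (by positivity) h3
  have h5 : (-1 : ℝ) = ((R - 1 : ℕ) : ℝ) * (-(1 / ((R : ℝ) - 1))) := by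
    rw [Nat.cast_sub (by omega)]; push_cast; field_simp
  rw [h5, Real.exp_nat_mul]
  gcongr

/-- Taking `R` of order `√σ` keeps `θ = gramBase σ R` between absolute constants. Then `N log θ` has
to lie between `(5 / 2) log σ`, for rarity, and `3 log σ`, for the prescribed gram length. -/
theorem exists_gram_parameters {σ : ℕ} (hσ : 2000 < √(σ : ℝ)) :
    ∃ R N : ℕ, 2 ≤ R ∧ 1 ≤ N ∧ Real.exp 1 * R < √(σ : ℝ) ∧ √(σ : ℝ) ≤ 16 * ((R : ℝ) - 1) ∧
      0 < gramExponent σ (1 - 1 / (R : ℝ)) ∧ R * N * gramExponent σ (1 - 1 / (R : ℝ)) ≤ 3 ∧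
      GramsRare σ R N := by
  set s := √(σ : ℝ) with hs
  have hss : s ^ 2 = σ := Real.sq_sqrt (Nat.cast_nonneg _)
  have hσ1 : (1 : ℝ) < σ := by nlinarith
  have hσ2 : 2 ≤ σ := by exact_mod_cast hσ1
  -- So `8 R ≤ s ≤ 9 R`, and with `1 / 3 ≤ c ≤ 1` the value `θ = (s c / R) ^ 2` lies between `64 /
  -- 9` and `81`.
  obtain ⟨R, hR⟩ : ∃ R, R = ⌊s / 8⌋₊ := ⟨_, rfl⟩
  have hR1 : (R : ℝ) ≤ s / 8 := hR ▸ Nat.floor_le (by positivity)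
  have hR2 : s / 8 < R + 1 := hR ▸ Nat.lt_floor_add_one _
  have hR249 : (249 : ℝ) < R := by linarith
  have hRn : 2 ≤ R := by
    have : 249 < R := by exact_mod_cast hR249
    omega
  have hR0 : (0 : ℝ) < R := by linarith
  have he : Real.exp 1 < 2.7182818286 := Real.exp_one_lt_d9
  have hcp0 : (0 : ℝ) < 1 - 1 / (R : ℝ) := by rw [sub_pos, div_lt_one hR0]; linarith
  have hcp1 : (1 : ℝ) - 1 / (R : ℝ) ≤ 1 := by
    have : 0 ≤ 1 / (R : ℝ) := by positivity
    linarith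
  obtain ⟨c, hc⟩ : ∃ c, c = (1 - 1 / (R : ℝ)) ^ (R - 1) := ⟨_, rfl⟩
  have hc0 : 0 < c := hc ▸ by positivity
  have hc1 : c ≤ 1 := hc ▸ pow_le_one₀ hcp0.le hcp1
  have hce : 1 ≤ c * Real.exp 1 := by
    have := exp_neg_one_le_pow hRn
    rw [← hc, Real.exp_neg] at this
    have he0 := Real.exp_pos 1
    calc (1 : ℝ) = (Real.exp 1)⁻¹ * Real.exp 1 := by field_simp
      _ ≤ _ := by gcongr
  have hc3 : 1 / 3 ≤ c := by nlinarith
  set θ := gramBase σ R with hθ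
  have hθe : θ * R ^ 2 = s ^ 2 * c ^ 2 := by
    rw [hθ, gramBase, ← hc, hss]; field_simp
  have hθ1 : 1 < θ := by
    by_contra hle
    push Not at hle
    have h1 : θ * (R : ℝ) ^ 2 ≤ 1 * (R : ℝ) ^ 2 := by gcongr
    have h2 : (8 * (R : ℝ)) ^ 2 * (1 / 3) ^ 2 ≤ s ^ 2 * c ^ 2 := by gcongr; linarith
    nlinarith
  have hθ81 : θ ≤ 81 := by
    by_contra hle
    push Not at hle
    have h1 : 81 * (R : ℝ) ^ 2 < θ * (R : ℝ) ^ 2 := by gcongr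
    have h2 : s ^ 2 * c ^ 2 ≤ (9 * (R : ℝ)) ^ 2 * 1 ^ 2 := by gcongr; linarith
    nlinarith
  have hlσ : 0 < Real.log σ := Real.log_pos hσ1
  have hlθ : 0 < Real.log θ := Real.log_pos hθ1
  have hlle : 2 * Real.log θ ≤ Real.log σ := by
    have : Real.log (θ ^ 2) ≤ Real.log σ := by
      apply Real.log_le_log (by positivity)
      rw [← hss]
      have : θ ^ 2 ≤ 81 ^ 2 := by gcongr
      nlinarith
    rwa [Real.log_pow] at this
  -- Rounding down loses less than `log θ ≤ (log σ) / 2`, so `N log θ` stays above `(5 / 2) log σ`.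
  obtain ⟨N, hN⟩ : ∃ N, N = ⌊3 * Real.log σ / Real.log θ⌋₊ := ⟨_, rfl⟩
  have hN1 : (N : ℝ) * Real.log θ ≤ 3 * Real.log σ := by
    rw [← le_div_iff₀ hlθ]; exact hN ▸ Nat.floor_le (by positivity)
  have hN2 : 3 * Real.log σ < (N + 1) * Real.log θ := by
    rw [← div_lt_iff₀ hlθ]; exact hN ▸ Nat.lt_floor_add_one _
  have hN3 : 1 ≤ N := by
    by_contra hlt
    obtain rfl : N = 0 := by omega
    simp only [Nat.cast_zero, zero_add, one_mul] at hN2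
    linarith
  have hd : gramExponent σ (1 - 1 / (R : ℝ)) = Real.log θ / Real.log σ / R := by
    rw [gramExponent_eq hσ2 hRn, ← hθ, Real.logb]
  refine ⟨R, N, hRn, hN3, by nlinarith, by linarith, by rw [hd]; positivity, ?_, ?_⟩
  · rw [hd]
    have : (R : ℝ) * N * (Real.log θ / Real.log σ / R) = N * Real.log θ / Real.log σ := by
      field_simp
    rw [this, div_le_iff₀ hlσ]
    exact hN1
  · intro a
    have h1 : (σ : ℝ) ^ 5 ≤ θ ^ (2 * N) := by
      rw [← Real.log_le_log_iff (by positivity) (by positivity), Real.log_pow, Real.log_pow]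
      push_cast
      nlinarith
    obtain ⟨r, hr⟩ : ∃ r, r = N * a := ⟨_, rfl⟩
    have hrR : r ≤ R * r := Nat.le_mul_of_pos_left _ (by omega)
    have h2 := choose_mul_pow_le_one (p := 1 / (R : ℝ)) (by positivity)
      (by rw [div_le_one hR0]; linarith) hrR
    have h3 : (1 - 1 / (R : ℝ)) ^ (R * r - r) = c ^ r := by
      rw [hc, ← pow_mul, Nat.sub_mul, one_mul]
    rw [h3, ← mul_pow] at h2
    -- The binomial bound at `p = 1 / R`, squared: here `θ = σ (c / R) ^ 2`.
    have h4 : (((R * r).choose r : ℝ)) ^ 2 * θ ^ r ≤ (σ : ℝ) ^ r := by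
      have h5 : θ = σ * (1 / (R : ℝ) * c) ^ 2 := by
        rw [hθ, gramBase, ← hc]; field_simp
      have h6 : (((R * r).choose r : ℝ) * (1 / (R : ℝ) * c) ^ r) ^ 2 ≤ 1 :=
        pow_le_one₀ (by positivity) h2
      rw [h5, mul_pow]
      calc _ = (σ : ℝ) ^ r * (((R * r).choose r : ℝ) * (1 / (R : ℝ) * c) ^ r) ^ 2 := by ring
        _ ≤ (σ : ℝ) ^ r * 1 := by gcongr
        _ = _ := mul_one _
    have h7 : ((((R * r).choose r : ℝ)) ^ 2) ^ 2 * (σ : ℝ) ^ (5 * a) ≤ (σ : ℝ) ^ (2 * r) := by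
      calc _ = ((((R * r).choose r : ℝ)) ^ 2) ^ 2 * ((σ : ℝ) ^ 5) ^ a := by rw [pow_mul (σ : ℝ)]
        _ ≤ ((((R * r).choose r : ℝ)) ^ 2) ^ 2 * (θ ^ (2 * N)) ^ a := by gcongr
        _ = ((((R * r).choose r : ℝ)) ^ 2 * θ ^ r) ^ 2 := by
          have : 2 * N * a = r * 2 := by rw [hr]; ring
          rw [mul_pow, ← pow_mul θ, ← pow_mul θ, this]
        _ ≤ ((σ : ℝ) ^ r) ^ 2 := by gcongr
        _ = _ := by rw [← pow_mul, mul_comm]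
    rw [← hr]
    exact_mod_cast h7

theorem exists_forall_mul_log_le (σ C : ℕ) : ∃ M, ∀ m, M ≤ m → C * Nat.log σ m ≤ m := by
  rcases Nat.lt_or_ge 1 σ with hσ | hσ
  · have h := Real.isLittleO_log_id_atTop.bound
      (show (0 : ℝ) < Real.log σ / (C + 1) by
        have : 0 < Real.log σ := Real.log_pos (by exact_mod_cast hσ)
        positivity)
    obtain ⟨M, hM⟩ := Filter.eventually_atTop.1 (tendsto_natCast_atTop_atTop.eventually h)
    refine ⟨max M 1, fun m hm => ?_⟩
    have hm1 : 1 ≤ m := (le_max_right _ _).trans hm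
    have h1 := hM m ((le_max_left _ _).trans hm)
    have hm1' : (1 : ℝ) ≤ m := by exact_mod_cast hm1
    have hlσ : 0 < Real.log σ := Real.log_pos (by exact_mod_cast hσ)
    simp only [id, Real.norm_eq_abs] at h1
    rw [abs_of_nonneg (Real.log_nonneg hm1'), abs_of_nonneg (by linarith)] at h1
    have h2 : (Nat.log σ m : ℝ) * Real.log σ ≤ Real.log m := by
      rw [← Real.log_pow]
      apply Real.log_le_log (by positivity)
      exact_mod_cast Nat.pow_log_le_self σ (by omega)
    have h3 : Real.log σ * ((C : ℝ) * Nat.log σ m) ≤ Real.log σ * m := by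
      have hC : (0 : ℝ) < C + 1 := by positivity
      calc Real.log σ * ((C : ℝ) * Nat.log σ m) = C * (Nat.log σ m * Real.log σ) := by ring
        _ ≤ (C + 1) * (Real.log σ / (C + 1) * m) := by
            apply mul_le_mul (by linarith) (h2.trans h1) (by positivity) hC.le
        _ = _ := by field_simp
    have := le_of_mul_le_mul_left h3 hlσ
    exact_mod_cast this
  · exact ⟨0, fun m _ => by rw [Nat.log_of_left_le_one hσ]; omega⟩

theorem natLog_le_logb {σ m : ℕ} (hσ : 2 ≤ σ) (hm : 1 ≤ m) : (Nat.log σ m : ℝ) ≤ Real.logb σ m := by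
  have hσ' : (1 : ℝ) < σ := by exact_mod_cast hσ
  rw [Real.le_logb_iff_rpow_le hσ' (by exact_mod_cast hm), Real.rpow_natCast]
  exact_mod_cast Nat.pow_log_le_self σ (by omega)

theorem logb_lt_natLog {σ m : ℕ} (hσ : 2 ≤ σ) (hm : 1 ≤ m) :
    Real.logb σ m < Nat.log σ m + 1 := by
  have hσ' : (1 : ℝ) < σ := by exact_mod_cast hσ
  rw [Real.logb_lt_iff_lt_rpow hσ' (by exact_mod_cast hm)]
  have := Nat.lt_pow_succ_log_self (b := σ) (by omega) m
  exact_mod_cast this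

/-- The grams used are no longer than prescribed, so the prescribed time and memory suffice. -/
theorem gramLen_le_gramLength {σ R N m k : ℕ} (hσ : 2 ≤ σ) (hm : 1 ≤ m) {c : ℝ}
    (hd : 0 < gramExponent σ c) (hRN : R * N * gramExponent σ c ≤ 3) :
    gramLen σ R N m ≤ gramLength σ c m k := by
  have hσ' : (1 : ℝ) < σ := by exact_mod_cast hσ
  have h1 := natLog_le_logb hσ hm
  have h2 : 0 ≤ Real.logb σ (max k 1 : ℕ) :=
    Real.logb_nonneg hσ' (by exact_mod_cast le_max_right k 1)
  have h3 : (gramLen σ R N m : ℝ) ≤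
      (3 * Real.logb σ m + Real.logb σ (max k 1 : ℕ)) / gramExponent σ c := by
    rw [le_div_iff₀ hd, gramLen]
    push_cast
    calc (R : ℝ) * N * Nat.log σ m * gramExponent σ c =
          (R * N * gramExponent σ c) * Nat.log σ m := by ring
      _ ≤ 3 * Real.logb σ m := by gcongr
      _ ≤ _ := by simpa using h2
  have := h3.trans (Nat.le_ceil _)
  exact_mod_cast this

/-- For long patterns, windows have a length proportional to that of the pattern. -/
theorem windowShift_bounds {σ R N m k : ℕ} (hσ : 2000 < √(σ : ℝ)) (hR : 2 ≤ R)
    (hRσ : √(σ : ℝ) ≤ 16 * ((R : ℝ) - 1)) (hm : 0 < m)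
    (hlog : 11 * R * N * σ * Nat.log σ m ≤ m) (hk : (k : ℝ) / m < 1 / 2 - 1000 / √(σ : ℝ)) :
    gramCount σ R N m k * gramLen σ R N m + k ≤ m ∧ m ≤ σ * windowShift σ R N m k := by
  set s := √(σ : ℝ) with hs
  have hss : s ^ 2 = σ := Real.sq_sqrt (Nat.cast_nonneg _)
  have hs0 : 0 < s := by linarith
  have hσ1 : 2 ≤ σ := by
    have : (1 : ℝ) < σ := by nlinarith
    exact_mod_cast this
  have hm' : (0 : ℝ) < m := by exact_mod_cast hm
  have hR' : (2 : ℝ) ≤ R := by exact_mod_cast hR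
  have hR1 : (0 : ℝ) < (R : ℝ) - 1 := by linarith
  obtain ⟨X, hX⟩ : ∃ X, X = gramCount σ R N m k * gramLen σ R N m := ⟨_, rfl⟩
  obtain ⟨lam, hlam'⟩ : ∃ lam, lam = Nat.log σ m := ⟨_, rfl⟩
  rw [← hlam'] at hlog
  -- A gram of `R N lam` letters uses up `(R - 1) N lam` of the threshold, so the block is about `R
  -- / (R - 1)` times `k`, plus eleven grams.
  have hXr : (X : ℝ) * ((R : ℝ) - 1) ≤ R * k + ((R : ℝ) - 1) * (11 * (R * N * lam)) := by
    have h1 : k / ((R - 1) * N * lam) * ((R - 1) * N * lam) ≤ k := Nat.div_mul_le_self _ _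
    have h2 : X * (R - 1) = R * (k / ((R - 1) * N * lam) * ((R - 1) * N * lam)) +
        (R - 1) * (11 * (R * N * lam)) := by
      rw [hX, gramCount, gramLen, ← hlam']; ring
    have h3 : X * (R - 1) ≤ R * k + (R - 1) * (11 * (R * N * lam)) := by
      rw [h2]; gcongr
    have h4 : ((R - 1 : ℕ) : ℝ) = (R : ℝ) - 1 := by rw [Nat.cast_sub (by omega)]; simp
    have h5 : ((X * (R - 1) : ℕ) : ℝ) ≤ ((R * k + (R - 1) * (11 * (R * N * lam)) : ℕ) : ℝ) := by
      exact_mod_cast h3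
    push_cast [h4] at h5
    exact h5
  have hlogr : 11 * ((R : ℝ) * N * lam) * σ ≤ m := by
    have : ((11 * R * N * σ * lam : ℕ) : ℝ) ≤ m := by exact_mod_cast hlog
    push_cast at this; linarith
  have hk' : (k : ℝ) * s < m * (s / 2 - 1000) := by
    rw [div_lt_iff₀ hm'] at hk
    calc (k : ℝ) * s < (1 / 2 - 1000 / s) * m * s := by gcongr
      _ = _ := by field_simp
  -- Here `X` is at most `k + 16 k / s + m / s`, and `2 k < m - 2000 m / s`; the margin `2000 m / s`
  -- covers the error terms and leaves at least `m / s`.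
  have hmain : (m : ℝ) ≤ σ * (m - k - X) := by
    have h1 : (X : ℝ) ≤ k + k / (R - 1) + 11 * (R * N * lam) := by
      rw [← mul_le_mul_iff_left₀ hR1]
      calc _ ≤ _ := hXr
        _ = _ := by field_simp; ring
    have h2 : (k : ℝ) / (R - 1) * s ≤ 16 * k := by
      rw [div_mul_eq_mul_div, div_le_iff₀ hR1]
      have : (0 : ℝ) ≤ k := Nat.cast_nonneg _
      nlinarith
    have h3 : 11 * ((R : ℝ) * N * lam) * s ≤ m := by
      have : 11 * ((R : ℝ) * N * lam) * s * s ≤ m * s := by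
        have e : 11 * ((R : ℝ) * N * lam) * s * s = 11 * ((R : ℝ) * N * lam) * σ := by
          rw [← hss]; ring
        rw [e]; nlinarith
      exact le_of_mul_le_mul_right this hs0
    have h4 : (X : ℝ) * s ≤ k * s + 16 * k + m := by
      calc (X : ℝ) * s ≤ (k + k / (R - 1) + 11 * (R * N * lam)) * s := by gcongr
        _ = k * s + k / (R - 1) * s + 11 * (R * N * lam) * s := by ring
        _ ≤ _ := by linarith
    have hkm : (k : ℝ) ≤ m := by
      have : (k : ℝ) * s ≤ m * s := by nlinarith
      exact le_of_mul_le_mul_right this hs0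
    have h5 : (m : ℝ) ≤ (m - k - X) * s := by nlinarith
    have h6 : (m : ℝ) * s ≤ (m - k - X) * s * s := by gcongr
    calc (m : ℝ) ≤ m * s := by nlinarith
      _ ≤ _ := h6
      _ = _ := by rw [← hss]; ring
  have hpos : (0 : ℝ) < m - k - X := by
    by_contra hle
    push Not at hle
    have : (σ : ℝ) * (m - k - X) ≤ 0 := mul_nonpos_of_nonneg_of_nonpos (Nat.cast_nonneg _) hle
    linarith
  have hnat : X + k ≤ m := by
    have : (X : ℝ) + k ≤ m := by linarith
    exact_mod_cast this
  rw [windowShift, ← hX]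
  refine ⟨hnat, ?_⟩
  have h7 : ((m - k - X + 1 : ℕ) : ℝ) = m - k - X + 1 := by
    push_cast [Nat.cast_sub (show X ≤ m - k by omega), Nat.cast_sub (show k ≤ m by omega)]
    ring
  have h8 : (m : ℝ) ≤ ((σ * (m - k - X + 1) : ℕ) : ℝ) := by
    rw [Nat.cast_mul, h7]
    have : (0 : ℝ) ≤ σ := Nat.cast_nonneg _
    linarith
  exact_mod_cast h8

theorem exists_gramAlgorithm {σ : ℕ} (hσ : 2000 < √(σ : ℝ)) :
    ∃ c : ℝ, 0 < c ∧ c < 1 - Real.exp 1 / √(σ : ℝ) ∧ 0 < gramExponent σ c ∧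
      ∃ (A : Algorithm) (K B M : ℕ),
        ∀ (m k n : ℕ) (x : List (Fin σ)), M ≤ m → (k : ℝ) / m < 1 / 2 - 1000 / √(σ : ℝ) →
          m < n → x.length = m → ∀ word : ℕ, n ^ B ≤ word →
            ∃ (Tp : ℕ) (Ts : (Fin n → Fin σ) → ℕ),
              A.Solves word (K * σ ^ gramLength σ c m k) x k n Tp Ts ∧
              Tp ≤ K * (σ ^ gramLength σ c m k * m * gramLength σ c m k) ∧
              expectedTime Ts ≤ K * (n * (k + Real.logb σ m) / m) := by
  have hσ1 : 2 ≤ σ := by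
    have hss : √(σ : ℝ) ^ 2 = σ := Real.sq_sqrt (Nat.cast_nonneg _)
    have : (1 : ℝ) < σ := by nlinarith
    exact_mod_cast this
  obtain ⟨R, N, hR, hN, heR, hRσ, hd, hd3, hrare⟩ := exists_gram_parameters hσ
  obtain ⟨M, hM⟩ := exists_forall_mul_log_le σ (11 * R * N * σ)
  have hR' : (2 : ℝ) ≤ R := by exact_mod_cast hR
  have hs0 : 0 < √(σ : ℝ) := by linarith
  -- In the constant, 1000 serves the preprocessing and 9 the memory; `2 σ` comes from the number of
  -- windows and `11 R N` from the letters read in each.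
  refine ⟨1 - 1 / (R : ℝ), ?_, ?_, hd, gramAlgorithm σ R N,
    1009 + 22 * σ * R * N * searchConst σ, R * N + 2, max M (max σ 300), ?_⟩
  · rw [sub_pos, div_lt_one (by linarith)]; linarith
  · have : Real.exp 1 / √(σ : ℝ) < 1 / R := by
      rw [div_lt_div_iff₀ hs0 (by linarith)]; linarith
    linarith
  intro m k n x hm hk hmn hx word hword
  have hm1 : M ≤ m := (le_max_left _ _).trans hm
  have hm2 : σ ≤ m := (le_max_left _ _).trans ((le_max_right _ _).trans hm)
  have hm3 : 300 ≤ m := (le_max_right _ _).trans ((le_max_right _ _).trans hm)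
  obtain ⟨hLq, hsh⟩ := windowShift_bounds hσ hR hRσ (by omega) (hM m hm1) hk
  have hqq := gramLen_le_gramLength (m := m) (k := k) hσ1 (by omega) hd hd3
  obtain ⟨Q, hQ⟩ : ∃ Q, Q = gramLength σ (1 - 1 / (R : ℝ)) m k := ⟨_, rfl⟩
  rw [← hQ] at hqq ⊢
  have hpow : σ ^ gramLen σ R N m ≤ σ ^ Q := Nat.pow_le_pow_right (by omega) hqq
  obtain ⟨Tp, Ts, hsol, hTp, hTs⟩ := gramAlgorithm_solves (k := k) hσ1 hR hN hrare hx hm2 hm3 rfl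
    rfl hLq rfl hmn hword
    (size := (1009 + 22 * σ * R * N * searchConst σ) * σ ^ Q)
    (Nat.mul_le_mul (by omega) hpow)
  refine ⟨Tp, Ts, hsol, hTp.trans ?_, ?_⟩
  · gcongr
    omega
  · have hm' : (0 : ℝ) < m := by exact_mod_cast (by omega : 0 < m)
    have hσ0 : (0 : ℝ) < (σ : ℝ) ^ n := by positivity
    obtain ⟨sh, hshe⟩ : ∃ sh, sh = windowShift σ R N m k := ⟨_, rfl⟩
    obtain ⟨G, hG⟩ : ∃ G, G = (n - (m - k)) / sh + 1 := ⟨_, rfl⟩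
    rw [← hshe] at hsh hTs
    rw [← hG] at hTs
    have hGm : G * m ≤ 2 * σ * n := by
      have h1 : (n - (m - k)) / sh * sh ≤ n := (Nat.div_mul_le_self _ _).trans (Nat.sub_le _ _)
      have h2 : (n - (m - k)) / sh * m ≤ σ * n := by
        calc _ ≤ (n - (m - k)) / sh * (σ * sh) := Nat.mul_le_mul_left _ hsh
          _ = σ * ((n - (m - k)) / sh * sh) := by ring
          _ ≤ _ := Nat.mul_le_mul_left _ h1
      have h3 : m ≤ σ * n := by nlinarith
      rw [hG, add_mul]; linarith
    have hLq' := gramCount_mul_gramLen_le (σ := σ) (R := R) (N := N) (m := m) (k := k) hR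
    have hlogb := natLog_le_logb (m := m) hσ1 (by omega)
    obtain ⟨X, hX⟩ : ∃ X, X = gramCount σ R N m k * gramLen σ R N m := ⟨_, rfl⟩
    rw [← hX] at hTs hLq'
    have hRN : (1 : ℝ) ≤ R * N := by
      have : 1 ≤ R * N := Nat.mul_pos (by omega) hN
      exact_mod_cast this
    have hXr : (X : ℝ) ≤ 11 * (R * N) * (k + Real.logb σ m) := by
      have h1 : (X : ℝ) ≤ 2 * k + 11 * (R * N * Nat.log σ m) := by exact_mod_cast hLq'
      have h2 : (R : ℝ) * N * Nat.log σ m ≤ R * N * Real.logb σ m := by gcongr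
      have h3 : (k : ℝ) * 1 ≤ k * (R * N) := by gcongr
      have : (0 : ℝ) ≤ k := Nat.cast_nonneg _
      nlinarith
    have hsum : (∑ t, (Ts t : ℝ)) ≤ (σ : ℝ) ^ n * (G * (searchConst σ * X)) := by
      exact_mod_cast hTs
    have hGr : (G : ℝ) ≤ 2 * σ * n / m := by
      rw [le_div_iff₀ hm']; exact_mod_cast hGm
    have hlog0 : (0 : ℝ) ≤ k + Real.logb σ m := by
      have : (0 : ℝ) ≤ k := Nat.cast_nonneg _
      have : (0 : ℝ) ≤ Nat.log σ m := Nat.cast_nonneg _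
      linarith
    rw [expectedTime, div_le_iff₀ hσ0]
    calc (∑ t, (Ts t : ℝ)) ≤ (σ : ℝ) ^ n * (G * (searchConst σ * X)) := hsum
      _ ≤ (σ : ℝ) ^ n * ((2 * σ * n / m) *
          (searchConst σ * (11 * (R * N) * (k + Real.logb σ m)))) := by gcongr
      _ = (22 * σ * R * N * searchConst σ) * (n * (k + Real.logb σ m) / m) * (σ : ℝ) ^ n := by
          field_simp; ring
      _ ≤ ((1009 + 22 * σ * R * N * searchConst σ : ℕ) : ℝ) * (n * (k + Real.logb σ m) / m) *
          (σ : ℝ) ^ n := by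
          gcongr
          push_cast
          linarith

/-! ### Runs and the letters they read -/

/-- Lets the run on a changed text be identified with the run transferred from the original text. -/
theorem Exec.det {σ : ℕ} {E : Env σ} {c : Cmd} {s s₁ s₂ : State} {T₁ T₂ : ℕ}
    (h₁ : Exec E c s T₁ s₁) (h₂ : Exec E c s T₂ s₂) : T₁ = T₂ ∧ s₁ = s₂ := by
  induction h₁ generalizing T₂ s₂ with
  | instr h =>
    cases h₂ with
    | instr h' => exact ⟨rfl, Option.some.inj (h.symm.trans h')⟩
  | seq _ _ ih₁ ih₂ =>
    cases h₂ with
    | seq e₁ e₂ =>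
      obtain ⟨rfl, rfl⟩ := ih₁ e₁
      obtain ⟨rfl, rfl⟩ := ih₂ e₂
      exact ⟨rfl, rfl⟩
  | iteTrue hab _ ih =>
    cases h₂ with
    | iteTrue _ e =>
      obtain ⟨rfl, rfl⟩ := ih e
      exact ⟨rfl, rfl⟩
    | iteFalse hab' _ => exact absurd hab hab'
  | iteFalse hab _ ih =>
    cases h₂ with
    | iteTrue hab' _ => exact absurd hab' hab
    | iteFalse _ e =>
      obtain ⟨rfl, rfl⟩ := ih e
      exact ⟨rfl, rfl⟩
  | loopDone hab =>
    cases h₂ with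
    | loopDone _ => exact ⟨rfl, rfl⟩
    | loopStep hab' _ _ => exact absurd hab' hab
  | loopStep hab _ _ ih₁ ih₂ =>
    cases h₂ with
    | loopDone hab' => exact absurd hab hab'
    | loopStep _ e₁ e₂ =>
      obtain ⟨rfl, rfl⟩ := ih₁ e₁
      obtain ⟨rfl, rfl⟩ := ih₂ e₂
      exact ⟨rfl, rfl⟩

/-- A run of `T` steps depends on at most `T` letters of the text. -/
theorem Exec.exists_reads {σ : ℕ} {E : Env σ} {c : Cmd} {s s' : State} {T : ℕ}
    (h : Exec E c s T s') : ∃ S : Finset ℕ, S.card ≤ T ∧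
      ∀ t' : List (Fin σ), t'.length = E.text.length → (∀ i ∈ S, t'[i]? = E.text[i]?) →
        Exec { E with text := t' } c s T s' := by
  classical
  induction h with
  | @instr i s s' h =>
    cases i with
    | txt r a =>
      refine ⟨{s.reg a}, by simp, fun t' hlen hS => Exec.instr ?_⟩
      have hS' := hS (s.reg a) (by simp)
      by_cases hlt : s.reg a < E.text.length
      · have hlt' : s.reg a < t'.length := hlen ▸ hlt
        have hget : t'[s.reg a] = E.text[s.reg a] := by
          rw [List.getElem?_eq_getElem hlt, List.getElem?_eq_getElem hlt'] at hS'
          exact Option.some.inj hS'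
        simp only [Instr.run, dif_pos hlt] at h
        simp only [Instr.run, dif_pos hlt', hget]
        exact h
      · simp [Instr.run, hlt] at h
    | _ => exact ⟨∅, by simp, fun t' _ _ => Exec.instr h⟩
  | seq _ _ ih₁ ih₂ =>
    obtain ⟨S₁, h₁, e₁⟩ := ih₁
    obtain ⟨S₂, h₂, e₂⟩ := ih₂
    refine ⟨S₁ ∪ S₂, (Finset.card_union_le _ _).trans (by omega), fun t' hl hS => ?_⟩
    exact Exec.seq (e₁ t' hl fun i hi => hS i (Finset.mem_union_left _ hi))
      (e₂ t' hl fun i hi => hS i (Finset.mem_union_right _ hi))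
  | iteTrue hab _ ih =>
    obtain ⟨S, h, e⟩ := ih
    exact ⟨S, by omega, fun t' hl hS => Exec.iteTrue hab (e t' hl hS)⟩
  | iteFalse hab _ ih =>
    obtain ⟨S, h, e⟩ := ih
    exact ⟨S, by omega, fun t' hl hS => Exec.iteFalse hab (e t' hl hS)⟩
  | loopDone hab => exact ⟨∅, by simp, fun t' _ _ => Exec.loopDone hab⟩
  | loopStep hab _ _ ih₁ ih₂ =>
    obtain ⟨S₁, h₁, e₁⟩ := ih₁
    obtain ⟨S₂, h₂, e₂⟩ := ih₂
    refine ⟨S₁ ∪ S₂, (Finset.card_union_le _ _).trans (by omega), fun t' hl hS => ?_⟩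
    exact Exec.loopStep hab (e₁ t' hl fun i hi => hS i (Finset.mem_union_left _ hi))
      (e₂ t' hl fun i hi => hS i (Finset.mem_union_right _ hi))

/-- Substitutions alone: the Hamming distance is an upper bound. -/
theorem editDist_ofFn_le {α : Type*} [DecidableEq α] {m : ℕ} (u v : Fin m → α) :
    editDist (List.ofFn u) (List.ofFn v) ≤ (Finset.univ.filter fun a => u a ≠ v a).card := by
  induction m with
  | zero => simp [editDist]
  | succ m ih =>
    have h := ih (fun a => u a.succ) (fun a => v a.succ)
    rw [List.ofFn_succ, List.ofFn_succ, editDist]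
    have e : (Finset.univ.filter fun a => u a ≠ v a).card =
        (if u 0 ≠ v 0 then 1 else 0) +
          (Finset.univ.filter fun a : Fin m => u a.succ ≠ v a.succ).card := by
      rw [Fin.card_filter_univ_succ]
      split_ifs <;> simp [add_comm]
    rw [e]
    split_ifs <;> omega

/-! ### Patterns that contain every small set of letters -/

/-- Every choice of at most `l` letters, at any positions, occurs in some rotation. -/
def Universal {σ m : ℕ} [NeZero m] (l : ℕ) (X : Fin m → Fin σ) : Prop :=
  ∀ (e : Fin l → Fin m), Function.Injective e → ∀ w : Fin l → Fin σ,
    ∃ j : Fin m, ∀ a, X (j + e a) = w a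

/-- For a largest family `J` of disjoint translates, every translate meets one of the family, so
every `j` has the form `i + e a - e b` with `i ∈ J`; there are at most `|J| l ^ 2` of these. -/
theorem exists_disjoint_translates {m l : ℕ} [NeZero m] (hl : 0 < l) (e : Fin l → Fin m)
    (he : Function.Injective e) : ∃ J : Finset (Fin m), m ≤ J.card * l ^ 2 ∧
      ∀ i ∈ J, ∀ j ∈ J, ∀ a b, i + e a = j + e b → i = j ∧ a = b := by
  classical
  let P : Finset (Fin m) → Prop := fun J =>
    ∀ i ∈ J, ∀ j ∈ J, ∀ a b, i + e a = j + e b → i = j ∧ a = b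
  obtain ⟨J, hJ, hmax⟩ := Finset.exists_max_image (Finset.univ.filter P) Finset.card
    ⟨∅, by simp [P]⟩
  simp only [Finset.mem_filter, Finset.mem_univ, true_and] at hJ hmax
  refine ⟨J, ?_, hJ⟩
  have hsub : (Finset.univ : Finset (Fin m)) ⊆
      (J ×ˢ (Finset.univ : Finset (Fin l × Fin l))).image fun p => p.1 + e p.2.1 - e p.2.2 := by
    intro j _
    rw [Finset.mem_image]
    by_contra hno
    push Not at hno
    have hno' : ∀ i ∈ J, ∀ a b, i + e a ≠ j + e b := by
      intro i hi a b hab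
      exact hno (i, a, b) (by simp [hi]) (by simp [hab])
    have hjJ : j ∉ J := fun h => hno' j h ⟨0, hl⟩ ⟨0, hl⟩ rfl
    have hP : P (insert j J) := by
      intro i hi i' hi' a b hab
      rw [Finset.mem_insert] at hi hi'
      rcases hi with rfl | hi <;> rcases hi' with rfl | hi'
      · exact ⟨rfl, he (add_left_cancel hab)⟩
      · exact absurd hab.symm (hno' i' hi' b a)
      · exact absurd hab (hno' i hi a b)
      · exact hJ i hi i' hi' a b hab
    have := hmax _ hP
    rw [Finset.card_insert_of_notMem hjJ] at this
    omega
  have := (Finset.card_le_card hsub).trans Finset.card_image_le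
  simpa [Finset.card_product, sq] using this

/-- The disjoint translates are at least `m / l ^ 2` independent trials, each failing with
probability `1 - σ ^ (-l) ≤ exp (-σ ^ (-l))`. -/
theorem card_missing_le {σ m l : ℕ} [NeZero m] (hσ : 0 < σ) (hl : 0 < l) (e : Fin l → Fin m)
    (he : Function.Injective e) (w : Fin l → Fin σ) :
    ((Finset.univ.filter fun X : Fin m → Fin σ => ∀ j, ∃ a, X (j + e a) ≠ w a).card : ℝ) ≤
      (σ : ℝ) ^ m * Real.exp (-(m / ((l : ℝ) ^ 2 * (σ : ℝ) ^ l))) := by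
  classical
  obtain ⟨J, hJ, hdis⟩ := exists_disjoint_translates hl e he
  have h := card_filter_forall_comp_mul J (fun j a => j + e a) hdis
    ((Finset.univ : Finset (Fin l → Fin σ)).erase w)
  rw [Finset.card_erase_of_mem (Finset.mem_univ _)] at h
  simp only [Finset.card_univ, Fintype.card_fun, Fintype.card_fin] at h
  have hle : (Finset.univ.filter fun X : Fin m → Fin σ => ∀ j, ∃ a, X (j + e a) ≠ w a).card ≤
      (Finset.univ.filter fun X : Fin m → Fin σ => ∀ j ∈ J, X ∘ (fun a => j + e a) ∈
        (Finset.univ : Finset (Fin l → Fin σ)).erase w).card := by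
    refine Finset.card_le_card fun X hX => ?_
    simp only [Finset.mem_filter, Finset.mem_univ, true_and, Finset.mem_erase, and_true] at hX ⊢
    intro j _ hj
    obtain ⟨a, ha⟩ := hX j
    exact ha (congrFun hj a)
  obtain ⟨F, hF⟩ : ∃ F, F = (Finset.univ.filter fun X : Fin m → Fin σ => ∀ j ∈ J,
      X ∘ (fun a => j + e a) ∈ (Finset.univ : Finset (Fin l → Fin σ)).erase w).card := ⟨_, rfl⟩
  have h : F * (σ ^ l) ^ J.card = σ ^ m * (σ ^ l - 1) ^ J.card := by
    rw [hF]; convert h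
  rw [← hF] at hle
  have hσ' : (0 : ℝ) < σ := by exact_mod_cast hσ
  have hy : (0 : ℝ) < (σ : ℝ) ^ l := by positivity
  have h1 : (F : ℝ) * ((σ : ℝ) ^ l) ^ J.card = (σ : ℝ) ^ m * ((σ : ℝ) ^ l - 1) ^ J.card := by
    have h2 : ((σ ^ l - 1 : ℕ) : ℝ) = (σ : ℝ) ^ l - 1 := by
      rw [Nat.cast_sub (Nat.one_le_pow _ _ hσ)]; push_cast; ring
    rw [← h2]
    exact_mod_cast h
  have hl' : (0 : ℝ) < l := by exact_mod_cast hl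
  have h3 : (σ : ℝ) ^ l - 1 ≤ (σ : ℝ) ^ l * Real.exp (-(1 / (σ : ℝ) ^ l)) := by
    have := Real.add_one_le_exp (-(1 / (σ : ℝ) ^ l))
    calc (σ : ℝ) ^ l - 1 = (σ : ℝ) ^ l * (-(1 / (σ : ℝ) ^ l) + 1) := by field_simp; ring
      _ ≤ _ := by gcongr
  have h0 : (0 : ℝ) ≤ (σ : ℝ) ^ l - 1 := by
    have : (1 : ℝ) ≤ (σ : ℝ) ^ l := one_le_pow₀ (by exact_mod_cast hσ)
    linarith
  have h4 : (F : ℝ) * ((σ : ℝ) ^ l) ^ J.card ≤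
      (σ : ℝ) ^ m * Real.exp (-(1 / (σ : ℝ) ^ l)) ^ J.card * ((σ : ℝ) ^ l) ^ J.card := by
    rw [h1]
    calc _ ≤ (σ : ℝ) ^ m * ((σ : ℝ) ^ l * Real.exp (-(1 / (σ : ℝ) ^ l))) ^ J.card := by gcongr
      _ = _ := by rw [mul_pow]; ring
  have h5 := le_of_mul_le_mul_right h4 (by positivity)
  refine (show (_ : ℝ) ≤ F by exact_mod_cast hle).trans (h5.trans ?_)
  rw [← Real.exp_nat_mul]
  gcongr
  have h6 : (m : ℝ) ≤ J.card * (l : ℝ) ^ 2 := by exact_mod_cast hJ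
  rw [mul_neg, neg_le_neg_iff, div_le_iff₀ (by positivity)]
  calc (m : ℝ) ≤ J.card * (l : ℝ) ^ 2 := h6
    _ = _ := by field_simp

/-- Union bound over at most `m ^ l` position maps and `σ ^ l` words; the failure probability is far
smaller as long as `σ ^ l` is at most `m ^ (1/8)`. -/
theorem exists_universal {σ m l : ℕ} [NeZero m] (hσ : 2 ≤ σ) (hl : 0 < l) (hσm : σ ≤ m)
    (hm : 4096 < m) (hlm : (σ ^ l) ^ 8 ≤ m) : ∃ X : Fin m → Fin σ, Universal l X := by
  classical
  by_contra hno
  have hcover : (Finset.univ : Finset (Fin m → Fin σ)) ⊆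
      ((Finset.univ.filter fun e : Fin l → Fin m => Function.Injective e) ×ˢ
        (Finset.univ : Finset (Fin l → Fin σ))).biUnion fun p =>
        Finset.univ.filter fun X : Fin m → Fin σ => ∀ j, ∃ a, X (j + p.1 a) ≠ p.2 a := by
    intro X _
    by_contra hX
    refine hno ⟨X, fun e he w => ?_⟩
    by_contra hw
    push Not at hw
    exact hX (Finset.mem_biUnion.2 ⟨(e, w), by simp [he], by simpa using hw⟩)
  have h1 := (Finset.card_le_card hcover).trans Finset.card_biUnion_le
  have hσ' : (2 : ℝ) ≤ σ := by exact_mod_cast hσ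
  have hm' : (4096 : ℝ) < m := by exact_mod_cast hm
  have hσm' : (σ : ℝ) ≤ m := by exact_mod_cast hσm
  have hl' : (0 : ℝ) < l := by exact_mod_cast hl
  obtain ⟨D, hD⟩ : ∃ D : ℝ, D = Real.exp (-(m / ((l : ℝ) ^ 2 * (σ : ℝ) ^ l))) := ⟨_, rfl⟩
  have h2 : (σ : ℝ) ^ m ≤ ((m : ℝ) ^ l * (σ : ℝ) ^ l) * ((σ : ℝ) ^ m * D) := by
    have h3 : ((Fintype.card (Fin m → Fin σ) : ℕ) : ℝ) ≤ _ := Nat.cast_le.2 h1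
    simp only [Fintype.card_fun, Fintype.card_fin] at h3
    push_cast at h3
    refine h3.trans ((Finset.sum_le_card_nsmul _ _ ((σ : ℝ) ^ m * D) ?_).trans ?_)
    · rintro ⟨e, w⟩ hp
      rw [hD]
      exact card_missing_le (by omega) hl e (by simpa using hp) w
    · rw [nsmul_eq_mul]
      have hD0 : 0 ≤ D := hD ▸ (Real.exp_pos _).le
      gcongr
      have : ((Finset.univ.filter fun e : Fin l → Fin m => Function.Injective e) ×ˢ
          (Finset.univ : Finset (Fin l → Fin σ))).card ≤ m ^ l * σ ^ l := by
        rw [Finset.card_product]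
        refine Nat.mul_le_mul ((Finset.card_filter_le _ _).trans_eq (by simp)) (by simp)
      exact_mod_cast this
  have h4 : (1 : ℝ) ≤ ((m : ℝ) * σ) ^ l * D := by
    have h0 : (0 : ℝ) < (σ : ℝ) ^ m := by positivity
    rw [← mul_le_mul_iff_right₀ h0, mul_pow]
    linarith
  have h5 : (m : ℝ) / ((l : ℝ) ^ 2 * (σ : ℝ) ^ l) ≤ l * Real.log (m * σ) := by
    have h6 := Real.log_le_log (by norm_num) h4
    rw [Real.log_one, Real.log_mul (by positivity) (by rw [hD]; exact (Real.exp_pos _).ne'), hD,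
      Real.log_exp, Real.log_pow] at h6
    linarith
  obtain ⟨y, hy⟩ : ∃ y : ℝ, y = (σ : ℝ) ^ l := ⟨_, rfl⟩
  have hly : (l : ℝ) ≤ y := by
    have : l ≤ σ ^ l := (Nat.lt_pow_self (by omega)).le
    rw [hy]; exact_mod_cast this
  have hy0 : 0 < y := hl'.trans_le hly
  have hy8 : y ^ 8 ≤ m := by rw [hy]; exact_mod_cast hlm
  rw [← hy] at h5
  -- In terms of `z = m ^ (1/4)`: `l ≤ y ≤ √z` and `log (m σ) < 8 z`, so `h5` would give `m ≤ 8 z ·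
  -- y ^ 4 ≤ 8 z ^ 3`, which is below `z ^ 4 = m` as `z > 8`.
  obtain ⟨z, hz⟩ : ∃ z : ℝ, z = √√(m : ℝ) := ⟨_, rfl⟩
  have hz0 : 0 ≤ z := hz ▸ Real.sqrt_nonneg _
  have hz4 : z ^ 4 = (m : ℝ) := by
    have h7 : z ^ 2 = √(m : ℝ) := by rw [hz, Real.sq_sqrt (Real.sqrt_nonneg _)]
    calc z ^ 4 = (z ^ 2) ^ 2 := by ring
      _ = (m : ℝ) := by rw [h7, Real.sq_sqrt (by linarith)]
  have hz8 : 8 < z := by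
    by_contra hle
    push Not at hle
    have : z ^ 4 ≤ 8 ^ 4 := by gcongr
    rw [hz4] at this
    norm_num at this
    linarith
  have hyz : y ^ 2 ≤ z := by
    by_contra hlt
    push Not at hlt
    have : z ^ 4 < (y ^ 2) ^ 4 := by gcongr
    rw [hz4, ← pow_mul] at this
    norm_num at this
    linarith
  have hlog : Real.log (m * σ) < 8 * z := by
    have h7 : Real.log (m * σ) ≤ Real.log (z ^ 4 * z ^ 4) := by
      apply Real.log_le_log (by positivity)
      rw [hz4]; gcongr
    have h8 : Real.log (z ^ 4 * z ^ 4) = 8 * Real.log z := by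
      rw [← pow_add, Real.log_pow]; norm_num
    have h9 := Real.log_le_sub_one_of_pos (show 0 < z by linarith)
    linarith
  rw [div_le_iff₀ (by positivity)] at h5
  have h10 : (m : ℝ) < z ^ 4 := by
    calc (m : ℝ) ≤ l * Real.log (m * σ) * ((l : ℝ) ^ 2 * y) := h5
      _ ≤ y * (8 * z) * (y ^ 2 * y) := by
          have : 0 ≤ Real.log (m * σ) := Real.log_nonneg (by nlinarith)
          gcongr
      _ = (8 * z) * (y ^ 2) ^ 2 := by ring
      _ ≤ (8 * z) * z ^ 2 := by gcongr
      _ < z * z * z ^ 2 := by gcongr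
      _ = z ^ 4 := by ring
  linarith

/-! ### The lower bound -/

/-- The run on `t` is also a run on every text that agrees with `t` on the letters read, and
determinism makes the outputs equal. -/
theorem Algorithm.Solves.exists_reads {σ : ℕ} {A : Algorithm} {word size k n Tp : ℕ}
    {x : List (Fin σ)} {Ts : (Fin n → Fin σ) → ℕ} (h : A.Solves word size x k n Tp Ts)
    (t : Fin n → Fin σ) : ∃ S : Finset ℕ, S.card ≤ Ts t ∧
      ∀ t' : Fin n → Fin σ, (∀ i : Fin n, (i : ℕ) ∈ S → t' i = t i) → ∀ i l,
        IsOccurrence x (List.ofFn t') k i l → IsOccurrence x (List.ofFn t) k i l := by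
  obtain ⟨s, -, h⟩ := h
  obtain ⟨s₁, e₁, o₁⟩ := h t
  obtain ⟨S, hS, hr⟩ := e₁.exists_reads
  refine ⟨S, hS, fun t' ht' i l hocc => ?_⟩
  obtain ⟨s₂, e₂, o₂⟩ := h t'
  have e₃ := hr (List.ofFn t') (by simp) fun i hi => by
    by_cases hin : i < n
    · simp [hin, ht' ⟨i, hin⟩ hi]
    · simp [hin]
  obtain ⟨-, rfl⟩ := Exec.det e₂ e₃
  exact (o₁ i l).1 ((o₂ i l).2 hocc)

theorem isOccurrence_ofFn_iff {σ m n k p : ℕ} [NeZero m] {X : Fin m → Fin σ}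
    {t : Fin n → Fin σ} (e : Fin m → Fin n) (he : ∀ a, (e a : ℕ) = p + a) (hp : p + m ≤ n) :
    IsOccurrence (List.ofFn X) (List.ofFn t) k p m ↔
      ∃ j : Fin m, editDist (List.ofFn (t ∘ e)) (List.ofFn fun a => X (j + a)) ≤ k := by
  have h1 : ((List.ofFn t).drop p).take m = List.ofFn (t ∘ e) := by
    refine List.ext_getElem (by simp; omega) fun i h₁ h₂ => ?_
    simp only [List.getElem_take, List.getElem_drop, List.getElem_ofFn, Function.comp]
    congr 1
    exact Fin.ext (he ⟨i, by simpa using h₂⟩).symm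
  have h2 : ∀ j : Fin m, (List.ofFn X).rotate j = List.ofFn fun a => X (j + a) := by
    intro j
    refine List.ext_getElem (by simp) fun i h₁ h₂ => ?_
    rw [List.getElem_rotate]
    simp only [List.getElem_ofFn, List.length_ofFn]
    congr 1
    exact Fin.ext (by simp [Fin.val_add, add_comm])
  rw [IsOccurrence, h1]
  simp only [List.length_ofFn]
  constructor
  · rintro ⟨-, j, hj, h⟩
    exact ⟨⟨j, hj⟩, by rw [← h2]; exact h⟩
  · rintro ⟨j, h⟩
    exact ⟨hp, j, j.2, by rw [h2]; exact h⟩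

/-- Adversary argument: against every rotation, more than `k` of the letters read must be
mismatches, since the unread ones could all be made to agree. Universality provides a rotation
without such mismatches if at most `l` letters are read. -/
theorem card_reads_gt {σ m n k p l : ℕ} [NeZero m] {X : Fin m → Fin σ} (hX : Universal l X)
    (hl : l ≤ m) {t : Fin n → Fin σ} (e : Fin m → Fin n) (he : ∀ a, (e a : ℕ) = p + a)
    (hp : p + m ≤ n) {S : Finset ℕ}
    (hS : ∀ t' : Fin n → Fin σ, (∀ i : Fin n, (i : ℕ) ∈ S → t' i = t i) →
      IsOccurrence (List.ofFn X) (List.ofFn t') k p m →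
        IsOccurrence (List.ofFn X) (List.ofFn t) k p m)
    (hno : ¬ IsOccurrence (List.ofFn X) (List.ofFn t) k p m) :
    max k l < (Finset.univ.filter fun a : Fin m => p + (a : ℕ) ∈ S).card := by
  classical
  have hinj : Function.Injective e := fun a b hab => by
    have h := congrArg Fin.val hab
    rw [he, he] at h
    exact Fin.ext (by omega)
  have key : ∀ j : Fin m, k < (Finset.univ.filter fun a : Fin m =>
      p + (a : ℕ) ∈ S ∧ t (e a) ≠ X (j + a)).card := by
    intro j
    by_contra hle
    push Not at hle
    -- Keep the letters read, copy the rotation onto the unread part of the block, and leave the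
    -- text outside the block as it is.
    refine hno (hS (fun i => if (i : ℕ) ∈ S then t i else
      Function.extend e (fun a => X (j + a)) t i) (fun i hi => by simp [hi]) ?_)
    refine (isOccurrence_ofFn_iff e he hp).2 ⟨j, (editDist_ofFn_le _ _).trans (le_trans ?_ hle)⟩
    refine Finset.card_le_card fun a ha => ?_
    simp only [Finset.mem_filter, Finset.mem_univ, true_and, Function.comp, he,
      hinj.extend_apply] at ha ⊢
    split_ifs at ha with h
    · exact ⟨h, ha⟩
    · exact absurd rfl ha
  rw [max_lt_iff]
  refine ⟨(key 0).trans_le (Finset.card_le_card fun a ha => ?_), ?_⟩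
  · simp only [Finset.mem_filter, Finset.mem_univ, true_and] at ha ⊢
    exact ha.1
  · by_contra hle
    push Not at hle
    -- Universality speaks of exactly `l` positions, so the set of positions read is padded.
    obtain ⟨U, hU, hUl⟩ := Finset.exists_superset_card_eq hle (by simpa using hl)
    obtain ⟨j, hj⟩ := hX (U.orderEmbOfFin hUl) (U.orderEmbOfFin hUl).injective
      (fun a => t (e (U.orderEmbOfFin hUl a)))
    have h := key j
    rw [Finset.filter_false_of_mem] at h
    · simp at h
    · rintro a - ⟨ha, hne⟩
      have haU : a ∈ U := hU (by simpa using ha)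
      rw [← Finset.mem_coe, ← Finset.range_orderEmbOfFin U hUl] at haU
      obtain ⟨b, rfl⟩ := haU
      exact hne (hj b).symm

-- Each of `m` rotations is close to at most `(m.choose k) ^ 2 * σ ^ k` strings of length `m`. Since
-- `2 k ≤ m`, all the combinatorial factors together are at most `16 ^ m ≤ 256 ^ (m - k)`, whence
-- the condition on `σ`.
open Classical in
theorem card_isOccurrence_le {σ m n k p : ℕ} [NeZero m] (hσ : 256 ≤ σ) (hk : 2 * k ≤ m)
    (X : Fin m → Fin σ) (hp : p + m ≤ n) :
    (Finset.univ.filter fun t : Fin n → Fin σ =>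
      IsOccurrence (List.ofFn X) (List.ofFn t) k p m).card * 2 ≤ σ ^ n := by
  let e : Fin m → Fin n := fun a => ⟨p + a, by omega⟩
  have hinj : Function.Injective e := fun a b hab => by
    have h := congrArg Fin.val hab
    exact Fin.ext (by simpa [e] using h)
  let B : Finset (Fin m → Fin σ) := Finset.univ.biUnion fun j : Fin m =>
    Finset.univ.filter fun v => editDist (List.ofFn v) (List.ofFn fun a => X (j + a)) ≤ k
  have hm : 0 < m := NeZero.pos m
  have hB : B.card * 2 ≤ σ ^ m := by
    have h1 : B.card ≤ m * (m.choose (m - k) ^ 2 * σ ^ k) := by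
      refine Finset.card_biUnion_le.trans ((Finset.sum_le_card_nsmul _ _
        (m.choose (m - k) ^ 2 * σ ^ k) fun j _ => ?_).trans_eq (by simp))
      have := card_close_prefix_le (List.ofFn fun a => X (j + a)) (Nat.sub_le m k)
        (Finset.univ.filter fun v => editDist (List.ofFn v) (List.ofFn fun a => X (j + a)) ≤ k)
        (fun v hv => ⟨_, List.prefix_rfl, by
          rw [show m - (m - k) = k by omega]; simpa using hv⟩)
      rwa [show m - (m - k) = k by omega, Fintype.card_fin] at this
    have h2 : m * 2 ≤ 4 ^ m := by
      have h3 : m < 2 ^ m := Nat.lt_two_pow_self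
      have h4 : 2 ≤ 2 ^ m := Nat.le_self_pow hm.ne' 2
      calc m * 2 ≤ 2 ^ m * 2 ^ m := Nat.mul_le_mul h3.le h4
        _ = 4 ^ m := by rw [← mul_pow]; norm_num
    have h5 : m.choose (m - k) ^ 2 ≤ 4 ^ m := by
      calc m.choose (m - k) ^ 2 ≤ (2 ^ m) ^ 2 := Nat.pow_le_pow_left (Nat.choose_le_two_pow _ _) 2
        _ = 4 ^ m := by rw [← pow_mul, mul_comm, pow_mul]; norm_num
    calc B.card * 2 ≤ m * (m.choose (m - k) ^ 2 * σ ^ k) * 2 := Nat.mul_le_mul_right _ h1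
      _ = m * 2 * m.choose (m - k) ^ 2 * σ ^ k := by ring
      _ ≤ 4 ^ m * 4 ^ m * σ ^ k := by gcongr
      _ = 16 ^ m * σ ^ k := by rw [← mul_pow]; norm_num
      _ ≤ 16 ^ (2 * (m - k)) * σ ^ k :=
          Nat.mul_le_mul_right _ (Nat.pow_le_pow_right (by norm_num) (by omega))
      _ = 256 ^ (m - k) * σ ^ k := by rw [pow_mul]; norm_num
      _ ≤ σ ^ (m - k) * σ ^ k := by gcongr
      _ = σ ^ m := by rw [← pow_add]; congr 1; omega
  have h := card_filter_comp_mul e hinj (Finset.univ : Finset (Fin n → Fin σ)) (by simp) B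
  have heq : (Finset.univ.filter fun t : Fin n → Fin σ =>
      IsOccurrence (List.ofFn X) (List.ofFn t) k p m) =
      Finset.univ.filter fun t : Fin n → Fin σ => t ∘ e ∈ B := by
    ext t
    simp [isOccurrence_ofFn_iff e (fun a => rfl) hp, B]
  rw [heq]
  simp only [Finset.card_univ, Fintype.card_fun, Fintype.card_fin] at h
  have hpos : 0 < σ ^ m := Nat.pow_pos (by omega)
  refine Nat.le_of_mul_le_mul_right (?_ : _ * σ ^ m ≤ σ ^ n * σ ^ m) hpos
  calc _ = (Finset.univ.filter fun t : Fin n → Fin σ => t ∘ e ∈ B).card * σ ^ m * 2 := by ring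
    _ = σ ^ n * (B.card * 2) := by rw [h]; ring
    _ ≤ _ := Nat.mul_le_mul_left _ hB

-- Blocks starting at multiples of `m` are disjoint, so the letters read in them add up; the
-- quotient `i / m` tells the block of position `i`.
open Classical in
theorem Algorithm.Solves.sum_not_isOccurrence_le {σ m n k l : ℕ} [NeZero m] {X : Fin m → Fin σ}
    (hX : Universal l X) (hl : l ≤ m) {A : Algorithm} {word size Tp : ℕ}
    {Ts : (Fin n → Fin σ) → ℕ} (h : A.Solves word size (List.ofFn X) k n Tp Ts)
    (t : Fin n → Fin σ) :
    (∑ g ∈ Finset.range (n / m), if IsOccurrence (List.ofFn X) (List.ofFn t) k (g * m) m then 0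
      else max k l + 1) ≤ Ts t := by
  obtain ⟨S, hS, hr⟩ := h.exists_reads t
  have hm : 0 < m := NeZero.pos m
  calc _ ≤ ∑ g ∈ Finset.range (n / m), (S.filter fun i => i / m = g).card := by
        refine Finset.sum_le_sum fun g hg => ?_
        split_ifs with hocc
        · exact Nat.zero_le _
        have hp : g * m + m ≤ n := by
          rw [← Nat.succ_mul]
          exact (Nat.le_div_iff_mul_le hm).1 (Finset.mem_range.1 hg)
        refine (card_reads_gt hX hl (p := g * m) (fun a => ⟨g * m + a, by omega⟩) (fun a => rfl) hp
          (fun t' ht' => hr t' ht' _ _) hocc).trans_le ?_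
        refine Finset.card_le_card_of_injOn (fun a => g * m + a) (fun a ha => ?_)
          fun a _ b _ hab => Fin.ext (by simpa using hab)
        simp only [Finset.coe_filter, Finset.mem_univ, true_and, Set.mem_ofPred_eq] at ha ⊢
        refine ⟨ha, ?_⟩
        rw [mul_comm, Nat.mul_add_div hm, Nat.div_eq_of_lt a.2, add_zero]
    _ ≤ S.card := by
        rw [← Finset.card_biUnion]
        · exact Finset.card_le_card (Finset.biUnion_subset.2 fun g _ => Finset.filter_subset _ _)
        · intro g _ g' _ hgg'
          refine Finset.disjoint_left.2 fun i hi hi' => hgg' ?_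
          exact (Finset.mem_filter.1 hi).2.symm.trans (Finset.mem_filter.1 hi').2
    _ ≤ Ts t := hS

theorem Algorithm.Solves.le_sum {σ m n k l : ℕ} [NeZero m] (hσ : 256 ≤ σ) (hk : 2 * k ≤ m)
    {X : Fin m → Fin σ} (hX : Universal l X) (hl : l ≤ m) {A : Algorithm} {word size Tp : ℕ}
    {Ts : (Fin n → Fin σ) → ℕ} (h : A.Solves word size (List.ofFn X) k n Tp Ts) :
    n / m * (max k l + 1) * σ ^ n ≤ 2 * ∑ t, Ts t := by
  classical
  have h1 := Finset.sum_le_sum fun t (_ : t ∈ (Finset.univ : Finset (Fin n → Fin σ))) =>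
    h.sum_not_isOccurrence_le hX hl t
  rw [Finset.sum_comm] at h1
  refine le_trans ?_ (Nat.mul_le_mul_left 2 h1)
  rw [Finset.mul_sum, mul_assoc]
  refine (Finset.card_nsmul_le_sum _ _ ((max k l + 1) * σ ^ n) fun g hg => ?_).trans_eq' (by simp)
  have hp : g * m + m ≤ n := by
    rw [← Nat.succ_mul]
    exact (Nat.le_div_iff_mul_le (NeZero.pos m)).1 (Finset.mem_range.1 hg)
  have h2 := card_isOccurrence_le hσ hk X hp
  have h3 := Finset.card_filter_add_card_filter_not (s := (Finset.univ : Finset (Fin n → Fin σ)))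
    (fun t => IsOccurrence (List.ofFn X) (List.ofFn t) k (g * m) m)
  simp only [Finset.card_univ, Fintype.card_fun, Fintype.card_fin] at h3
  rw [Finset.sum_ite, Finset.sum_const_zero, zero_add, Finset.sum_const, smul_eq_mul]
  calc (max k l + 1) * σ ^ n ≤ (max k l + 1) * (2 * (Finset.univ.filter fun t : Fin n → Fin σ =>
        ¬ IsOccurrence (List.ofFn X) (List.ofFn t) k (g * m) m).card) :=
        Nat.mul_le_mul_left _ (by omega)
    _ = _ := by ring

theorem exists_hard_pattern {σ : ℕ} (hσ : 256 ≤ σ) : ∃ (κ : ℝ) (M : ℕ), 0 < κ ∧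
    ∀ m k : ℕ, M ≤ m → (k : ℝ) / m < 1 / 2 →
      ∃ x : List (Fin σ), x.length = m ∧
        ∀ n : ℕ, m < n →
          ∀ (A : Algorithm) (word size Tp : ℕ) (Ts : (Fin n → Fin σ) → ℕ),
            A.Solves word size x k n Tp Ts →
              κ * (n * (k + Real.logb σ m) / m) ≤ expectedTime Ts := by
  -- The 36 collects 2 for the texts without occurrence at a block, 2 for rounding `n / m`, and 9
  -- for `max k l + 1` against `k + log_σ m`. The bound `σ ^ 8 ≤ m` makes `l` positive.
  refine ⟨1 / 36, max (σ ^ 8) 4097, by norm_num, fun m k hm hkm => ?_⟩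
  obtain ⟨hσm, hm'⟩ := max_le_iff.1 hm
  have : NeZero m := ⟨by omega⟩
  have hm0 : (0 : ℝ) < m := by exact_mod_cast NeZero.pos m
  have hk : 2 * k ≤ m := by
    rw [div_lt_iff₀ hm0] at hkm
    have : (2 * k : ℝ) ≤ m := by linarith
    exact_mod_cast this
  have hlog : 8 ≤ Nat.log σ m := Nat.le_log_of_pow_le (by omega) hσm
  obtain ⟨l, hl⟩ : ∃ l, l = Nat.log σ m / 8 := ⟨_, rfl⟩
  have hlm : (σ ^ l) ^ 8 ≤ m := by
    rw [← pow_mul]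
    exact (Nat.pow_le_pow_right (by omega) (by omega)).trans (Nat.pow_log_le_self σ (by omega))
  have hlem : l ≤ m := by
    have := Nat.log_lt_self σ (x := m) (by omega)
    omega
  obtain ⟨X, hX⟩ := exists_universal (m := m) (l := l) (σ := σ) (by omega) (by omega)
    ((Nat.le_self_pow (by norm_num) σ).trans hσm) (by omega) hlm
  refine ⟨List.ofFn X, by simp, fun n hn A word size Tp Ts hA => ?_⟩
  have h1 := hA.le_sum hσ hk hX hlem
  have hσ0 : (0 : ℝ) < (σ : ℝ) ^ n := pow_pos (by exact_mod_cast (by omega : 0 < σ)) n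
  have hG : n ≤ 2 * (n / m) * m := by
    have h2 := Nat.lt_div_mul_add (a := n) (NeZero.pos m)
    have h3 : 1 ≤ n / m := (Nat.one_le_div_iff (NeZero.pos m)).2 hn.le
    nlinarith
  have hGr : (n : ℝ) / m ≤ 2 * (n / m : ℕ) := by
    rw [div_le_iff₀ hm0]
    exact_mod_cast hG
  have hW : k + Real.logb σ m ≤ 9 * ((max k l + 1 : ℕ) : ℝ) := by
    have h2 := logb_lt_natLog (σ := σ) (m := m) (by omega) (by omega)
    have h3 : k + (Nat.log σ m + 1) ≤ 9 * (max k l + 1) := by omega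
    have h4 : (k : ℝ) + (Nat.log σ m + 1) ≤ 9 * ((max k l + 1 : ℕ) : ℝ) := by exact_mod_cast h3
    linarith
  have hlog0 : 0 ≤ Real.logb σ m := Real.logb_nonneg (by exact_mod_cast (by omega : 1 < σ))
    (by exact_mod_cast NeZero.pos m)
  have h1' : ((n / m : ℕ) : ℝ) * ((max k l + 1 : ℕ) : ℝ) * (σ : ℝ) ^ n ≤ 2 * ∑ t, (Ts t : ℝ) := by
    exact_mod_cast h1
  rw [expectedTime, le_div_iff₀ hσ0]
  calc 1 / 36 * (n * (k + Real.logb σ m) / m) * (σ : ℝ) ^ n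
      = 1 / 36 * ((n / m : ℝ) * (k + Real.logb σ m)) * (σ : ℝ) ^ n := by ring
    _ ≤ 1 / 36 * (2 * (n / m : ℕ) * (9 * ((max k l + 1 : ℕ) : ℝ))) * (σ : ℝ) ^ n := by gcongr
    _ = ((n / m : ℕ) : ℝ) * ((max k l + 1 : ℕ) : ℝ) * (σ : ℝ) ^ n / 2 := by ring
    _ ≤ _ := by linarith

end CircularMatching

theorem mainTheorem1 :
    ∃ C : ℝ, 0 < C ∧ ∀ σ : ℕ, 2 ≤ σ → 0 < 1 / 2 - C / √(σ : ℝ) →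
      -- one algorithm with the claimed expected search time, for all patterns
      (∃ c : ℝ, 0 < c ∧ c < 1 - Real.exp 1 / √(σ : ℝ) ∧ 0 < gramExponent σ c ∧
        ∃ (A : Algorithm) (K B M : ℕ),
          ∀ (m k n : ℕ) (x : List (Fin σ)), M ≤ m → (k : ℝ) / m < 1 / 2 - C / √(σ : ℝ) →
            m < n → x.length = m → ∀ word : ℕ, n ^ B ≤ word →
              ∃ (Tp : ℕ) (Ts : (Fin n → Fin σ) → ℕ),
                A.Solves word (K * σ ^ gramLength σ c m k) x k n Tp Ts ∧
                Tp ≤ K * (σ ^ gramLength σ c m k * m * gramLength σ c m k) ∧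
                expectedTime Ts ≤ K * (n * (k + Real.logb σ m) / m)) ∧
      -- no algorithm has a smaller order of expected search time
      (∃ (κ : ℝ) (M : ℕ), 0 < κ ∧
        ∀ m k : ℕ, M ≤ m → (k : ℝ) / m < 1 / 2 - C / √(σ : ℝ) →
          ∃ x : List (Fin σ), x.length = m ∧
            ∀ n : ℕ, m < n →
              ∀ (A : Algorithm) (word size Tp : ℕ) (Ts : (Fin n → Fin σ) → ℕ),
                A.Solves word size x k n Tp Ts →
                  κ * (n * (k + Real.logb σ m) / m) ≤ expectedTime Ts) := by
  refine ⟨1000, by norm_num, fun σ hσ hpos => ?_⟩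
  have hs : 0 < √(σ : ℝ) := Real.sqrt_pos.2 (by exact_mod_cast (by omega : 0 < σ))
  -- Positivity of the bound on `k / m` alone makes the alphabet this large.
  have hs' : 2000 < √(σ : ℝ) := by
    have h : 1000 / √(σ : ℝ) < 1 / 2 := by linarith
    rw [div_lt_iff₀ hs] at h
    linarith
  have hσ' : 256 ≤ σ := by
    have h := Real.sq_sqrt (Nat.cast_nonneg (α := ℝ) σ)
    have : (256 : ℝ) ≤ σ := by nlinarith
    exact_mod_cast this
  refine ⟨exists_gramAlgorithm hs', ?_⟩
  obtain ⟨κ, M, hκ, h⟩ := exists_hard_pattern hσ'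
  refine ⟨κ, M, hκ, fun m k hm hk => h m k hm (hk.trans_le ?_)⟩
  have : 0 < 1000 / √(σ : ℝ) := by positivity
  linarith
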